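/- Let $k$ be a commutative ring. Categories. Let $\mathcal F(as)$ be the category whose objects are the sets $\underline n=\{1,\dots,n\}$, $n\ge 0$, and whose morphisms are set maps together with a total ordering of each preimage set; in a composite $gf$ the preimage of $i$ is ordered as the ordered disjoint union, over $b$ in the ordered set $g^{-1}(i)$, of the ordered sets $f^{-1}(b)$. Permutations are regarded as morphisms of $\mathcal F(as)$, and $f_1\odot\cdots\odot f_m$ denotes the disjoint union. For $\sigma\in S_m$ and $p_1,\dots,p_m\ge 0$, $\sigma\{p_1,\dots,p_m\}\in S_{p_1+\cdots+p_m}$ is the permutation that carries the $s$-th block (of size $p_s$) in order to position $\sigma(s)$. Put $\mathscr D_{\mathrm{cat}}(m)=ES_m$ (objects the elements of $S_m$, exactly one morphism between any two objects, right action of $S_m$ by right multiplication) and $\mathscr K_{\mathrm{cat}}(m)=\underline m\setminus\mathcal F(as)$ (the category of morphisms with source $\underline m$, with right action of $S_m$ by precomposition). Let $\delta:\mathscr D_{\mathrm{cat}}(m)\times\prod_s\mathscr D_{\mathrm{cat}}(j_s)\to\mathscr D_{\mathrm{cat}}(\sum j_s)$ be the functor $(\sigma,\tau_1,\dots,\tau_m)\mapsto\sigma\{j_1,\dots,j_m\}(\tau_1\oplus\cdots\oplus\tau_m)$,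 and let $\mu:\mathscr D_{\mathrm{cat}}(m)\times\prod_s\mathscr K_{\mathrm{cat}}(j_s)\to\mathscr K_{\mathrm{cat}}(\sum j_s)$ be the functor given on objects $f_s:\underline{j_s}\to\underline{p_s}$ by $\mu(\sigma,f_1,\dots,f_m)=\sigma\{p_1,\dots,p_m\}(f_1\odot\cdots\odot f_m)$, which sends the morphism $(\sigma,f_s)\to(\tau,g_sf_s)$ given by $g_s:\underline{p_s}\to\underline{q_s}$ to $\tau\{q_1,\dots,q_m\}(g_1\odot\cdots\odot g_m)\sigma\{p_1,\dots,p_m\}^{-1}$. Chains. Let $N$ be the nerve, $k[-]$ the degreewise free $k$-module functor from simplicial sets to simplicial $k$-modules, and $\mathcal N$ the normalization functor (alternating face complex modulo degenerate simplices) from simplicial $k$-modules to non-negatively graded chain complexes of $k$-modules. Put $\mathscr D_{\mathrm{ch}}=\mathcal N k[N\mathscr D_{\mathrm{cat}}]$ and $\mathscr K_{\mathrm{ch}}=\mathcal N k[N\mathscr K_{\mathrm{cat}}]$, with the induced right actions of the symmetric groups. Chain complexes have the usual tensor product, with symmetry $x\otimes y\mapsto(-1)^{|x||y|}y\otimes x$.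 For categories $C_0,\dots,C_m,E$ and a functor $F:C_0\times\cdots\times C_m\to E$ let $$F_*:\mathcal Nk[NC_0]\otimes\cdots\otimes\mathcal Nk[NC_m]\to\mathcal Nk[NE]$$ be the iterated Eilenberg–Zilber shuffle map, composed with the identifications $k[X]\,\widehat\otimes\,k[Y]\cong k[X\times Y]$ (where $\widehat\otimes$ is the degreewise tensor product) and $NA\times NB\cong N(A\times B)$, followed by the map induced by $F$. Theorem. The maps $$\delta_*:\mathscr D_{\mathrm{ch}}(m)\otimes\mathscr D_{\mathrm{ch}}(j_1)\otimes\cdots\otimes\mathscr D_{\mathrm{ch}}(j_m)\to\mathscr D_{\mathrm{ch}}(j_1+\cdots+j_m),$$ $$\widetilde\mu_*=\mu_*:\mathscr D_{\mathrm{ch}}(m)\otimes\mathscr K_{\mathrm{ch}}(j_1)\otimes\cdots\otimes\mathscr K_{\mathrm{ch}}(j_m)\to\mathscr K_{\mathrm{ch}}(j_1+\cdots+j_m)$$ ($m,j_1,\dots,j_m\ge 0$) are well-defined morphisms of chain complexes. The maps $\delta_*$, with the unit $k\to\mathscr D_{\mathrm{ch}}(1)$ that sends $1$ to the class of the identity permutation,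 make $\mathscr D_{\mathrm{ch}}$ an operad of chain complexes: $\mathscr D_{\mathrm{ch}}(0)\cong k$, and the associativity axiom, the left and right unit axioms, and the two equivariance axioms (for block permutations $\sigma\{j_1,\dots,j_m\}$ and for sums $\tau_1\oplus\cdots\oplus\tau_m$) hold. The maps $\widetilde\mu_*$ make $\mathscr K_{\mathrm{ch}}$ a left $\mathscr D_{\mathrm{ch}}$-module: the corresponding associativity, left unit and two equivariance axioms hold. -/

import Mathlib

open CategoryTheory MonoidalCategory Simplicial Opposite

universe u

noncomputable section

namespace SymHomology

/-! ### The category of non-commutative sets -/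

/-- A morphism `m ⟶ n` of non-commutative sets: a set map `{1,…,m} → {1,…,n}` together with a
total ordering of each preimage set.  The ordering of the preimage of `i` is recorded by the list
`fib i` that enumerates this preimage, without repetition, in increasing order. -/
@[ext]
structure NCHom (m n : ℕ) where
  toFun : Fin m → Fin n
  fib : Fin n → List (Fin m)
  nodup_fib : ∀ i, (fib i).Nodup
  mem_fib : ∀ i a, a ∈ fib i ↔ toFun a = i

namespace NCHom

/-- The identity. -/
def id (n : ℕ) : NCHom n n where
  toFun a := a
  fib i := [i]
  nodup_fib i := by simp
  mem_fib i a := by simp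

/-- Composition (first `f`, then `g`): the preimage of `i` under the composite is ordered as the
ordered disjoint union, over `b` in the ordered preimage of `i` under `g`, of the ordered preimages
of `b` under `f`. -/
def comp {l m n : ℕ} (f : NCHom l m) (g : NCHom m n) : NCHom l n where
  toFun a := g.toFun (f.toFun a)
  fib i := (g.fib i).flatMap f.fib
  nodup_fib i := by
    rw [List.nodup_flatMap]
    refine ⟨fun b _ => f.nodup_fib b, (g.nodup_fib i).imp ?_⟩
    intro b c hbc a hb hc
    rw [f.mem_fib] at hb hc
    exact hbc (hb.symm.trans hc)
  mem_fib i a := by simp [f.mem_fib, g.mem_fib]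

/-- A permutation, as an (invertible) morphism of non-commutative sets. -/
def ofPerm {n : ℕ} (σ : Equiv.Perm (Fin n)) : NCHom n n where
  toFun := σ
  fib i := [σ⁻¹ i]
  nodup_fib i := by simp
  mem_fib i a := by rw [List.mem_singleton, Equiv.Perm.eq_inv_iff_eq]

/-- The ordered preimages under the disjoint union of the maps `f_s`. -/
def sigmaFib {m : ℕ} {p q : Fin m → ℕ} (f : ∀ s, NCHom (p s) (q s)) (x : Σ s, Fin (q s)) :
    List (Σ s, Fin (p s)) := ((f x.1).fib x.2).map (Sigma.mk x.1)

lemma mem_sigmaFib {m : ℕ} {p q : Fin m → ℕ} (f : ∀ s, NCHom (p s) (q s)) (x : Σ s, Fin (q s))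
    (a : Σ s, Fin (p s)) : a ∈ sigmaFib f x ↔ Sigma.map _root_.id (fun s => (f s).toFun) a = x := by
  obtain ⟨s, i⟩ := x
  obtain ⟨t, a⟩ := a
  simp only [sigmaFib, List.mem_map, (f _).mem_fib, Sigma.map, _root_.id]
  constructor
  · rintro ⟨b, rfl, h⟩
    cases h
    rfl
  · intro h
    cases h
    exact ⟨a, rfl, rfl⟩

/-- The product `f_1 ⊙ … ⊙ f_m`: disjoint union, `f_s` being applied to the `s`-th block. -/
def oplus {m : ℕ} {p q : Fin m → ℕ} (f : ∀ s, NCHom (p s) (q s)) :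
    NCHom (∑ s, p s) (∑ s, q s) where
  toFun a := finSigmaFinEquiv (Sigma.map _root_.id (fun s => (f s).toFun) (finSigmaFinEquiv.symm a))
  fib i := (sigmaFib f (finSigmaFinEquiv.symm i)).map finSigmaFinEquiv
  nodup_fib i := List.Nodup.map finSigmaFinEquiv.injective
    (List.Nodup.map sigma_mk_injective ((f _).nodup_fib _))
  mem_fib i a := by
    rw [List.mem_map]
    constructor
    · rintro ⟨b, hb, rfl⟩
      rw [mem_sigmaFib] at hb
      rw [Equiv.symm_apply_apply, hb, Equiv.apply_symm_apply]
    · rintro rfl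
      exact ⟨finSigmaFinEquiv.symm a, by rw [mem_sigmaFib, Equiv.symm_apply_apply], by simp⟩

end NCHom

/-- The objects `0, 1, 2, …` of the category of non-commutative sets. -/
structure NCSet where
  card : ℕ

/-- The category of non-commutative sets. -/
instance : Category NCSet where
  Hom X Y := NCHom X.card Y.card
  id X := NCHom.id X.card
  comp f g := NCHom.comp f g
  id_comp f := by ext <;> simp [NCHom.id, NCHom.comp]
  comp_id f := by ext <;> simp [NCHom.id, NCHom.comp]
  assoc f g h := by ext <;> simp [NCHom.comp, List.flatMap_assoc]

/-- A permutation of `n` letters, as an endomorphism of the object `n`. -/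
def permHom {n : ℕ} (σ : Equiv.Perm (Fin n)) : NCSet.mk n ⟶ NCSet.mk n := NCHom.ofPerm σ

/-- `f_1 ⊙ … ⊙ f_m`, as a morphism. -/
def oplusHom {m : ℕ} {X Y : Fin m → NCSet} (f : ∀ s, X s ⟶ Y s) :
    NCSet.mk (∑ s, (X s).card) ⟶ NCSet.mk (∑ s, (Y s).card) := NCHom.oplus f

/-- `permHom` turns products of permutations (`σ * τ` is `τ` followed by `σ`) into composites. -/
lemma permHom_mul {n : ℕ} (σ τ : Equiv.Perm (Fin n)) :
    permHom (σ * τ) = permHom τ ≫ permHom σ :=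
  NCHom.ext rfl (by funext i; rfl)

lemma permHom_one (n : ℕ) : permHom (1 : Equiv.Perm (Fin n)) = 𝟙 _ := NCHom.ext rfl rfl

lemma oplusHom_id {m : ℕ} (X : Fin m → NCSet) :
    oplusHom (fun s => 𝟙 (X s)) = 𝟙 _ :=
  NCHom.ext (by funext a; exact finSigmaFinEquiv.apply_symm_apply a)
    (by funext i; exact congrArg (fun x => [x]) (finSigmaFinEquiv.apply_symm_apply i))

lemma oplusHom_comp {m : ℕ} {X Y Z : Fin m → NCSet} (f : ∀ s, X s ⟶ Y s) (g : ∀ s, Y s ⟶ Z s) :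
    oplusHom (fun s => f s ≫ g s) = oplusHom f ≫ oplusHom g := by
  refine NCHom.ext ?_ ?_
  · funext a
    refine congrArg (fun x => finSigmaFinEquiv
        (Sigma.map (β₁ := fun s => Fin (Y s).card) (β₂ := fun s => Fin (Z s).card) id
          (fun s => (g s).toFun) x))
      (Equiv.symm_apply_apply finSigmaFinEquiv (Sigma.map (β₂ := fun s => Fin (Y s).card) id
        (fun s => (f s).toFun) (finSigmaFinEquiv.symm a))).symm
  · funext i
    change _ = List.flatMap _ (List.map _ _)
    rw [List.flatMap_map]
    change List.map _ (List.map _ (List.flatMap _ _)) = List.flatMap _ (List.map _ _)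
    rw [List.flatMap_map, List.map_flatMap, List.map_flatMap]
    refine congrArg (fun F => List.flatMap F _) (funext fun b => ?_)
    change _ = List.map _ (NCHom.sigmaFib f (finSigmaFinEquiv.symm (finSigmaFinEquiv _)))
    rw [Equiv.symm_apply_apply]
    rfl

/-! ### Block permutations -/

/-- The block permutation `σ{j_1,…,j_m}` of `j_1 + … + j_m` letters: the `s`-th block, of size
`j_s`, is carried in order to position `σ(s)`, the blocks in the target being of sizes
`j_{σ⁻¹(1)}, …, j_{σ⁻¹(m)}`. -/
def blockPerm {m : ℕ} (σ : Equiv.Perm (Fin m)) (j : Fin m → ℕ) : Equiv.Perm (Fin (∑ s, j s)) :=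
  ((finCongr (Equiv.sum_comp σ⁻¹ j).symm).trans
    ((finSigmaFinEquiv (n := fun t => j (σ⁻¹ t))).symm.trans
      ((Equiv.sigmaCongrLeft (β := fun s => Fin (j s)) σ⁻¹).trans finSigmaFinEquiv))).symm

/-- The permutation `τ_1 ⊕ … ⊕ τ_m`, acting by `τ_s` on the `s`-th block. -/
def sumPerm {m : ℕ} {j : Fin m → ℕ} (τ : ∀ s, Equiv.Perm (Fin (j s))) :
    Equiv.Perm (Fin (∑ s, j s)) :=
  finSigmaFinEquiv.permCongr (Equiv.sigmaCongrRight τ)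

/-! ### Symmetric sequences -/

/-- A functor from the opposite of the symmetric groupoid to `C`: a sequence of objects with right
actions of the symmetric groups. -/
structure SymmSeq (C : Type*) [Category C] where
  obj : ℕ → C
  act : ∀ {n : ℕ}, Equiv.Perm (Fin n) → (obj n ⟶ obj n)
  act_one : ∀ n : ℕ, act (1 : Equiv.Perm (Fin n)) = 𝟙 (obj n)
  act_mul : ∀ {n : ℕ} (σ τ : Equiv.Perm (Fin n)), act (σ * τ) = act σ ≫ act τ

/-- The image of a symmetric sequence under a functor. -/
def SymmSeq.map {C D : Type*} [Category C] [Category D] (F : C ⥤ D) (P : SymmSeq C) :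
    SymmSeq D where
  obj n := F.obj (P.obj n)
  act σ := F.map (P.act σ)
  act_one n := by rw [P.act_one, F.map_id]
  act_mul σ τ := by rw [P.act_mul, F.map_comp]

/-- The identification of `P(a)` with `P(b)` when `a = b`. -/
def SymmSeq.cast {C : Type*} [Category C] (P : SymmSeq C) {a b : ℕ} (h : a = b) :
    P.obj a ⟶ P.obj b := eqToHom (congrArg P.obj h)

/-! ### `D_cat` and `K_cat` -/

/-- `D_cat(m) = E S_m`: the objects are the elements of `S_m`, there is exactly one morphism between
any two objects, and `S_m` acts from the right by right multiplication. -/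
def Dcat : SymmSeq Cat.{0, 0} where
  obj m := Cat.of (Codiscrete (Equiv.Perm (Fin m)))
  act ρ := (Codiscrete.functorOfFun (fun σ => σ * ρ)).toCatHom
  act_one n := by
    have h : (fun σ : Equiv.Perm (Fin n) => σ * 1) = id := funext mul_one
    rw [h]
    rfl
  act_mul σ τ := by
    have h : (fun ρ => ρ * (σ * τ)) = (fun ρ => ρ * τ) ∘ (fun ρ => ρ * σ) :=
      funext fun ρ => (mul_assoc ρ σ τ).symm
    rw [h]
    rfl

/-- The operad structure functors of `D_cat`, on objects
`(σ, τ_1, …, τ_m) ↦ σ{k_1,…,k_m} (τ_1 ⊕ … ⊕ τ_m)`. -/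
def deltaCat (m : ℕ) (k : Fin m → ℕ) :
    (Codiscrete (Equiv.Perm (Fin m)) × (∀ s, Codiscrete (Equiv.Perm (Fin (k s))))) ⥤
      Codiscrete (Equiv.Perm (Fin (∑ s, k s))) :=
  Codiscrete.functor (fun x => blockPerm x.1.as k * sumPerm (fun s => (x.2 s).as))

/-- `K_cat(m)` is the category of objects under `m` in non-commutative sets; `S_m` acts from the
right by precomposition. -/
def Kcat : SymmSeq Cat.{0, 0} where
  obj m := Cat.of (Under (NCSet.mk m))
  act ρ := (Under.map (permHom ρ)).toCatHom
  act_one n := by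
    rw [permHom_one, Under.mapId_eq]
    rfl
  act_mul σ τ := by
    rw [permHom_mul, Under.mapComp_eq]
    rfl

/-- The functors `μ : D_cat(m) × K_cat(j_1) × … × K_cat(j_m) ⥤ K_cat(j_1 + … + j_m)`.
On objects, with `f_s : j_s ⟶ p_s`,
`μ(σ, f_1, …, f_m) = σ{p_1,…,p_m} ∘ (f_1 ⊙ … ⊙ f_m)`.
The morphism `(σ, f_s) ⟶ (τ, g_s ∘ f_s)` given by `g_s : p_s ⟶ q_s` goes to the morphism that
carries the block at position `σ(s)` by `g_s` to the block at position `τ(s)`, which is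
`τ{q_1,…,q_m} ∘ (g_1 ⊙ … ⊙ g_m) ∘ σ{p_1,…,p_m}⁻¹`; moving `σ{p_1,…,p_m}⁻¹` past the product,
this is `(τσ⁻¹){q_{σ⁻¹(1)},…,q_{σ⁻¹(m)}} ∘ (g_{σ⁻¹(1)} ⊙ … ⊙ g_{σ⁻¹(m)})`. -/
def muCat (m : ℕ) (j : Fin m → ℕ) :
    (Codiscrete (Equiv.Perm (Fin m)) × (∀ s, Under (NCSet.mk (j s)))) ⥤
      Under (NCSet.mk (∑ s, j s)) where
  obj x := Under.mk (oplusHom (X := fun s => NCSet.mk (j s)) (fun s => (x.2 s).hom) ≫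
    permHom (blockPerm x.1.as fun s => (x.2 s).right.card))
  map {x y} g := Under.homMk
    (permHom (blockPerm x.1.as fun s => (x.2 s).right.card)⁻¹ ≫
      oplusHom (fun s => (g.2 s).right) ≫
        permHom (blockPerm y.1.as fun s => (y.2 s).right.card)) (by
      dsimp only [Under.mk_hom]
      rw [Category.assoc, ← Category.assoc (permHom _) (permHom _), ← permHom_mul,
        inv_mul_cancel, permHom_one, Category.id_comp, ← Category.assoc, ← oplusHom_comp]
      have h (s) : (x.2 s).hom ≫ (g.2 s).right = (y.2 s).hom := Under.w (g.2 s)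
      simp only [h])
  map_id x := by
    refine Under.UnderMorphism.ext ?_
    have h : oplusHom (fun s => ((𝟙 x : x ⟶ x).2 s).right) = 𝟙 _ :=
      oplusHom_id fun s => (x.2 s).right
    change permHom _ ≫ oplusHom (fun s => ((𝟙 x : x ⟶ x).2 s).right) ≫ permHom _ = _
    rw [h, Category.id_comp, ← permHom_mul, mul_inv_cancel, permHom_one]
    rfl
  map_comp {x y z} f g := by
    refine Under.UnderMorphism.ext ?_
    have h : oplusHom (fun s => ((f ≫ g).2 s).right) =
        oplusHom (fun s => (f.2 s).right) ≫ oplusHom (fun s => (g.2 s).right) :=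
      oplusHom_comp (fun s => (f.2 s).right) (fun s => (g.2 s).right)
    change permHom _ ≫ oplusHom (fun s => ((f ≫ g).2 s).right) ≫ permHom _ =
      (permHom _ ≫ oplusHom (fun s => (f.2 s).right) ≫ permHom _) ≫
        (permHom _ ≫ oplusHom (fun s => (g.2 s).right) ≫ permHom _)
    rw [h]
    simp only [Category.assoc]
    rw [← Category.assoc (permHom _) (permHom _), ← permHom_mul, inv_mul_cancel, permHom_one,
      Category.id_comp]

/-! ### Linearization and normalization -/

variable (k : Type u) [CommRing k]

/-- The free `k`-module functor. -/
def freeMod : Type ⥤ ModuleCat.{u} k where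
  obj X := ModuleCat.of k (X →₀ k)
  map f := ModuleCat.ofHom (Finsupp.lmapDomain k k f)
  map_id X := by
    ext : 1
    exact Finsupp.lmapDomain_id k k
  map_comp f g := by
    ext : 1
    exact Finsupp.lmapDomain_comp k k f g

/-- The linearization functor `k[-]` from simplicial sets to simplicial `k`-modules. -/
def linearization : SSet.{0} ⥤ SimplicialObject (ModuleCat.{u} k) :=
  (SimplicialObject.whiskering _ _).obj (freeMod k)

variable {k}

/-- The submodule of degenerate `n`-simplices of a simplicial module: the span of the images of the
degeneracy operators. -/
def degenerate (A : SimplicialObject (ModuleCat.{u} k)) (n : ℕ) : Submodule k (A _⦋n⦌) :=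
  match n with
  | 0 => ⊥
  | n + 1 => ⨆ i : Fin (n + 1), LinearMap.range (A.σ i).hom

lemma degenerate_le_comap_map {A B : SimplicialObject (ModuleCat.{u} k)} (φ : A ⟶ B) (n : ℕ) :
    degenerate A n ≤ (degenerate B n).comap (φ.app (op ⦋n⦌)).hom := by
  cases n with
  | zero => exact bot_le
  | succ n =>
    refine iSup_le fun i => ?_
    rintro _ ⟨x, rfl⟩
    refine (le_iSup (fun i : Fin (n + 1) => LinearMap.range (B.σ i).hom) i) ⟨(φ.app _).hom x, ?_⟩
    have h := congrArg (fun f => f.hom x) (SimplicialObject.σ_naturality φ i)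
    exact h.symm

open AlgebraicTopology DoldKan in
lemma degenerate_le_comap_d (A : SimplicialObject (ModuleCat.{u} k)) (i j : ℕ) :
    degenerate A i ≤ (degenerate A j).comap
      (((alternatingFaceMapComplex _).obj A).d i j).hom := by
  intro y hy
  have h1 : (PInfty (X := A)).f i y = 0 := by
    cases i with
    | zero =>
      have hy : y = 0 := hy
      rw [hy, map_zero]
    | succ i =>
      have h : degenerate A (i + 1) ≤ LinearMap.ker ((PInfty (X := A)).f (i + 1)).hom := by
        refine iSup_le fun l => ?_
        rintro _ ⟨x, rfl⟩
        exact congrArg (fun f => f.hom x) (σ_comp_PInfty A l)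
      exact h hy
  set z : A _⦋j⦌ := (((alternatingFaceMapComplex _).obj A).d i j).hom y with hz
  have h2 : (PInfty (X := A)).f j z = 0 := by
    have h := congrArg (fun f => f.hom y) ((PInfty (X := A)).comm i j)
    have h' : (PInfty (X := A)).f j z =
      (((alternatingFaceMapComplex _).obj A).d i j).hom ((PInfty (X := A)).f i y) := h.symm
    rw [h', h1, map_zero]
  have h3 : (QInfty (X := A)).f j z = z := by
    have h := congrArg (fun f => f.hom z) (PInfty_f_add_QInfty_f (X := A) j)
    have h' : (PInfty (X := A)).f j z + (QInfty (X := A)).f j z = z := h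
    rwa [h2, zero_add] at h'
  change z ∈ degenerate A j
  rw [← h3]
  cases j with
  | zero =>
    rw [QInfty_f_0]
    exact Submodule.zero_mem _
  | succ j =>
    rw [QInfty_f, decomposition_Q]
    have h : ∀ f : Fin (j + 1) → (A _⦋j + 1⦌ ⟶ A _⦋j⦌), ∀ s : Finset (Fin (j + 1)),
        (∑ l ∈ s, f l ≫ A.σ (Fin.rev l)) z ∈ degenerate A (j + 1) := by
      intro f s
      change (∑ l ∈ s, f l ≫ A.σ (Fin.rev l)).hom z ∈ _
      rw [ModuleCat.hom_sum, LinearMap.sum_apply]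
      refine Submodule.sum_mem _ fun l _ => ?_
      exact (le_iSup (fun i : Fin (j + 1) => LinearMap.range (A.σ i).hom) (Fin.rev l)) ⟨f l z, rfl⟩
    simpa only [Category.assoc] using
      h (fun l => (P l.val).f (j + 1) ≫ A.δ l.rev.succ) (Finset.univ.filter fun l => l.val < j + 1)

variable (k) in
/-- The normalization functor: the quotient of the alternating face map complex by the subcomplex
of degenerate simplices. -/
def normalization : SimplicialObject (ModuleCat.{u} k) ⥤ ChainComplex (ModuleCat.{u} k) ℕ where
  obj A :=
    { X := fun n => ModuleCat.of k (A _⦋n⦌ ⧸ degenerate A n)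
      d := fun i j => ModuleCat.ofHom (Submodule.mapQ _ _
        (((AlgebraicTopology.alternatingFaceMapComplex _).obj A).d i j).hom
        (degenerate_le_comap_d A i j))
      shape := fun i j h => by
        ext x
        have h' := ((AlgebraicTopology.alternatingFaceMapComplex _).obj A).shape i j h
        exact congrArg (fun f => Submodule.mkQ (degenerate A j) (f.hom x)) h'
      d_comp_d' := fun i j l _ _ => by
        ext x
        have h' := ((AlgebraicTopology.alternatingFaceMapComplex _).obj A).d_comp_d i j l
        exact congrArg (fun f => Submodule.mkQ (degenerate A l) (f.hom x)) h' }
  map {A B} φ :=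
    { f := fun n => ModuleCat.ofHom (Submodule.mapQ _ _ (φ.app (op ⦋n⦌)).hom
        (degenerate_le_comap_map φ n))
      comm' := fun i j _ => by
        ext x
        have h' := ((AlgebraicTopology.alternatingFaceMapComplex _).map φ).comm i j
        exact congrArg (fun f => Submodule.mkQ (degenerate B j) (f.hom x)) h' }
  map_id A := by
    ext n x
    rfl
  map_comp {A B C} φ ψ := by
    ext n : 2
    apply Submodule.linearMap_qext
    rfl

/-- The class of an `n`-simplex in the normalization. -/
def toNormalization (A : SimplicialObject (ModuleCat.{u} k)) (n : ℕ) :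
    A _⦋n⦌ →ₗ[k] ((normalization k).obj A).X n := Submodule.mkQ (degenerate A n)

variable (k) in
/-- The composite of nerve, linearization and normalization. -/
def chains : Cat.{0, 0} ⥤ ChainComplex (ModuleCat.{u} k) ℕ :=
  nerveFunctor ⋙ linearization k ⋙ normalization k

variable (k) in
/-- `D_ch = 𝒩 k[N D_cat]`. -/
def Dch : SymmSeq (ChainComplex (ModuleCat.{u} k) ℕ) := Dcat.map (chains k)

variable (k) in
/-- `K_ch = 𝒩 k[N K_cat]`. -/
def Kch : SymmSeq (ChainComplex (ModuleCat.{u} k) ℕ) := Kcat.map (chains k)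

/-! ### Shuffles -/

/-- The `n`-simplices of `Δ^p × Δ^q` that are injective on vertices.  For `n = p + q` these are the
maximal chains in `[p] × [q]`, that is, the `(p, q)`-shuffles: the steps of the chain in the first
direction form the first part of the shuffle, the steps in the second direction its second part, and
the two components of the chain are the corresponding iterated degeneracies. -/
def Shuffle (p q n : ℕ) : Type :=
  {c : (⦋n⦌ ⟶ ⦋p⦌) × (⦋n⦌ ⟶ ⦋q⦌) // Function.Injective fun i : Fin (n + 1) => (c.1 i, c.2 i)}

instance (p q n : ℕ) : Fintype (Shuffle p q n) :=
  haveI : Finite (Shuffle p q n) := Subtype.finite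
  Fintype.ofFinite _

/-- The number of inversions of a shuffle: pairs `s < t` of steps such that step `s` is in the
second direction and step `t` is in the first direction. -/
def Shuffle.inv {p q n : ℕ} (c : Shuffle p q n) : ℕ :=
  (Finset.univ.filter fun x : Fin n × Fin n => x.1 < x.2 ∧
    c.1.2 x.1.castSucc < c.1.2 x.1.succ ∧ c.1.1 x.2.castSucc < c.1.1 x.2.succ).card

/-- The Eilenberg–Zilber shuffle map `A_p ⊗ B_q → (A ⊗̂ B)_n`, `n = p + q`, for the degreewise tensor
product `⊗̂`, as a bilinear map on simplices. -/
def shuffle (A B : SimplicialObject (ModuleCat.{u} k)) (p q n : ℕ) :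
    A _⦋p⦌ →ₗ[k] B _⦋q⦌ →ₗ[k] TensorProduct k (A _⦋n⦌) (B _⦋n⦌) :=
  ∑ c : Shuffle p q n, ((-1 : k) ^ c.inv) •
    (TensorProduct.mk k (A _⦋n⦌) (B _⦋n⦌)).compl₁₂ (A.map c.1.1.op).hom (B.map c.1.2.op).hom

/-- The shuffle map for linearizations of simplicial sets, composed with
`k[X] ⊗̂ k[Y] ≅ k[X × Y]`. -/
def linShuffle (X Y : SSet.{0}) (p q n : ℕ) (x : X _⦋p⦌ →₀ k) (y : Y _⦋q⦌ →₀ k) :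
    (X _⦋n⦌ × Y _⦋n⦌) →₀ k :=
  finsuppTensorFinsupp' k (X _⦋n⦌) (Y _⦋n⦌)
    (shuffle ((linearization k).obj X) ((linearization k).obj Y) p q n x y)

/-- The degreewise product of a finite family of simplicial sets. -/
def piSSet {m : ℕ} (X : Fin m → SSet.{0}) : SSet.{0} where
  obj Δ := ∀ s, (X s).obj Δ
  map f := ↾fun x s => (X s).map f (x s)
  map_id Δ := by
    ext x s
    exact congrArg (fun f => f (x s)) ((X s).map_id Δ)
  map_comp f g := by
    ext x s
    exact congrArg (fun h => h (x s)) ((X s).map_comp f g)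

/-- The iterated shuffle map `k[X_1]_{q_1} ⊗ … ⊗ k[X_m]_{q_m} → k[X_1 × … × X_m]_n`,
`n = q_1 + … + q_m`. -/
def iterShuffle {m : ℕ} (X : Fin m → SSet.{0}) (q : Fin m → ℕ) (n : ℕ)
    (x : ∀ s, (X s) _⦋q s⦌ →₀ k) : (∀ s, (X s) _⦋n⦌) →₀ k :=
  match m, X, q, x with
  | 0, _, _, _ => Finsupp.single (fun s => s.elim0) 1
  | _ + 1, X, q, x =>
    Finsupp.mapDomain (fun y => Fin.cons y.1 y.2)
      (linShuffle (X 0) (piSSet fun s => X s.succ) (q 0) (∑ s, q (Fin.succ s)) n (x 0)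
        (iterShuffle (fun s => X s.succ) (fun s => q s.succ) (∑ s, q (Fin.succ s))
          fun s => x s.succ))

/-- The map `N C × N C_1 × … × N C_m → N E` in degree `n` induced by a functor
`C × (C_1 × … × C_m) ⥤ E`. -/
def nerveAct {C E : Type} [Category.{0} C] [Category.{0} E] {m : ℕ} {B : Fin m → Type}
    [∀ s, Category.{0} (B s)] (F : C × (∀ s, B s) ⥤ E) (n : ℕ)
    (x : nerve C _⦋n⦌ × (∀ s, nerve (B s) _⦋n⦌)) : nerve E _⦋n⦌ :=
  (Functor.prod' (x.1 : ComposableArrows C n)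
    (Functor.pi' fun s => (x.2 s : ComposableArrows (B s) n))) ⋙ F

/-- The value of the map induced by a functor `F : C × (C_1 × … × C_m) ⥤ E` on normalized chains:
apply the iterated shuffle map to chains `x`, `y_1`, …, `y_m`, then `F`, then pass to the class in
the normalization. -/
def inducedChain {C E : Type} [Category.{0} C] [Category.{0} E] {m : ℕ} {B : Fin m → Type}
    [∀ s, Category.{0} (B s)] (F : C × (∀ s, B s) ⥤ E) (p : ℕ) (q : Fin m → ℕ)
    (x : nerve C _⦋p⦌ →₀ k) (y : ∀ s, nerve (B s) _⦋q s⦌ →₀ k) :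
    ((chains k).obj (Cat.of E)).X (p + ∑ s, q s) :=
  toNormalization ((linearization k).obj (nerve E)) (p + ∑ s, q s)
    (Finsupp.mapDomain (nerveAct F (p + ∑ s, q s))
      (linShuffle (nerve C) (piSSet fun s => nerve (B s)) p (∑ s, q s) (p + ∑ s, q s) x
        (iterShuffle (fun s => nerve (B s)) q (∑ s, q s) y)))

/-- The class of a chain on the nerve of a category in the normalization. -/
def chainClass {C : Type} [Category.{0} C] {p : ℕ} (x : nerve C _⦋p⦌ →₀ k) :
    ((chains k).obj (Cat.of C)).X p :=
  toNormalization ((linearization k).obj (nerve C)) p x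

/-! ### Operads and operad modules over the category of `k`-complexes -/

/-- The iterated tensor product of complexes. -/
def tensorFam {n : ℕ} (X : Fin n → ChainComplex (ModuleCat.{u} k) ℕ) :
    ChainComplex (ModuleCat.{u} k) ℕ :=
  match n, X with
  | 0, _ => 𝟙_ _
  | _ + 1, X => X 0 ⊗ tensorFam fun s => X s.succ

/-- The element `x ⊗ y` of the tensor product of two complexes. -/
def tmul {X Y : ChainComplex (ModuleCat.{u} k) ℕ} {p q n : ℕ} (h : p + q = n)
    (x : X.X p) (y : Y.X q) : (X ⊗ Y).X n :=
  (HomologicalComplex.ιTensorObj X Y p q n h).hom (TensorProduct.tmul k x y)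

variable (k) in
/-- The element `1` of the unit complex (`k` concentrated in degree `0`). -/
def unitElem : (𝟙_ (ChainComplex (ModuleCat.{u} k) ℕ)).X 0 :=
  (HomologicalComplex.singleObjXSelf (ComplexShape.down ℕ) 0 (𝟙_ (ModuleCat.{u} k))).inv.hom
    (1 : k)

/-- The element `x_1 ⊗ … ⊗ x_n` of an iterated tensor product of complexes.  Such elements
generate the tensor product. -/
def tprod {n : ℕ} {X : Fin n → ChainComplex (ModuleCat.{u} k) ℕ} {q : Fin n → ℕ}
    (x : ∀ s, (X s).X (q s)) : (tensorFam X).X (∑ s, q s) :=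
  match n, X, q, x with
  | 0, _, _, _ => unitElem k
  | _ + 1, _, _, x => tmul (Fin.sum_univ_succ _).symm (x 0) (tprod fun s => x s.succ)

/-- Families of morphisms `P(n) ⊗ M(j_1) ⊗ … ⊗ M(j_n) ⟶ M(j_1 + … + j_n)`. -/
abbrev StructureMaps (P M : SymmSeq (ChainComplex (ModuleCat.{u} k) ℕ)) :=
  ∀ (n : ℕ) (j : Fin n → ℕ), P.obj n ⊗ tensorFam (fun s => M.obj (j s)) ⟶ M.obj (∑ s, j s)

/-- The value of a structure map at `x ⊗ y_1 ⊗ … ⊗ y_n`. -/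
def StructureMaps.app {P M : SymmSeq (ChainComplex (ModuleCat.{u} k) ℕ)} (μ : StructureMaps P M)
    {n : ℕ} {j : Fin n → ℕ} {p : ℕ} {q : Fin n → ℕ} {N : ℕ} (h : p + ∑ s, q s = N)
    (x : (P.obj n).X p) (y : ∀ s, (M.obj (j s)).X (q s)) : (M.obj (∑ s, j s)).X N :=
  ((μ n j).f N).hom (tmul h x (tprod y))

/-- Letters of `j_1 + … + j_n` as pairs (block, letter in the block). -/
abbrev blockOf {n : ℕ} {j : Fin n → ℕ} (r : Fin (∑ s, j s)) : Σ s, Fin (j s) :=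
  finSigmaFinEquiv.symm r

lemma sum_blockOf {n : ℕ} {j : Fin n → ℕ} (i : ∀ s, Fin (j s) → ℕ) :
    ∑ r : Fin (∑ s, j s), i (blockOf r).1 (blockOf r).2 = ∑ s, ∑ r, i s r := by
  rw [← Fintype.sum_sigma' i]
  exact Equiv.sum_comp finSigmaFinEquiv.symm (fun x : Σ s, Fin (j s) => i x.1 x.2)

/-- The axioms of a left module `M`, with structure maps `μ`, over an operad `P` with structure maps
`γ` and unit `η`.  The diagrams are evaluated at tensor products of homogeneous elements; the signs
are those of the symmetry `x ⊗ y ↦ (-1)^{|x||y|} y ⊗ x` of the category of complexes. -/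
structure ModuleLaws {P M : SymmSeq (ChainComplex (ModuleCat.{u} k) ℕ)} (γ : StructureMaps P P)
    (η : 𝟙_ (ChainComplex (ModuleCat.{u} k) ℕ) ⟶ P.obj 1) (μ : StructureMaps P M) : Prop where
  /-- `μ(γ(x; y_1,…,y_n); z_{11},…) = ± μ(x; μ(y_1; z_{11},…),…,μ(y_n; z_{n1},…))`; the sign
  comes from moving every `y_s` past all `z_{t r}` with `t < s`. -/
  assoc : ∀ {n : ℕ} {j : Fin n → ℕ} {i : ∀ s, Fin (j s) → ℕ} {a : ℕ} {b : Fin n → ℕ}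
    {c : ∀ s, Fin (j s) → ℕ} {N : ℕ} (x : (P.obj n).X a) (y : ∀ s, (P.obj (j s)).X (b s))
    (z : ∀ s r, (M.obj (i s r)).X (c s r))
    (h : (a + ∑ s, b s) + ∑ r : Fin (∑ s, j s), c (blockOf r).1 (blockOf r).2 = N)
    (h' : a + ∑ s, (b s + ∑ r, c s r) = N),
    ((M.cast (sum_blockOf i)).f N).hom
        (μ.app h (γ.app rfl x y) (fun r => z (blockOf r).1 (blockOf r).2)) =
      ((-1 : k) ^ (∑ s, ∑ t, if t < s then b s * ∑ r, c t r else 0)) •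
        μ.app h' x (fun s => μ.app rfl (y s) (z s))
  /-- `μ(η(1); x) = x`. -/
  left_unit : ∀ {j q : ℕ} (x : (M.obj j).X q) (h : 0 + ∑ _s : Fin 1, q = q),
    ((M.cast (by simp)).f q).hom
        (μ.app (j := fun _ : Fin 1 => j) (q := fun _ => q) h ((η.f 0).hom (unitElem k))
          (fun _ => x)) = x
  /-- `μ(x.σ; y_1,…,y_n) = ± μ(x; y_{σ⁻¹(1)},…,y_{σ⁻¹(n)}).σ{j_1,…,j_n}`. -/
  equivariance_A : ∀ {n : ℕ} {j : Fin n → ℕ} {p : ℕ} {q : Fin n → ℕ} {N : ℕ}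
    (σ : Equiv.Perm (Fin n)) (x : (P.obj n).X p) (y : ∀ s, (M.obj (j s)).X (q s))
    (h : p + ∑ s, q s = N) (h' : p + ∑ s, q (σ⁻¹ s) = N),
    μ.app h (((P.act σ).f p).hom x) y =
      ((-1 : k) ^ (∑ s, ∑ t, if s < t ∧ σ t < σ s then q s * q t else 0)) •
        ((M.act (blockPerm σ j)).f N).hom
          (((M.cast (Equiv.sum_comp σ⁻¹ j)).f N).hom (μ.app h' x (fun s => y (σ⁻¹ s))))
  /-- `μ(x; y_1.τ_1,…,y_n.τ_n) = μ(x; y_1,…,y_n).(τ_1 ⊕ … ⊕ τ_n)`. -/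
  equivariance_B : ∀ {n : ℕ} {j : Fin n → ℕ} {p : ℕ} {q : Fin n → ℕ} {N : ℕ}
    (τ : ∀ s, Equiv.Perm (Fin (j s))) (x : (P.obj n).X p) (y : ∀ s, (M.obj (j s)).X (q s))
    (h : p + ∑ s, q s = N),
    μ.app h x (fun s => ((M.act (τ s)).f (q s)).hom (y s)) =
      ((M.act (sumPerm τ)).f N).hom (μ.app h x y)

/-- Operad structures on a symmetric sequence of complexes.  The axioms are those of a left module
of `P` over itself, together with the right unit condition and `P(0) ≅ k`. -/
structure OperadStructure (P : SymmSeq (ChainComplex (ModuleCat.{u} k) ℕ)) where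
  γ : StructureMaps P P
  η : 𝟙_ (ChainComplex (ModuleCat.{u} k) ℕ) ⟶ P.obj 1
  obj_zero : Nonempty (P.obj 0 ≅ 𝟙_ (ChainComplex (ModuleCat.{u} k) ℕ))
  laws : ModuleLaws γ η γ
  /-- `γ(x; η(1),…,η(1)) = x`. -/
  right_unit : ∀ {j p : ℕ} (x : (P.obj j).X p),
    ((P.cast (by simp)).f p).hom (γ.app (j := fun _ : Fin j => 1) (q := fun _ => 0) (by simp) x
      (fun _ => (η.f 0).hom (unitElem k))) = x

/-- (Left) module structures over an operad. -/
structure OperadModule {P : SymmSeq (ChainComplex (ModuleCat.{u} k) ℕ)} (O : OperadStructure P)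
    (M : SymmSeq (ChainComplex (ModuleCat.{u} k) ℕ)) where
  μ : StructureMaps P M
  laws : ModuleLaws O.γ O.η μ

end SymHomology

end

open SymHomology

/-!
The maps `δ_*` and `μ_*` are Eilenberg–Zilber maps followed by maps induced by functors, so the
axioms split into a statement about shuffles and a statement about the functors `δ` and `μ`.

**The maps are well defined.**  A shuffle product with a degenerate factor is degenerate for
dimension reasons (`normShuffle_σ_left`, `normShuffle_σ_right`), so the shuffle map descends to
normalized chains.  That it commutes with the differentials is the Leibniz rule modulo degenerate
chains, `normClass_bdry_linShuffle`.  It is proved by acyclic models: by naturality it suffices to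
consider the fundamental simplices of `Δ[p] × Δ[q]`, where the cone `c` over the bottom vertex
satisfies `d c = 1 - c d`.  Sorting shuffles by their first step shows that the product of the
fundamental simplices is the cone over its expected boundary (`normClass_cone_leibniz`); this
expected boundary is a cycle by induction on the degree, so applying `d` gives the claim.

**Shuffles.**  A maximal chain in a product of simplices is a word in the set of factors, each step
being labelled by the direction in which it moves.  Accordingly the `cross` product of a finite
family of chains is a signed sum over words, the sign being the parity of the inversions of the word
for a chosen order of the factors.  A word in a disjoint union of two alphabets is a pattern of two
letters together with two subwords, hence a shuffle product of cross products is a cross product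
(`linShuffle_cross`, `iterShuffle_cross`).  So both sides of the associativity axiom, and both sides
of the equivariance axiom for block permutations, are cross products of the same family of chains
for two orders of the factors, and changing the order costs the Koszul sign (`cross_reorder`).  This
gives `linShuffle_assoc` and `iterShuffle_perm`.  The unit axioms concern shuffle products with
vertices.  By `moduleLaws_chainStructure` it remains to check the axioms for the functors, applied
to sequences of composable arrows.

**Functors.**  A morphism of non-commutative sets is determined by its ordered preimages
(`ncHom_ext`), and a permutation is determined by the order in which it puts the letters
(`perm_eq_of_lt`).  Comparing preimages shows how disjoint unions interact with iteration and with
block permutations (`mu_assoc`, `oplusHom_blockPerm_mul`, `oplusHom_one`), which are the axioms for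
`μ` on objects; their compatibility with morphisms follows formally (`nerveLaws_muCat`).
Permutations are invertible morphisms of non-commutative sets, so the same identities, applied to
permutations, are the axioms for `δ` (`nerveLaws_deltaCat`); morphisms need no check there because
`E S_m` is codiscrete.
-/

noncomputable section

namespace SymHomology

variable {k : Type u} [CommRing k]

/-! ### Morphisms out of tensor products of complexes -/

/-- The morphism out of the tensor product of two complexes given by bilinear maps that satisfy the
Leibniz rule.  Only the bilinear maps with `p + q = n` matter.  The differential is always taken to
degree `p - 1`, which for `p = 0` means the zero map `X_0 → X_0`. -/
def tensorDesc {X Y Z : ChainComplex (ModuleCat.{u} k) ℕ}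
    (φ : ∀ p q n, X.X p →ₗ[k] Y.X q →ₗ[k] Z.X n)
    (hφ : ∀ p q n, p + q = n → ∀ x y, (Z.d n (n - 1)).hom (φ p q n x y) =
      φ (p - 1) q (n - 1) ((X.d p (p - 1)).hom x) y +
        (-1 : k) ^ p • φ p (q - 1) (n - 1) x ((Y.d q (q - 1)).hom y)) :
    X ⊗ Y ⟶ Z where
  f n := HomologicalComplex.mapBifunctorDesc fun p q _ => ModuleCat.ofHom
      (TensorProduct.lift (φ p q n))
  comm' := by
    rintro _ n rfl
    apply HomologicalComplex.mapBifunctor.hom_ext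
    intro p q h
    erw [HomologicalComplex.ι_mapBifunctorDesc_assoc]
    -- the differential of the tensor product is the sum of its horizontal and vertical parts
    have hd : (X ⊗ Y).d (n + 1) n = HomologicalComplex.mapBifunctor.D₁ X Y (curriedTensor _)
        (ComplexShape.down ℕ) (n+1) n + HomologicalComplex.mapBifunctor.D₂ X Y (curriedTensor _)
        (ComplexShape.down ℕ) (n+1) n := rfl
    rw [hd, Preadditive.add_comp, Preadditive.comp_add]
    rw [HomologicalComplex.mapBifunctor.ι_D₁_assoc, HomologicalComplex.mapBifunctor.ι_D₂_assoc]
    have h1 : HomologicalComplex.mapBifunctor.d₁ X Y (curriedTensor _) (ComplexShape.down ℕ) p q n ≫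
        HomologicalComplex.mapBifunctorDesc (fun p q _ => ModuleCat.ofHom
        (TensorProduct.lift (φ p q n))) = ModuleCat.ofHom
        (TensorProduct.lift ((φ (p-1) q n) ∘ₗ (X.d p (p-1)).hom)) := by
      cases p with
      | zero =>
        rw [HomologicalComplex.mapBifunctor.d₁_eq_zero]
        · rw [X.shape _ _ (by simp)]
          apply ModuleCat.hom_ext
          apply TensorProduct.ext'
          intro x y
          simp
        · simp
      | succ p =>
        rw [HomologicalComplex.mapBifunctor.d₁_eq X Y _ _ (i₁' := p) rfl q n (by
          have h : p + 1 + q = n + 1 := h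
          change p + q = n
          omega)]
        have : ComplexShape.ε₁ (ComplexShape.down ℕ) (ComplexShape.down ℕ) (ComplexShape.down ℕ)
            (p+1,q) = 1 := rfl
        rw [this, one_smul, Category.assoc]
        erw [HomologicalComplex.ι_mapBifunctorDesc]
        apply ModuleCat.hom_ext
        apply TensorProduct.ext'
        intro x y
        rfl
    have h2 : HomologicalComplex.mapBifunctor.d₂ X Y (curriedTensor _) (ComplexShape.down ℕ) p q n ≫
        HomologicalComplex.mapBifunctorDesc (fun p q _ => ModuleCat.ofHom
        (TensorProduct.lift (φ p q n))) = ModuleCat.ofHom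
        ((-1 : k)^p • TensorProduct.lift ((φ p (q-1) n).compl₂ (Y.d q (q-1)).hom)) := by
      cases q with
      | zero =>
        rw [HomologicalComplex.mapBifunctor.d₂_eq_zero]
        · rw [Y.shape _ _ (by simp)]
          apply ModuleCat.hom_ext
          apply TensorProduct.ext'
          intro x y
          simp
        · simp
      | succ q =>
        rw [HomologicalComplex.mapBifunctor.d₂_eq X Y _ _ p (i₂' := q) rfl n (by
          have h : p + (q + 1) = n + 1 := h
          change p + q = n
          omega)]
        have : ComplexShape.ε₂ (ComplexShape.down ℕ) (ComplexShape.down ℕ) (ComplexShape.down ℕ)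
            (p,q+1) = (-1)^p := rfl
        rw [this, Linear.units_smul_comp, Category.assoc]
        erw [HomologicalComplex.ι_mapBifunctorDesc]
        apply ModuleCat.hom_ext
        apply TensorProduct.ext'
        intro x y
        have e : ((-1 : ℤˣ)^p) • (φ p q n x ((Y.d (q+1) q).hom y)) =
            (-1 : k)^p • (φ p q n x ((Y.d (q+1) q).hom y)) := by
          rcases Nat.even_or_odd p with hp | hp <;> simp [hp.neg_one_pow]
        exact e
    rw [h1, h2]
    apply ModuleCat.hom_ext
    apply TensorProduct.ext'
    intro x y
    exact hφ p q (n+1) h x y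

lemma tensorDesc_tmul {X Y Z : ChainComplex (ModuleCat.{u} k) ℕ}
    (φ : ∀ p q n, X.X p →ₗ[k] Y.X q →ₗ[k] Z.X n) (hφ) {p q n : ℕ} (h : p + q = n)
    (x : X.X p) (y : Y.X q) :
    ((tensorDesc φ hφ).f n).hom (tmul h x y) = φ p q n x y := by
  have e := HomologicalComplex.ι_mapBifunctorDesc (K₁ := X) (K₂ := Y) (F := curriedTensor _)
      (c := ComplexShape.down ℕ) (j := n) (fun p q _ => ModuleCat.ofHom
      (TensorProduct.lift (φ p q n))) p q h
  exact congrArg (fun f => f.hom (TensorProduct.tmul k x y)) e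

lemma tensorHom_tmul {X Y X' Y' : ChainComplex (ModuleCat.{u} k) ℕ} (f : X ⟶ X') (g : Y ⟶ Y')
    {p q n : ℕ} (h : p + q = n) (x : X.X p) (y : Y.X q) :
    ((f ⊗ₘ g).f n).hom (tmul h x y) = tmul h ((f.f p).hom x) ((g.f q).hom y) := by
  have e := HomologicalComplex.ι_mapBifunctorMap f g (curriedTensor _) (ComplexShape.down ℕ) p q n h
  exact congrArg (fun f => f.hom (TensorProduct.tmul k x y)) e

/-- The morphism out of the unit complex that sends `1` to `z`. -/
def unitDesc {Z : ChainComplex (ModuleCat.{u} k) ℕ} (z : Z.X 0) :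
    𝟙_ (ChainComplex (ModuleCat.{u} k) ℕ) ⟶ Z :=
  HomologicalComplex.mkHomFromSingle (ModuleCat.ofHom (LinearMap.toSpanSingleton k _ z))
    (fun j hj => by simp at hj)

lemma unitDesc_unitElem {Z : ChainComplex (ModuleCat.{u} k) ℕ} (z : Z.X 0) :
    ((unitDesc z).f 0).hom (unitElem k) = z := by
  have e := HomologicalComplex.mkHomFromSingle_f (K := Z) (c := ComplexShape.down ℕ) (j := 0)
      (A := 𝟙_ (ModuleCat.{u} k)) (ModuleCat.ofHom (LinearMap.toSpanSingleton k _ z))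
      (fun j hj => by simp at hj)
  have e2 := congrArg (fun f => f.hom (unitElem k)) e
  refine e2.trans ?_
  have e3 := (HomologicalComplex.singleObjXSelf (ComplexShape.down ℕ) 0
      (𝟙_ (ModuleCat.{u} k))).inv_hom_id
  have e4 := congrArg (fun f => f.hom (1:k)) e3
  refine (congrArg (LinearMap.toSpanSingleton k _ z) e4).trans ?_
  exact one_smul k z

/-! ### Words and shuffles -/

open scoped Classical in
/-- The truth value of a proposition as a number; it keeps decidability instances out of sums. -/
def indic (p : Prop) : ℕ := if p then 1 else 0

lemma indic_eq_ite (p : Prop) [Decidable p] : indic p = if p then 1 else 0 := by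
  unfold indic
  congr

@[simp] lemma indic_true : indic True = 1 := if_pos trivial

@[simp] lemma indic_false : indic False = 0 := if_neg not_false

lemma indic_of {p : Prop} (h : p) : indic p = 1 := if_pos h

lemma indic_of_not {p : Prop} (h : ¬ p) : indic p = 0 := if_neg h

lemma indic_mono {p q : Prop} (h : p → q) : indic p ≤ indic q := by
  by_cases hp : p
  · rw [indic_of hp, indic_of (h hp)]
  · rw [indic_of_not hp]
    exact Nat.zero_le _

lemma sum_indic_eq {ι : Type*} [Fintype ι] (a : ι) : ∑ i, indic (a = i) = 1 := by
  classical
  simp [indic_eq_ite]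

/-- The number of occurrences of the letter `i` among the first `t` letters of the word `w`. -/
def wordCount {ι : Type*} {n : ℕ} (w : Fin n → ι) (i : ι) (t : ℕ) : ℕ :=
  ∑ u : Fin n, indic (u.val < t ∧ w u = i)

section
variable {ι : Type*} {n : ℕ} (w : Fin n → ι) (i : ι)

lemma wordCount_zero : wordCount w i 0 = 0 := by simp [wordCount]

lemma wordCount_mono : Monotone (wordCount w i) := fun _ _ h =>
  Finset.sum_le_sum fun _ _ => indic_mono fun hu => ⟨hu.1.trans_le h, hu.2⟩

lemma wordCount_succ (u : Fin n) :
    wordCount w i (u + 1) = wordCount w i u + indic (w u = i) := by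
  have h : indic (w u = i) = ∑ v : Fin n, indic (v = u ∧ w u = i) := by
    rw [Finset.sum_eq_single u]
    · simp
    · intro v _ hv
      simp [hv]
    · simp
  rw [h, wordCount, wordCount, ← Finset.sum_add_distrib]
  refine Finset.sum_congr rfl fun v _ => ?_
  by_cases hv : v = u
  · subst hv; simp
  · have : v.val < u + 1 ↔ v.val < u := by
      have := fun e => hv (Fin.ext e)
      omega
    simp [hv, this]

lemma wordCount_cons (b : ι) (t : ℕ) :
    wordCount (Fin.cons b w : Fin (n + 1) → ι) i (t + 1) = indic (b = i) + wordCount w i t := by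
  rw [wordCount, Fin.sum_univ_succ]
  simp [wordCount]

/-- The monotone map `[n] → [q]` that counts the letter `i`; it counts up to `q` only, in order to
be defined for every word. -/
def wordChain (q : ℕ) : ⦋n⦌ ⟶ ⦋q⦌ :=
  SimplexCategory.mkHom
    { toFun := fun t => ⟨min q (wordCount w i t), by omega⟩
      monotone' := fun s t h => by
        have := wordCount_mono w i (Fin.le_def.1 h)
        simp only [Fin.mk_le_mk]
        omega }

lemma wordChain_apply (q : ℕ) (t : Fin (n + 1)) :
    (wordChain w i q t : ℕ) = min q (wordCount w i t) := rfl

lemma wordChain_apply_of_le {q : ℕ} (h : wordCount w i n ≤ q) (t : Fin (n + 1)) :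
    (wordChain w i q t : ℕ) = wordCount w i t := by
  have := wordCount_mono w i (Nat.le_of_lt_succ t.isLt)
  rw [wordChain_apply]
  omega

end

/-- The number of inversions of a word, for an order relation `r` on the letters. -/
def wordInv {ι : Type*} (r : ι → ι → Prop) {n : ℕ} (w : Fin n → ι) : ℕ :=
  ∑ s : Fin n, ∑ t : Fin n, indic (s < t ∧ r (w t) (w s))

lemma simplex_hom_ext {m n : ℕ} {f g : ⦋m⦌ ⟶ ⦋n⦌} (h : ∀ t : Fin (m + 1), (f t : ℕ) = g t) :
    f = g := by
  ext t
  exact h t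

lemma simplex_hom_le {m n : ℕ} (f : ⦋m⦌ ⟶ ⦋n⦌) (t : Fin (m + 1)) : (f t : ℕ) ≤ n :=
  Nat.le_of_lt_succ (f t).isLt

section shuffle

variable {p q n : ℕ}

lemma wordCount_bool_add (w : Fin n → Bool) {t : ℕ} (h : t ≤ n) :
    wordCount w false t + wordCount w true t = t := by
  induction t with
  | zero => simp [wordCount_zero]
  | succ t ih =>
    have h1 := wordCount_succ w false ⟨t, h⟩
    have h2 := wordCount_succ w true ⟨t, h⟩
    have := ih (by omega)
    simp only at h1 h2
    cases hw : w ⟨t, h⟩ <;> simp [hw] at h1 h2 <;> omega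

/-- A shuffle is a maximal chain: at time `t` its coordinates add up to `t`. -/
lemma Shuffle.add_eq (h : p + q = n) (c : Shuffle p q n) (t : Fin (n + 1)) :
    (c.1.1 t : ℕ) + c.1.2 t = t := by
  -- the sum of the coordinates is a strictly monotone endomap of `[n]`, hence the identity
  have hs : StrictMono (fun t : Fin (n + 1) => (⟨c.1.1 t + c.1.2 t, by
      have := simplex_hom_le c.1.1 t
      have := simplex_hom_le c.1.2 t
      omega⟩ : Fin (n + 1))) := by
    intro s t hst
    have h1 := Fin.le_def.1 (c.1.1.toOrderHom.monotone hst.le)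
    have h2 := Fin.le_def.1 (c.1.2.toOrderHom.monotone hst.le)
    have h3 : ¬ (c.1.1 s = c.1.1 t ∧ c.1.2 s = c.1.2 t) := fun e =>
      hst.ne (c.2 (Prod.ext e.1 e.2))
    rw [Fin.lt_def]
    change (c.1.1 s : ℕ) ≤ c.1.1 t at h1
    change (c.1.2 s : ℕ) ≤ c.1.2 t at h2
    rw [Fin.ext_iff, Fin.ext_iff] at h3
    change (c.1.1 s : ℕ) + c.1.2 s < c.1.1 t + c.1.2 t
    omega
  have hr := hs.range_inj strictMono_id |>.1 (by
    rw [(Finite.injective_iff_surjective.1 hs.injective).range_eq, Set.range_id])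
  exact congrArg Fin.val (congrFun hr t)

/-- The word of a shuffle: the letter `false` stands for a step in the first direction. -/
def Shuffle.word (c : Shuffle p q n) : Fin n → Bool :=
  fun t => decide (c.1.2 t.castSucc < c.1.2 t.succ)

/-- The coordinates of a shuffle count the letters of its word. -/
lemma Shuffle.wordCount_word (h : p + q = n) (c : Shuffle p q n) (t : Fin (n + 1)) :
    wordCount c.word false t = c.1.1 t ∧ wordCount c.word true t = c.1.2 t := by
  induction t using Fin.induction with
  | zero =>
    have := c.add_eq h 0
    simp only [Fin.val_zero, wordCount_zero] at this ⊢
    omega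
  | succ t ih =>
    have h1 := wordCount_succ c.word false t
    have h2 := wordCount_succ c.word true t
    have h3 := c.add_eq h t.castSucc
    have h4 := c.add_eq h t.succ
    have h5 : (c.1.1 t.castSucc : ℕ) ≤ c.1.1 t.succ :=
      c.1.1.toOrderHom.monotone (Fin.castSucc_lt_succ (i := t)).le
    have h6 : (c.1.2 t.castSucc : ℕ) ≤ c.1.2 t.succ :=
      c.1.2.toOrderHom.monotone (Fin.castSucc_lt_succ (i := t)).le
    simp only [Fin.val_castSucc, Fin.val_succ] at *
    rw [h1, h2]
    by_cases hc : (c.1.2 t.castSucc : ℕ) < c.1.2 t.succ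
    · have : c.word t = true := by simpa [Shuffle.word] using hc
      simp only [this]
      simp
      omega
    · have : c.word t = false := by simpa [Shuffle.word] using hc
      simp only [this]
      simp
      omega

/-- Shuffles as words with two letters. -/
def shuffleEquiv (h : p + q = n) :
    Shuffle p q n ≃ {w : Fin n → Bool // wordCount w false n = p ∧ wordCount w true n = q} where
  toFun c := ⟨c.word, by
    have h1 := c.wordCount_word h (Fin.last n)
    have h2 := c.add_eq h (Fin.last n)
    have := simplex_hom_le c.1.1 (Fin.last n)
    have := simplex_hom_le c.1.2 (Fin.last n)
    simp only [Fin.val_last] at h1 h2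
    omega⟩
  invFun w := ⟨(wordChain w.1 false p, wordChain w.1 true q), fun s t e => by
    have h1 := congrArg (fun x => (x.1 : ℕ)) e
    have h2 := congrArg (fun x => (x.2 : ℕ)) e
    simp only at h1 h2
    rw [wordChain_apply_of_le _ _ w.2.1.le, wordChain_apply_of_le _ _ w.2.1.le] at h1
    rw [wordChain_apply_of_le _ _ w.2.2.le, wordChain_apply_of_le _ _ w.2.2.le] at h2
    have h3 := wordCount_bool_add w.1 (Nat.le_of_lt_succ s.isLt)
    have h4 := wordCount_bool_add w.1 (Nat.le_of_lt_succ t.isLt)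
    exact Fin.ext (by omega)⟩
  left_inv c := by
    have h1 := c.wordCount_word h
    refine Subtype.ext (Prod.ext (simplex_hom_ext fun t => ?_) (simplex_hom_ext fun t => ?_))
    · have := simplex_hom_le c.1.1 t
      change min p _ = _
      rw [(h1 t).1]
      omega
    · have := simplex_hom_le c.1.2 t
      change min q _ = _
      rw [(h1 t).2]
      omega
  right_inv w := by
    refine Subtype.ext (funext fun t => ?_)
    change decide (wordChain w.1 true q t.castSucc < wordChain w.1 true q t.succ) = _
    simp only [Fin.lt_def, wordChain_apply_of_le _ _ w.2.2.le, Fin.val_castSucc, Fin.val_succ,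
      wordCount_succ]
    cases w.1 t <;> simp

/-- The inversions of a shuffle are the inversions of its word. -/
lemma Shuffle.inv_eq (h : p + q = n) (c : Shuffle p q n) :
    c.inv = wordInv (· < ·) c.word := by
  rw [Shuffle.inv, Finset.card_filter, Fintype.sum_prod_type, wordInv]
  refine Finset.sum_congr rfl fun s _ => Finset.sum_congr rfl fun t _ => ?_
  have h3 := c.add_eq h t.castSucc
  have h4 := c.add_eq h t.succ
  have h5 : (c.1.1 t.castSucc : ℕ) ≤ c.1.1 t.succ :=
    c.1.1.toOrderHom.monotone (Fin.castSucc_lt_succ (i := t)).le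
  have h6 : (c.1.2 t.castSucc : ℕ) ≤ c.1.2 t.succ :=
    c.1.2.toOrderHom.monotone (Fin.castSucc_lt_succ (i := t)).le
  have e : c.1.1 t.castSucc < c.1.1 t.succ ↔ ¬ (c.1.2 t.castSucc < c.1.2 t.succ) := by
    rw [Fin.lt_def, Fin.lt_def]
    simp only [Fin.val_castSucc, Fin.val_succ] at *
    omega
  have e' : (c.word t < c.word s) ↔
      (c.1.2 s.castSucc < c.1.2 s.succ ∧ c.1.1 t.castSucc < c.1.1 t.succ) := by
    rw [e, Bool.lt_iff]
    simp [Shuffle.word, and_comm]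
  rw [indic_eq_ite]
  simp only [e']

open scoped Classical in
/-- A sum over shuffles is a sum over words with two letters. -/
lemma sum_shuffle {V : Type*} [AddCommMonoid V] (h : p + q = n)
    (f : ℕ → (⦋n⦌ ⟶ ⦋p⦌) → (⦋n⦌ ⟶ ⦋q⦌) → V) :
    ∑ c : Shuffle p q n, f c.inv c.1.1 c.1.2 =
      ∑ w : Fin n → Bool, if wordCount w false n = p ∧ wordCount w true n = q then
        f (wordInv (· < ·) w) (wordChain w false p) (wordChain w true q) else 0 := by
  rw [← Finset.sum_filter, Finset.sum_subtype (p := fun w : Fin n → Bool => wordCount w false n = p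
      ∧ wordCount w true n = q) _ (by simp)]
  refine Fintype.sum_equiv (shuffleEquiv h) _ _ fun c => ?_
  have := (shuffleEquiv h).symm_apply_apply c
  have h1 : wordChain c.word false p = c.1.1 := congrArg (fun x => x.1.1) this
  have h2 : wordChain c.word true q = c.1.2 := congrArg (fun x => x.1.2) this
  change _ = f (wordInv _ c.word) (wordChain c.word false p) (wordChain c.word true q)
  rw [h1, h2, c.inv_eq h]

end shuffle

/-! ### Chains of simplicial sets and the shuffle map -/

/-- The degreewise product of two simplicial sets. -/
def prodSSet (X Y : SSet.{0}) : SSet.{0} where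
  obj Δ := X.obj Δ × Y.obj Δ
  map f := ↾fun x => (X.map f x.1, Y.map f x.2)
  map_id Δ := by
    refine ConcreteCategory.hom_ext _ _ fun x => ?_
    exact Prod.ext (congrArg (fun f => f x.1) (X.map_id Δ)) (congrArg (fun f => f x.2) (Y.map_id Δ))
  map_comp f g := by
    refine ConcreteCategory.hom_ext _ _ fun x => ?_
    exact Prod.ext (congrArg (fun h => h x.1) (X.map_comp f g))
      (congrArg (fun h => h x.2) (Y.map_comp f g))

/-- The product of two maps of simplicial sets. -/
def prodSSetMap {X Y X' Y' : SSet.{0}} (f : X ⟶ X') (g : Y ⟶ Y') : prodSSet X Y ⟶ prodSSet X' Y'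
    where
  app Δ := ↾fun x => (f.app Δ x.1, g.app Δ x.2)
  naturality _ _ φ := by
    refine ConcreteCategory.hom_ext _ _ fun x => ?_
    exact Prod.ext (congrArg (fun h => h x.1) (f.naturality φ))
      (congrArg (fun h => h x.2) (g.naturality φ))

/-- The tensor product of two chains, as a chain on the product. -/
def pairChain {A B : Type} : (A →₀ k) →ₗ[k] (B →₀ k) →ₗ[k] (A × B →₀ k) :=
  (TensorProduct.mk k (A →₀ k) (B →₀ k)).compr₂ (finsuppTensorFinsupp' k A B).toLinearMap

lemma pairChain_single {A B : Type} (a : A) (b : B) (r s : k) :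
    pairChain (Finsupp.single a r) (Finsupp.single b s) = Finsupp.single (a, b) (r * s) :=
  finsuppTensorFinsupp'_single_tmul_single (R := k) (ι := A) (κ := B) a b r s

lemma bilinear_ext {A B : Type} {V : Type*} [AddCommMonoid V] [Module k V]
    {F G : (A →₀ k) →ₗ[k] (B →₀ k) →ₗ[k] V}
    (h : ∀ a b, F (Finsupp.single a 1) (Finsupp.single b 1) =
      G (Finsupp.single a 1) (Finsupp.single b 1)) : F = G := by
  ext a b
  exact h a b

lemma shuffle_apply (A B : SimplicialObject (ModuleCat.{u} k)) (p q n : ℕ) (x : A _⦋p⦌)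
    (y : B _⦋q⦌) : shuffle A B p q n x y = ∑ c : Shuffle p q n, (-1 : k) ^ c.inv •
      (((A.map c.1.1.op).hom x) ⊗ₜ[k] ((B.map c.1.2.op).hom y)) := by
  simp [shuffle, LinearMap.sum_apply]

/-- The first component of a shuffle. -/
def Shuffle.fst {p q n : ℕ} (c : Shuffle p q n) : ⦋n⦌ ⟶ ⦋p⦌ := c.1.1

/-- The second component of a shuffle. -/
def Shuffle.snd {p q n : ℕ} (c : Shuffle p q n) : ⦋n⦌ ⟶ ⦋q⦌ := c.1.2

lemma linShuffle_eq_sum (X Y : SSet.{0}) (p q n : ℕ) (x : X _⦋p⦌ →₀ k) (y : Y _⦋q⦌ →₀ k) :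
    linShuffle X Y p q n x y = ∑ c : Shuffle p q n, (-1 : k) ^ c.inv •
      pairChain (Finsupp.mapDomain (X.map c.fst.op) x) (Finsupp.mapDomain (Y.map c.snd.op) y) := by
  refine (congrArg _ (shuffle_apply ((linearization k).obj X) ((linearization k).obj Y)
    p q n x y)).trans ((map_sum _ _ _).trans (Finset.sum_congr rfl fun c _ => ?_))
  exact map_smul _ _ _

/-- The shuffle map for linearizations of simplicial sets as a bilinear map. -/
def linShuffleₗ (X Y : SSet.{0}) (p q n : ℕ) :
    (X _⦋p⦌ →₀ k) →ₗ[k] (Y _⦋q⦌ →₀ k) →ₗ[k] ((prodSSet X Y) _⦋n⦌ →₀ k) :=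
  (shuffle ((linearization k).obj X) ((linearization k).obj Y) p q n).compr₂
    (finsuppTensorFinsupp' k (X _⦋n⦌) (Y _⦋n⦌)).toLinearMap

open scoped Classical in
/-- The shuffle product of two simplices, as a sum over words. -/
lemma linShuffle_single (X Y : SSet.{0}) {p q n : ℕ} (h : p + q = n) (a : X _⦋p⦌) (b : Y _⦋q⦌)
    (r s : k) :
    linShuffle X Y p q n (Finsupp.single a r) (Finsupp.single b s) =
      ∑ w : Fin n → Bool, if wordCount w false n = p ∧ wordCount w true n = q then
        (-1 : k) ^ wordInv (· < ·) w • Finsupp.single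
          (X.map (wordChain w false p).op a, Y.map (wordChain w true q).op b) (r * s) else 0 := by
  rw [linShuffle_eq_sum, ← sum_shuffle h (fun i c d => (-1 : k) ^ i • Finsupp.single
          (X.map c.op a, Y.map d.op b) (r * s))]
  simp only [Finsupp.mapDomain_single, pairChain_single]
  rfl

lemma mapDomain_pairChain {A B A' B' : Type} (f : A → A') (g : B → B') (x : A →₀ k) (y : B →₀ k) :
    Finsupp.mapDomain (Prod.map f g) (pairChain x y) =
      pairChain (Finsupp.mapDomain f x) (Finsupp.mapDomain g y) := by
  have h : pairChain.compr₂ (Finsupp.lmapDomain k k (Prod.map f g)) =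
      pairChain.compl₁₂ (Finsupp.lmapDomain k k f) (Finsupp.lmapDomain k k g) :=
    bilinear_ext fun a b => by simp [pairChain_single]
  exact congrArg (fun F => F x y) h

lemma map_op_map (X : SSet.{0}) {l m n : ℕ} (f : ⦋l⦌ ⟶ ⦋m⦌) (g : ⦋m⦌ ⟶ ⦋n⦌) (x : X _⦋n⦌) :
    X.map f.op (X.map g.op x) = X.map (f ≫ g).op x :=
  (congrArg (fun h => h x) (X.map_comp g.op f.op)).symm

lemma map_op_id (X : SSet.{0}) {n : ℕ} (x : X _⦋n⦌) : X.map (𝟙 ⦋n⦌).op x = x :=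
  congrArg (fun h => h x) (X.map_id _)

lemma app_map_op {X Y : SSet.{0}} (φ : X ⟶ Y) {m n : ℕ} (f : ⦋m⦌ ⟶ ⦋n⦌) (x : X _⦋n⦌) :
    φ.app (op ⦋m⦌) (X.map f.op x) = Y.map f.op (φ.app (op ⦋n⦌) x) :=
  congrArg (fun h => h x) (φ.naturality f.op)

/-- The map on `n`-chains induced by a map of simplicial sets. -/
def chainMap {X Y : SSet.{0}} (φ : X ⟶ Y) (n : ℕ) : (X _⦋n⦌ →₀ k) →ₗ[k] (Y _⦋n⦌ →₀ k) :=
  Finsupp.lmapDomain k k (φ.app (op ⦋n⦌))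

lemma chainMap_single {X Y : SSet.{0}} (φ : X ⟶ Y) (n : ℕ) (x : X _⦋n⦌) (r : k) :
    chainMap φ n (Finsupp.single x r) = Finsupp.single (φ.app (op ⦋n⦌) x) r :=
  Finsupp.mapDomain_single

/-- The simplicial operator `f` on chains. -/
def chainOp (X : SSet.{0}) {m n : ℕ} (f : ⦋m⦌ ⟶ ⦋n⦌) : (X _⦋n⦌ →₀ k) →ₗ[k] (X _⦋m⦌ →₀ k) :=
  Finsupp.lmapDomain k k (X.map f.op)

lemma chainOp_single (X : SSet.{0}) {m n : ℕ} (f : ⦋m⦌ ⟶ ⦋n⦌) (x : X _⦋n⦌) (r : k) :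
    chainOp X f (Finsupp.single x r) = Finsupp.single (X.map f.op x) r :=
  Finsupp.mapDomain_single

lemma chainMap_linShuffle {X Y X' Y' : SSet.{0}} (φ : X ⟶ X') (ψ : Y ⟶ Y') (p q n : ℕ)
    (x : X _⦋p⦌ →₀ k) (y : Y _⦋q⦌ →₀ k) :
    chainMap (prodSSetMap φ ψ) n (linShuffle X Y p q n x y) =
      linShuffle X' Y' p q n (chainMap φ p x) (chainMap ψ q y) := by
  rw [linShuffle_eq_sum, linShuffle_eq_sum]
  refine (map_sum (chainMap (prodSSetMap φ ψ) n) _ _).trans (Finset.sum_congr rfl fun c _ => ?_)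
  refine (map_smul (chainMap (prodSSetMap φ ψ) n) _ _).trans ?_
  refine congrArg _ ((mapDomain_pairChain _ _ _ _).trans ?_)
  simp only [chainMap, Finsupp.lmapDomain_apply, ← Finsupp.mapDomain_comp]
  congr 2
  · congr 1
    exact funext fun a => app_map_op φ c.fst a
  · exact funext fun a => app_map_op ψ c.snd a

/-- The alternating sum of faces from degree `n` to degree `n - 1`; it is zero for `n = 0`. -/
def bdry (X : SSet.{0}) (n : ℕ) : (X _⦋n⦌ →₀ k) →ₗ[k] (X _⦋n - 1⦌ →₀ k) :=
  (((AlgebraicTopology.alternatingFaceMapComplex _).obj ((linearization k).obj X)).d n (n - 1)).hom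

lemma bdry_zero (X : SSet.{0}) (x : X _⦋0⦌ →₀ k) : bdry X 0 x = 0 := by
  rw [bdry, HomologicalComplex.shape _ _ _ (by simp)]
  rfl

lemma bdry_succ (X : SSet.{0}) (n : ℕ) (x : X _⦋n + 1⦌ →₀ k) :
    bdry X (n + 1) x = ∑ i : Fin (n + 2), (-1 : k) ^ (i : ℕ) • chainOp X (SimplexCategory.δ i)
        x := by
  have h := AlgebraicTopology.AlternatingFaceMapComplex.obj_d_eq ((linearization k).obj X) n
  have h2 := congrArg (fun f => f.hom x) h
  refine h2.trans ?_
  rw [ModuleCat.hom_sum]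
  refine (LinearMap.sum_apply _ _ _).trans (Finset.sum_congr rfl fun i _ => ?_)
  rcases Nat.even_or_odd (i : ℕ) with hi | hi
  · rw [hi.neg_one_pow, hi.neg_one_pow, one_smul, one_smul]
    rfl
  · rw [hi.neg_one_pow, hi.neg_one_pow, neg_smul, one_smul, neg_smul, one_smul]
    rfl

lemma bdry_bdry (X : SSet.{0}) (n : ℕ) (x : X _⦋n⦌ →₀ k) : bdry X (n - 1) (bdry X n x) = 0 :=
  congrArg (fun f => f.hom x) (HomologicalComplex.d_comp_d
    ((AlgebraicTopology.alternatingFaceMapComplex _).obj ((linearization k).obj X)) n (n - 1)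
    (n - 1 - 1))

lemma chainMap_bdry {X Y : SSet.{0}} (φ : X ⟶ Y) (n : ℕ) (x : X _⦋n⦌ →₀ k) :
    chainMap φ (n - 1) (bdry X n x) = bdry Y n (chainMap φ n x) :=
  (congrArg (fun f => f.hom x) (((AlgebraicTopology.alternatingFaceMapComplex _).map
    ((linearization k).map φ)).comm n (n - 1))).symm

/-- The class of a chain in the normalized chains. -/
def normClass (X : SSet.{0}) (n : ℕ) : (X _⦋n⦌ →₀ k) →ₗ[k]
    ((normalization k).obj ((linearization k).obj X)).X n :=
  toNormalization ((linearization k).obj X) n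

lemma normClass_surjective (X : SSet.{0}) (n : ℕ) : Function.Surjective (normClass (k := k) X n) :=
  Submodule.mkQ_surjective _

lemma normClass_eq_zero_iff {X : SSet.{0}} {n : ℕ} {x : X _⦋n⦌ →₀ k} :
    normClass X n x = 0 ↔ x ∈ degenerate ((linearization k).obj X) n :=
  Submodule.Quotient.mk_eq_zero _

lemma normClass_bdry (X : SSet.{0}) (n : ℕ) (x : X _⦋n⦌ →₀ k) :
    normClass X (n - 1) (bdry X n x) =
      (((normalization k).obj ((linearization k).obj X)).d n (n - 1)).hom (normClass X n x) := rfl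

lemma normClass_chainMap {X Y : SSet.{0}} (φ : X ⟶ Y) (n : ℕ) (x : X _⦋n⦌ →₀ k) :
    normClass Y n (chainMap φ n x) =
      (((normalization k).map ((linearization k).map φ)).f n).hom (normClass X n x) := rfl

/-! ### The shuffle map on normalized chains -/

lemma single_map_σ_mem_degenerate (X : SSet.{0}) {n : ℕ} (i : Fin (n + 1)) (x : X _⦋n⦌) (r : k) :
    Finsupp.single (X.map (SimplexCategory.σ i).op x) r ∈
      degenerate ((linearization k).obj X) (n + 1) :=
  (le_iSup (fun i : Fin (n + 1) => LinearMap.range (((linearization k).obj X).σ i).hom) i)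
    ⟨Finsupp.single x r, chainOp_single X _ x r⟩

/-- A monotone map that takes the same value at two consecutive places factors through the
corresponding degeneracy operator. -/
lemma simplex_hom_factor {m n : ℕ} (f : ⦋n + 1⦌ ⟶ ⦋m⦌) (i : Fin (n + 1))
    (h : f i.castSucc = f i.succ) : ∃ g : ⦋n⦌ ⟶ ⦋m⦌, f = SimplexCategory.σ i ≫ g :=
  SimplexCategory.eq_σ_comp_of_not_injective' f i h

/-- A simplex of a product is degenerate if its components are images under monotone maps that take
the same value at two common consecutive places. -/
lemma single_prod_mem_degenerate (X Y : SSet.{0}) {n p q : ℕ} (f : ⦋n + 1⦌ ⟶ ⦋p⦌)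
    (g : ⦋n + 1⦌ ⟶ ⦋q⦌) (i : Fin (n + 1)) (hf : f i.castSucc = f i.succ)
    (hg : g i.castSucc = g i.succ) (a : X _⦋p⦌) (b : Y _⦋q⦌) (r : k) :
    (Finsupp.single (X.map f.op a, Y.map g.op b) r : (prodSSet X Y) _⦋n + 1⦌ →₀ k) ∈
      degenerate ((linearization k).obj (prodSSet X Y)) (n + 1) := by
  obtain ⟨f, rfl⟩ := simplex_hom_factor f i hf
  obtain ⟨g, rfl⟩ := simplex_hom_factor g i hg
  have := single_map_σ_mem_degenerate (k := k) (prodSSet X Y) i (X.map f.op a, Y.map g.op b) r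
  rw [← map_op_map, ← map_op_map]
  exact this

/-- For dimension reasons, a simplex of dimension greater than `p + q` of a product of images of a
`p`-simplex and of a `q`-simplex is degenerate. -/
lemma single_prod_mem_degenerate_of_lt (X Y : SSet.{0}) {n p q : ℕ} (f : ⦋n⦌ ⟶ ⦋p⦌)
    (g : ⦋n⦌ ⟶ ⦋q⦌) (h : p + q < n) (a : X _⦋p⦌) (b : Y _⦋q⦌) (r : k) :
    (Finsupp.single (X.map f.op a, Y.map g.op b) r : (prodSSet X Y) _⦋n⦌ →₀ k) ∈
      degenerate ((linearization k).obj (prodSSet X Y)) n := by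
  cases n with
  | zero => omega
  | succ n =>
    have : ∃ i : Fin (n + 1), f i.castSucc = f i.succ ∧ g i.castSucc = g i.succ := by
      by_contra! hc
      -- otherwise the sum of the coordinates increases at each step, and exceeds `p + q`
      have key : ∀ t : Fin (n + 2), (t : ℕ) ≤ f t + g t := by
        intro t
        induction t using Fin.induction with
        | zero => simp
        | succ t ih =>
          have h5 : (f t.castSucc : ℕ) ≤ f t.succ :=
            f.toOrderHom.monotone (Fin.castSucc_lt_succ (i := t)).le
          have h6 : (g t.castSucc : ℕ) ≤ g t.succ :=
            g.toOrderHom.monotone (Fin.castSucc_lt_succ (i := t)).le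
          have h7 := hc t
          rw [Fin.ext_iff] at h7
          have h8 : (f t.castSucc : ℕ) = f t.succ → (g t.castSucc : ℕ) ≠ g t.succ := fun e e' =>
            h7 e (Fin.ext e')
          simp only [Fin.val_castSucc, Fin.val_succ] at *
          omega
      have := key (Fin.last (n + 1))
      have h1 := simplex_hom_le f (Fin.last (n + 1))
      have h2 := simplex_hom_le g (Fin.last (n + 1))
      simp only [Fin.val_last] at this
      omega
    obtain ⟨i, hf, hg⟩ := this
    exact single_prod_mem_degenerate X Y f g i hf hg a b r

/-- The class of the shuffle product in the normalized chains. -/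
def normShuffle (X Y : SSet.{0}) (p q n : ℕ) : (X _⦋p⦌ →₀ k) →ₗ[k] (Y _⦋q⦌ →₀ k) →ₗ[k]
    ((normalization k).obj ((linearization k).obj (prodSSet X Y))).X n :=
  (linShuffleₗ X Y p q n).compr₂ (normClass (prodSSet X Y) n)

lemma normShuffle_apply (X Y : SSet.{0}) (p q n : ℕ) (x : X _⦋p⦌ →₀ k) (y : Y _⦋q⦌ →₀ k) :
    normShuffle X Y p q n x y = normClass (prodSSet X Y) n (linShuffle X Y p q n x y) := rfl

lemma normShuffle_single (X Y : SSet.{0}) {p q n : ℕ} (a : X _⦋p⦌) (b : Y _⦋q⦌) :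
    normShuffle (k := k) X Y p q n (Finsupp.single a 1) (Finsupp.single b 1) =
      ∑ c : Shuffle p q n, (-1 : k) ^ c.inv • normClass (prodSSet X Y) n
        (Finsupp.single (X.map c.fst.op a, Y.map c.snd.op b) 1) := by
  rw [normShuffle_apply, linShuffle_eq_sum]
  refine (map_sum (normClass (prodSSet X Y) n) _ _).trans (Finset.sum_congr rfl fun c _ => ?_)
  refine (map_smul (normClass (prodSSet X Y) n) _ _).trans ?_
  rw [Finsupp.mapDomain_single, Finsupp.mapDomain_single, pairChain_single, one_mul]
  rfl

/-- The shuffle product with a degenerate left factor is degenerate. -/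
lemma normShuffle_σ_left (X Y : SSet.{0}) {p q n : ℕ} (h : p + 1 + q = n) (i : Fin (p + 1))
    (x : X _⦋p⦌ →₀ k) (y : Y _⦋q⦌ →₀ k) :
    normShuffle X Y (p + 1) q n (chainOp X (SimplexCategory.σ i) x) y = 0 := by
  suffices H : (normShuffle X Y (p + 1) q n) ∘ₗ (chainOp X (SimplexCategory.σ i)) = (0 : _ →ₗ[k] _)
      from
    congrArg (fun F => F x y) H
  refine bilinear_ext fun a b => ?_
  rw [LinearMap.comp_apply, chainOp_single, normShuffle_single]
  refine Finset.sum_eq_zero fun c _ => ?_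
  rw [map_op_map, normClass_eq_zero_iff.2, smul_zero]
  exact single_prod_mem_degenerate_of_lt X Y (c.fst ≫ SimplexCategory.σ i) c.snd (by omega) a b 1

/-- The shuffle product with a degenerate right factor is degenerate. -/
lemma normShuffle_σ_right (X Y : SSet.{0}) {p q n : ℕ} (h : p + (q + 1) = n) (i : Fin (q + 1))
    (x : X _⦋p⦌ →₀ k) (y : Y _⦋q⦌ →₀ k) :
    normShuffle X Y p (q + 1) n x (chainOp Y (SimplexCategory.σ i) y) = 0 := by
  suffices H : (normShuffle X Y p (q + 1) n).compl₂ (chainOp Y (SimplexCategory.σ i)) =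
      (0 : _ →ₗ[k] _) from
    congrArg (fun F => F x y) H
  refine bilinear_ext fun a b => ?_
  rw [LinearMap.compl₂_apply, chainOp_single, normShuffle_single]
  refine Finset.sum_eq_zero fun c _ => ?_
  rw [map_op_map, normClass_eq_zero_iff.2, smul_zero]
  exact single_prod_mem_degenerate_of_lt X Y c.fst (c.snd ≫ SimplexCategory.σ i) (by omega) a b 1

/-- A linear map that vanishes on the images of the degeneracy operators vanishes on degenerate
chains; the equality `n = m + 1` is kept as a hypothesis in order to apply this in a variable
degree. -/
lemma degenerate_le_ker (X : SSet.{0}) {n : ℕ} {V : Type*} [AddCommGroup V] [Module k V]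
    (F : (X _⦋n⦌ →₀ k) →ₗ[k] V)
    (h : ∀ (m : ℕ) (e : n = m + 1) (i : Fin (m + 1)) (x : X _⦋m⦌ →₀ k),
      F (chainOp X ((eqToHom (by rw [e]) : ⦋n⦌ ⟶ ⦋m + 1⦌) ≫ SimplexCategory.σ i) x) = 0) :
    degenerate ((linearization k).obj X) n ≤ LinearMap.ker F := by
  cases n with
  | zero => exact bot_le
  | succ n =>
    refine iSup_le fun i => ?_
    rintro _ ⟨x, rfl⟩
    have := h n rfl i x
    rw [eqToHom_refl, Category.id_comp] at this
    exact this

/-- The Eilenberg–Zilber map on normalized chains, as a family of bilinear maps. -/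
def ezBilinOfEq (X Y : SSet.{0}) {p q n : ℕ} (h : p + q = n) :
    ((normalization k).obj ((linearization k).obj X)).X p →ₗ[k]
    ((normalization k).obj ((linearization k).obj Y)).X q →ₗ[k]
    ((normalization k).obj ((linearization k).obj (prodSSet X Y))).X n :=
  (degenerate ((linearization k).obj X) p).liftQ
    (LinearMap.flip ((degenerate ((linearization k).obj Y) q).liftQ (normShuffle X Y p q n).flip
      (degenerate_le_ker Y _ (by
        rintro q rfl i y
        rw [eqToHom_refl, Category.id_comp]
        ext x : 1
        exact normShuffle_σ_right X Y h i x y))))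
    (degenerate_le_ker X _ (by
        rintro p rfl i x
        rw [eqToHom_refl, Category.id_comp]
        refine LinearMap.ext fun y => ?_
        obtain ⟨y, rfl⟩ := normClass_surjective Y q y
        exact normShuffle_σ_left X Y h i x y))

/-- The family of all bilinear Eilenberg–Zilber maps, extended by zero. -/
def ezBilin (X Y : SSet.{0}) (p q n : ℕ) :
    ((normalization k).obj ((linearization k).obj X)).X p →ₗ[k]
    ((normalization k).obj ((linearization k).obj Y)).X q →ₗ[k]
    ((normalization k).obj ((linearization k).obj (prodSSet X Y))).X n :=
  if h : p + q = n then ezBilinOfEq X Y h else 0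

lemma ezBilin_normClass (X Y : SSet.{0}) {p q n : ℕ} (h : p + q = n) (x : X _⦋p⦌ →₀ k)
    (y : Y _⦋q⦌ →₀ k) : ezBilin X Y p q n (normClass X p x) (normClass Y q y) =
      normClass (prodSSet X Y) n (linShuffle X Y p q n x y) := by
  have e : ezBilin (k := k) X Y p q n = ezBilinOfEq X Y h := dif_pos h
  rw [e]
  rfl

/-! ### The cone operator on chains of a product of simplices -/

/-- The simplicial set `Δ[p] × Δ[q]`. -/
abbrev simplexProd (p q : ℕ) : SSet.{0} := prodSSet (yoneda.obj ⦋p⦌) (yoneda.obj ⦋q⦌)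

/-- The map that classifies a simplex. -/
def classify {X : SSet.{0}} {p : ℕ} (a : X _⦋p⦌) : (yoneda.obj ⦋p⦌ : SSet.{0}) ⟶ X where
  app Δ := ↾fun f => X.map f.op a
  naturality Δ Δ' φ := by
    refine ConcreteCategory.hom_ext _ _ fun f => ?_
    exact congrArg (fun h => h a) (X.map_comp f.op φ)

lemma classify_id {X : SSet.{0}} {p : ℕ} (a : X _⦋p⦌) :
    (classify a).app (op ⦋p⦌) (𝟙 ⦋p⦌) = a := map_op_id X a

/-- The join of the bottom vertex with a simplex of `Δ[p]`. -/
def coneHom {n p : ℕ} (f : ⦋n⦌ ⟶ ⦋p⦌) : ⦋n + 1⦌ ⟶ ⦋p⦌ :=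
  SimplexCategory.mkHom
    { toFun := Fin.cons 0 f
      monotone' := fun s t h => by
        induction s using Fin.cases with
        | zero => simp
        | succ s =>
          induction t using Fin.cases with
          | zero => simp at h
          | succ t =>
            simp only [Fin.cons_succ]
            exact f.toOrderHom.monotone (by simpa using h) }

lemma coneHom_zero {n p : ℕ} (f : ⦋n⦌ ⟶ ⦋p⦌) : coneHom f 0 = 0 := rfl

lemma coneHom_succ {n p : ℕ} (f : ⦋n⦌ ⟶ ⦋p⦌) (t : Fin (n + 1)) : coneHom f t.succ = f t := rfl

lemma δ_zero_comp_coneHom {n p : ℕ} (f : ⦋n⦌ ⟶ ⦋p⦌) : SimplexCategory.δ 0 ≫ coneHom f = f := by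
  ext t
  rfl

lemma δ_succ_comp_coneHom {n p : ℕ} (f : ⦋n + 1⦌ ⟶ ⦋p⦌) (i : Fin (n + 2)) :
    SimplexCategory.δ i.succ ≫ coneHom f = coneHom (SimplexCategory.δ i ≫ f) := by
  refine simplex_hom_ext fun t => congrArg Fin.val ?_
  induction t using Fin.cases with
  | zero => rfl
  | succ t => exact congrArg (Fin.cons 0 f) (Fin.succ_succAbove_succ i t)

/-- A simplex of `Δ[p] × Δ[q]`. -/
def mkSimplex {p q n : ℕ} (f : ⦋n⦌ ⟶ ⦋p⦌) (g : ⦋n⦌ ⟶ ⦋q⦌) : (simplexProd p q) _⦋n⦌ := (f, g)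

lemma exists_mkSimplex {p q n : ℕ} (x : (simplexProd p q) _⦋n⦌) : ∃ f g, x = mkSimplex f g :=
  ⟨x.1, x.2, rfl⟩

lemma mkSimplex_mem_degenerate {p q n : ℕ} (f : ⦋n + 1⦌ ⟶ ⦋p⦌) (g : ⦋n + 1⦌ ⟶ ⦋q⦌)
    (i : Fin (n + 1)) (hf : f i.castSucc = f i.succ) (hg : g i.castSucc = g i.succ) (r : k) :
    Finsupp.single (mkSimplex f g) r ∈
      degenerate ((linearization k).obj (simplexProd p q)) (n + 1) := by
  have h := single_prod_mem_degenerate (k := k) (yoneda.obj ⦋p⦌) (yoneda.obj ⦋q⦌) f g i hf hg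
    (𝟙 _) (𝟙 _) r
  have e : ((yoneda.obj ⦋p⦌ : SSet.{0}).map f.op (𝟙 _), (yoneda.obj ⦋q⦌ : SSet.{0}).map g.op (𝟙 _))
      =
      mkSimplex f g := Prod.ext (Category.comp_id f) (Category.comp_id g)
  rwa [e] at h

/-- The cone operator on chains of `Δ[p] × Δ[q]`. -/
def cone (p q n : ℕ) : ((simplexProd p q) _⦋n⦌ →₀ k) →ₗ[k] ((simplexProd p q) _⦋n + 1⦌ →₀ k) :=
  Finsupp.lmapDomain k k fun x => mkSimplex (coneHom x.1) (coneHom x.2)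

lemma cone_single (p q n : ℕ) (f : ⦋n⦌ ⟶ ⦋p⦌) (g : ⦋n⦌ ⟶ ⦋q⦌) (r : k) :
    cone p q n (Finsupp.single (mkSimplex f g) r) = Finsupp.single
        (mkSimplex (coneHom f) (coneHom g)) r :=
  Finsupp.mapDomain_single

lemma chainOp_simplexProd_single {p q m n : ℕ} (φ : ⦋m⦌ ⟶ ⦋n⦌) (f : ⦋n⦌ ⟶ ⦋p⦌) (g : ⦋n⦌ ⟶ ⦋q⦌)
    (r : k) : chainOp (simplexProd p q) φ (Finsupp.single (mkSimplex f g) r) =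
      Finsupp.single (mkSimplex (φ ≫ f) (φ ≫ g)) r :=
  Finsupp.mapDomain_single

lemma chainOp_δ_zero_cone (p q n : ℕ) :
    chainOp (simplexProd p q) (SimplexCategory.δ 0) ∘ₗ cone p q n = LinearMap.id (R := k) := by
  refine Finsupp.lhom_ext fun x r => ?_
  obtain ⟨f, g, rfl⟩ := exists_mkSimplex x
  rw [LinearMap.comp_apply, cone_single, chainOp_simplexProd_single, δ_zero_comp_coneHom,
    δ_zero_comp_coneHom]
  rfl

lemma chainOp_δ_succ_cone (p q n : ℕ) (i : Fin (n + 2)) :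
    chainOp (simplexProd p q) (SimplexCategory.δ i.succ) ∘ₗ cone (k := k) p q (n + 1) =
      cone p q n ∘ₗ chainOp (simplexProd p q) (SimplexCategory.δ i) := by
  refine Finsupp.lhom_ext fun x r => ?_
  obtain ⟨f, g, rfl⟩ := exists_mkSimplex x
  rw [LinearMap.comp_apply, LinearMap.comp_apply, cone_single, chainOp_simplexProd_single,
    chainOp_simplexProd_single, δ_succ_comp_coneHom, δ_succ_comp_coneHom, cone_single]

/-- The cone operator is a contracting homotopy in positive degrees. -/
lemma bdry_cone (p q n : ℕ) (z : (simplexProd p q) _⦋n + 1⦌ →₀ k) :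
    bdry (simplexProd p q) (n + 2) (cone p q (n + 1) z) =
      z - cone p q n (bdry (simplexProd p q) (n + 1) z) := by
  rw [bdry_succ, Fin.sum_univ_succ, bdry_succ, map_sum, sub_eq_add_neg, ← Finset.sum_neg_distrib]
  congr 1
  · rw [Fin.val_zero, pow_zero, one_smul]
    exact congrArg (fun F => F z) (chainOp_δ_zero_cone p q (n + 1))
  · refine Finset.sum_congr rfl fun i _ => ?_
    rw [map_smul, Fin.val_succ, pow_succ, mul_neg_one, neg_smul]
    exact congrArg (fun F => - ((-1 : k) ^ (i : ℕ) • F z)) (chainOp_δ_succ_cone p q n i)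

/-- In degree `0` the cone operator is a homotopy from the identity to the projection onto the
bottom vertex. -/
lemma bdry_cone_zero (p q : ℕ) (z : (simplexProd p q) _⦋0⦌ →₀ k) :
    bdry (simplexProd p q) 1 (cone p q 0 z) =
      z - Finsupp.mapDomain (fun _ => mkSimplex (SimplexCategory.const _ _ 0)
          (SimplexCategory.const _ _ 0)) z := by
  rw [bdry_succ, Fin.sum_univ_two, Fin.val_zero, pow_zero, one_smul, Fin.val_one, pow_one, neg_smul,
    one_smul, sub_eq_add_neg]
  congr 1
  · exact congrArg (fun F => F z) (chainOp_δ_zero_cone p q 0)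
  · refine congrArg Neg.neg ?_
    have h : chainOp (simplexProd p q) (SimplexCategory.δ 1) ∘ₗ cone (k := k) p q 0 =
      Finsupp.lmapDomain k k (fun _ => mkSimplex (SimplexCategory.const _ _ 0)
          (SimplexCategory.const _ _ 0)) := by
      refine Finsupp.lhom_ext fun x r => ?_
      obtain ⟨f, g, rfl⟩ := exists_mkSimplex x
      rw [LinearMap.comp_apply, cone_single, chainOp_simplexProd_single, Finsupp.lmapDomain_apply,
        Finsupp.mapDomain_single]
      congr 2
      · exact simplex_hom_ext fun t => by
          obtain rfl : t = 0 := Subsingleton.elim (α := Fin 1) _ _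
          rfl
      · exact simplex_hom_ext fun t => by
          obtain rfl : t = 0 := Subsingleton.elim (α := Fin 1) _ _
          rfl
    exact congrArg (fun F => F z) h

/-- The cone operator preserves degenerate chains. -/
lemma cone_mem_degenerate (p q n : ℕ) {z : (simplexProd p q) _⦋n⦌ →₀ k}
    (hz : z ∈ degenerate ((linearization k).obj (simplexProd p q)) n) :
    cone p q n z ∈ degenerate ((linearization k).obj (simplexProd p q)) (n + 1) := by
  rw [← normClass_eq_zero_iff]
  suffices degenerate ((linearization k).obj (simplexProd p q)) n ≤
    LinearMap.ker (normClass (simplexProd p q) (n + 1) ∘ₗ cone p q n) from this hz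
  cases n with
  | zero => exact bot_le
  | succ n =>
    refine iSup_le fun i => ?_
    rintro _ ⟨x, rfl⟩
    change normClass (simplexProd p q) _ (cone p q (n + 1)
      (chainOp (simplexProd p q) (SimplexCategory.σ i) x)) = 0
    induction x using Finsupp.induction_linear with
    | zero => simp only [map_zero]
    | add x y hx hy => rw [map_add, map_add, map_add, hx, hy, add_zero]
    | single x r =>
      obtain ⟨f, g, rfl⟩ := exists_mkSimplex x
      rw [chainOp_simplexProd_single, cone_single, normClass_eq_zero_iff]
      have h (m : ℕ) (f : ⦋n⦌ ⟶ ⦋m⦌) : coneHom (SimplexCategory.σ i ≫ f) i.succ.castSucc =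
          coneHom (SimplexCategory.σ i ≫ f) i.succ.succ := by
        rw [← Fin.succ_castSucc, coneHom_succ, coneHom_succ]
        refine congrArg f ?_
        change i.predAbove i.castSucc = i.predAbove i.succ
        simp
      exact mkSimplex_mem_degenerate _ _ i.succ (h p f) (h q g) r

/-! ### The Leibniz rule for the shuffle map -/

lemma wordInv_cons_false {n : ℕ} (w : Fin n → Bool) :
    wordInv (· < ·) (Fin.cons false w : Fin (n + 1) → Bool) = wordInv (· < ·) w := by
  simp [wordInv, Fin.sum_univ_succ, Bool.lt_iff]

lemma wordInv_cons_true {n : ℕ} (w : Fin n → Bool) :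
    wordInv (· < ·) (Fin.cons true w : Fin (n + 1) → Bool) =
      wordCount w false n + wordInv (· < ·) w := by
  simp [wordInv, Fin.sum_univ_succ, wordCount, Bool.lt_iff]

/-- A first step in the direction `i` makes the map that counts `i` the cone over a map that misses
the bottom vertex. -/
lemma wordChain_cons_self {ι : Type*} {n : ℕ} (w : Fin n → ι) (i : ι) (q : ℕ) :
    wordChain (Fin.cons i w : Fin (n + 1) → ι) i (q + 1) =
      coneHom (wordChain w i q ≫ SimplexCategory.δ 0) := by
  refine simplex_hom_ext fun t => ?_
  induction t using Fin.cases with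
  | zero => rw [wordChain_apply, coneHom_zero, Fin.val_zero, wordCount_zero]; simp
  | succ t =>
    rw [wordChain_apply, coneHom_succ, Fin.val_succ, wordCount_cons, indic_of rfl]
    change _ = (wordChain w i q t : ℕ) + 1
    rw [wordChain_apply]
    omega

lemma wordChain_cons_of_ne {ι : Type*} {n : ℕ} (w : Fin n → ι) {i j : ι} (h : i ≠ j) (q : ℕ) :
    wordChain (Fin.cons i w : Fin (n + 1) → ι) j q = coneHom (wordChain w j q) := by
  refine simplex_hom_ext fun t => ?_
  induction t using Fin.cases with
  | zero => rw [wordChain_apply, coneHom_zero, Fin.val_zero, wordCount_zero]; simp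
  | succ t =>
    rw [wordChain_apply, coneHom_succ, Fin.val_succ, wordCount_cons, indic_of_not h, zero_add,
      wordChain_apply]

/-- The fundamental simplex of `Δ[p]`. -/
def fundChain (p : ℕ) : (yoneda.obj ⦋p⦌ : SSet.{0}) _⦋p⦌ →₀ k := Finsupp.single (𝟙 ⦋p⦌) 1

lemma bdry_fundChain (p : ℕ) : bdry (k := k) _ (p + 1) (fundChain (p + 1)) =
    ∑ i : Fin (p + 2), (-1 : k) ^ (i : ℕ) • Finsupp.single (SimplexCategory.δ i) 1 := by
  rw [bdry_succ]
  refine Finset.sum_congr rfl fun i _ => ?_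
  rw [fundChain, chainOp_single]
  refine congrArg (fun x => (-1 : k) ^ (i : ℕ) • Finsupp.single x 1)
      (Category.comp_id (SimplexCategory.δ i))

open scoped Classical in
lemma linShuffle_yoneda {p q a b n : ℕ} (h : a + b = n) (f : ⦋a⦌ ⟶ ⦋p⦌) (g : ⦋b⦌ ⟶ ⦋q⦌) :
    linShuffleₗ (k := k) (yoneda.obj ⦋p⦌) (yoneda.obj ⦋q⦌) a b n
      (Finsupp.single f 1) (Finsupp.single g 1) =
    ∑ w : Fin n → Bool, (if wordCount w false n = a ∧ wordCount w true n = b then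
      (-1 : k) ^ wordInv (· < ·) w else 0) •
        Finsupp.single (mkSimplex (wordChain w false a ≫ f) (wordChain w true b ≫ g)) 1 := by
  refine (linShuffle_single _ _ h _ _ _ _).trans (Finset.sum_congr rfl fun w _ => ?_)
  rw [ite_smul, zero_smul, one_mul]
  rfl

open scoped Classical in
lemma normClass_cone_linShuffle_single {p q a b n : ℕ} (h : a + b = n) (f : ⦋a⦌ ⟶ ⦋p⦌)
    (g : ⦋b⦌ ⟶ ⦋q⦌) :
    normClass (k := k) (simplexProd p q) (n + 1) (cone p q n
      (linShuffleₗ (yoneda.obj ⦋p⦌) (yoneda.obj ⦋q⦌) a b n (Finsupp.single f 1)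
          (Finsupp.single g 1))) =
    ∑ w : Fin n → Bool, (if wordCount w false n = a ∧ wordCount w true n = b then
        (-1 : k) ^ wordInv (· < ·) w else 0) • normClass (k := k) (simplexProd p q) (n + 1)
          (Finsupp.single (mkSimplex (coneHom (wordChain w false a ≫ f))
            (coneHom (wordChain w true b ≫ g))) 1) := by
  rw [linShuffle_yoneda h, map_sum, map_sum]
  refine Finset.sum_congr rfl fun w _ => ?_
  rw [map_smul, map_smul, cone_single]

/-- Cones over simplices that already start at the bottom vertex are degenerate. -/
lemma normClass_cone_linShuffle_eq_zero {p q a b n : ℕ} (h : a + b = n) (f : ⦋a⦌ ⟶ ⦋p⦌)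
    (g : ⦋b⦌ ⟶ ⦋q⦌) (hf : f 0 = 0) (hg : g 0 = 0) :
    normClass (k := k) (simplexProd p q) (n + 1) (cone p q n
      (linShuffleₗ (yoneda.obj ⦋p⦌) (yoneda.obj ⦋q⦌) a b n (Finsupp.single f 1)
          (Finsupp.single g 1)))
        = 0 := by
  rw [normClass_cone_linShuffle_single h]
  refine Finset.sum_eq_zero fun w _ => ?_
  rw [normClass_eq_zero_iff.2, smul_zero]
  have hw (i : Bool) (q : ℕ) : wordChain w i q 0 = 0 := Fin.ext (by
    rw [wordChain_apply, Fin.val_zero, wordCount_zero]; simp)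
  refine mkSimplex_mem_degenerate _ _ 0 ?_ ?_ 1
  · exact ((congrArg f (hw _ _)).trans hf).symm
  · exact ((congrArg g (hw _ _)).trans hg).symm

open scoped Classical in
/-- The cone over the first half of the expected boundary of the product of the fundamental
simplices consists of the shuffles whose first step is in the first direction. -/
lemma normClass_cone_bdry_left {p q n : ℕ} (h : p + q = n + 1) :
    normClass (k := k) (simplexProd p q) (n + 1) (cone p q n
      (linShuffleₗ (yoneda.obj ⦋p⦌) (yoneda.obj ⦋q⦌) (p - 1) q n (bdry _ p (fundChain p))
        (fundChain q))) =
    ∑ w : Fin n → Bool, (if wordCount (Fin.cons false w : Fin (n + 1) → Bool) false (n + 1) = p ∧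
        wordCount (Fin.cons false w : Fin (n + 1) → Bool) true (n + 1) = q then
      (-1 : k) ^ wordInv (· < ·) (Fin.cons false w : Fin (n + 1) → Bool) else 0) •
        normClass (k := k) (simplexProd p q) (n + 1)
          (Finsupp.single (mkSimplex (wordChain (Fin.cons false w : Fin (n + 1) → Bool) false p)
            (wordChain (Fin.cons false w : Fin (n + 1) → Bool) true q)) 1) := by
  cases p with
  | zero =>
    rw [bdry_zero, map_zero, LinearMap.zero_apply, map_zero, map_zero]
    refine (Finset.sum_eq_zero fun w _ => ?_).symm
    rw [if_neg, zero_smul]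
    rw [wordCount_cons, indic_of rfl]
    omega
  | succ p =>
    have h' : p + q = n := by omega
    rw [bdry_fundChain, map_sum, LinearMap.sum_apply, map_sum, map_sum,
      Finset.sum_eq_single_of_mem 0 (Finset.mem_univ _)]
    -- the face opposite to the bottom vertex gives the words that start with `false`
    · rw [Fin.val_zero, pow_zero, one_smul]
      refine (normClass_cone_linShuffle_single h' _ _).trans (Finset.sum_congr rfl fun w _ => ?_)
      rw [wordCount_cons, wordCount_cons, indic_of rfl, indic_of_not Bool.false_ne_true,
          wordInv_cons_false,
        wordChain_cons_self, wordChain_cons_of_ne _ Bool.false_ne_true, Category.comp_id]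
      refine congrArg (· • _) (if_congr ?_ rfl rfl)
      omega
    -- the other faces contain the bottom vertex, so that their cones are degenerate
    · intro i _ hi
      rw [map_smul, LinearMap.smul_apply, map_smul, map_smul]
      refine (congrArg _ (normClass_cone_linShuffle_eq_zero h' _ _ ?_ rfl)).trans (smul_zero _)
      exact Fin.succAbove_ne_zero_zero hi

open scoped Classical in
/-- The cone over the second half of the expected boundary of the product of the fundamental
simplices consists of the shuffles whose first step is in the second direction. -/
lemma normClass_cone_bdry_right {p q n : ℕ} (h : p + q = n + 1) :
    (-1 : k) ^ p • normClass (k := k) (simplexProd p q) (n + 1) (cone p q n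
      (linShuffleₗ (yoneda.obj ⦋p⦌) (yoneda.obj ⦋q⦌) p (q - 1) n (fundChain p)
        (bdry _ q (fundChain q)))) =
    ∑ w : Fin n → Bool, (if wordCount (Fin.cons true w : Fin (n + 1) → Bool) false (n + 1) = p ∧
        wordCount (Fin.cons true w : Fin (n + 1) → Bool) true (n + 1) = q then
      (-1 : k) ^ wordInv (· < ·) (Fin.cons true w : Fin (n + 1) → Bool) else 0) •
        normClass (k := k) (simplexProd p q) (n + 1)
          (Finsupp.single (mkSimplex (wordChain (Fin.cons true w : Fin (n + 1) → Bool) false p)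
            (wordChain (Fin.cons true w : Fin (n + 1) → Bool) true q)) 1) := by
  cases q with
  | zero =>
    rw [bdry_zero, map_zero, map_zero, map_zero, smul_zero]
    refine (Finset.sum_eq_zero fun w _ => ?_).symm
    rw [if_neg, zero_smul]
    rw [wordCount_cons _ true, indic_of rfl]
    omega
  | succ q =>
    have h' : p + q = n := by omega
    rw [bdry_fundChain, map_sum, map_sum, map_sum,
      Finset.sum_eq_single_of_mem 0 (Finset.mem_univ _)]
    · rw [Fin.val_zero, pow_zero, one_smul]
      refine (congrArg _ (normClass_cone_linShuffle_single h' _ _)).trans ?_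
      rw [Finset.smul_sum]
      refine (Finset.sum_congr rfl fun w _ => ?_)
      rw [wordCount_cons, wordCount_cons, indic_of rfl, indic_of_not Bool.false_ne_true.symm,
        wordInv_cons_true, wordChain_cons_self, wordChain_cons_of_ne _ Bool.false_ne_true.symm,
        Category.comp_id, smul_smul]
      by_cases hw : wordCount w false n = p
      · rw [hw, mul_ite, mul_zero, ← pow_add]
        refine congrArg (· • _) (if_congr ?_ rfl rfl)
        omega
      · rw [if_neg (fun e => hw e.1), if_neg (fun e => hw (by omega)), mul_zero]
    · intro i _ hi
      rw [map_smul, map_smul, map_smul]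
      refine (congrArg _ (normClass_cone_linShuffle_eq_zero h' _ _ rfl ?_)).trans (smul_zero _)
      exact Fin.succAbove_ne_zero_zero hi

/-- The boundary of `x × y` according to the Leibniz rule, as a chain. -/
def leibniz (X Y : SSet.{0}) (p q n : ℕ) :
    (X _⦋p⦌ →₀ k) →ₗ[k] (Y _⦋q⦌ →₀ k) →ₗ[k] ((prodSSet X Y) _⦋n⦌ →₀ k) :=
  linShuffleₗ X Y (p - 1) q n ∘ₗ bdry X p +
    (-1 : k) ^ p • (linShuffleₗ X Y p (q - 1) n).compl₂ (bdry Y q)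

lemma leibniz_apply (X Y : SSet.{0}) (p q n : ℕ) (x : X _⦋p⦌ →₀ k) (y : Y _⦋q⦌ →₀ k) :
    leibniz X Y p q n x y = linShuffleₗ X Y (p - 1) q n (bdry X p x) y +
      (-1 : k) ^ p • linShuffleₗ X Y p (q - 1) n x (bdry Y q y) := rfl

/-- Decomposition of the shuffles by their first step: the product of the fundamental simplices is,
modulo degenerate simplices, the cone over the expected boundary. -/
lemma normClass_cone_leibniz {p q n : ℕ} (h : p + q = n + 1) :
    normClass (k := k) (simplexProd p q) (n + 1) (cone p q n
      (leibniz (yoneda.obj ⦋p⦌) (yoneda.obj ⦋q⦌) p q n (fundChain p) (fundChain q))) =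
    normClass (simplexProd p q) (n + 1) (linShuffleₗ (yoneda.obj ⦋p⦌) (yoneda.obj ⦋q⦌) p q (n + 1)
      (fundChain p) (fundChain q)) := by
  classical
  rw [leibniz_apply, map_add, map_add, map_smul, map_smul]
  refine (congrArg₂ (· + ·) (normClass_cone_bdry_left h) (normClass_cone_bdry_right h)).trans ?_
  rw [fundChain, fundChain]
  refine Eq.trans ?_ (congrArg _ (linShuffle_yoneda h (𝟙 _) (𝟙 _))).symm
  rw [map_sum, ← Equiv.sum_comp (Fin.consEquiv (fun _ => Bool)), Fintype.sum_prod_type,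
    Fintype.sum_bool]
  refine (add_comm _ _).trans ?_
  simp only [map_smul, Category.comp_id]
  rfl

lemma chainMap_linShuffleₗ {X Y X' Y' : SSet.{0}} (φ : X ⟶ X') (ψ : Y ⟶ Y') (p q n : ℕ)
    (x : X _⦋p⦌ →₀ k) (y : Y _⦋q⦌ →₀ k) :
    chainMap (prodSSetMap φ ψ) n (linShuffleₗ X Y p q n x y) =
      linShuffleₗ X' Y' p q n (chainMap φ p x) (chainMap ψ q y) :=
  chainMap_linShuffle φ ψ p q n x y

lemma chainMap_leibniz {X Y X' Y' : SSet.{0}} (φ : X ⟶ X') (ψ : Y ⟶ Y') (p q n : ℕ)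
    (x : X _⦋p⦌ →₀ k) (y : Y _⦋q⦌ →₀ k) :
    chainMap (prodSSetMap φ ψ) n (leibniz X Y p q n x y) =
      leibniz X' Y' p q n (chainMap φ p x) (chainMap ψ q y) := by
  rw [leibniz_apply, leibniz_apply, map_add, map_smul, chainMap_linShuffleₗ, chainMap_linShuffleₗ,
    chainMap_bdry, chainMap_bdry]

/-- If the shuffle map satisfies the Leibniz rule in degree `n`, then the expected boundary of a
product of degree `n + 1` is a cycle. -/
lemma normClass_bdry_leibniz {X Y : SSet.{0}} {n : ℕ}
    (ih : ∀ p q, p + q = n → ∀ (x : X _⦋p⦌ →₀ k) (y : Y _⦋q⦌ →₀ k),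
      normClass (prodSSet X Y) (n - 1) (bdry _ n (linShuffleₗ X Y p q n x y)) =
        normClass _ (n - 1) (leibniz X Y p q (n - 1) x y))
    {p q : ℕ} (h : p + q = n + 1) (x : X _⦋p⦌ →₀ k) (y : Y _⦋q⦌ →₀ k) :
    normClass (prodSSet X Y) (n - 1) (bdry _ n (leibniz X Y p q n x y)) = 0 := by
  rw [leibniz_apply, map_add, map_add, map_smul, map_smul]
  have hx : normClass (prodSSet X Y) (n - 1)
      (bdry _ n (linShuffleₗ X Y (p - 1) q n (bdry X p x) y)) =
      (-1 : k) ^ (p + 1) • normClass (prodSSet X Y) (n - 1)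
        (linShuffleₗ X Y (p - 1) (q - 1) (n - 1) (bdry X p x) (bdry Y q y)) := by
    cases p with
    | zero => rw [bdry_zero]; simp only [map_zero, LinearMap.zero_apply, smul_zero]
    | succ p =>
      refine (ih p q (by omega) _ y).trans ?_
      rw [leibniz_apply]
      have hb : bdry X p (bdry X (p + 1) x) = 0 := bdry_bdry X (p + 1) x
      rw [hb, map_zero, LinearMap.zero_apply, zero_add, map_smul, pow_succ, pow_succ, mul_assoc,
        mul_neg_one, neg_neg, mul_one]
      rfl
  have hy : normClass (prodSSet X Y) (n - 1)
      (bdry _ n (linShuffleₗ X Y p (q - 1) n x (bdry Y q y))) =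
      normClass (prodSSet X Y) (n - 1)
        (linShuffleₗ X Y (p - 1) (q - 1) (n - 1) (bdry X p x) (bdry Y q y)) := by
    cases q with
    | zero => rw [bdry_zero]; simp only [map_zero]
    | succ q =>
      refine (ih p q (by omega) x _).trans ?_
      rw [leibniz_apply]
      have hb : bdry Y q (bdry Y (q + 1) y) = 0 := bdry_bdry Y (q + 1) y
      rw [hb, map_zero, smul_zero, add_zero]
      rfl
  rw [hx, hy, ← add_smul, pow_succ, mul_neg_one, neg_add_cancel, zero_smul]

lemma single_eq_chainMap_fundChain (X : SSet.{0}) {p : ℕ} (a : X _⦋p⦌) :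
    Finsupp.single a 1 = chainMap (classify a) p (fundChain (k := k) p) := by
  rw [fundChain, chainMap_single, classify_id]

/-- The projection of the expected boundary in degree `0` onto a vertex vanishes. -/
lemma mapDomain_const_leibniz {p q : ℕ} (h : p + q = 1) (v : (simplexProd p q) _⦋0⦌) :
    Finsupp.mapDomain (fun _ => v) (leibniz (k := k) (yoneda.obj ⦋p⦌) (yoneda.obj ⦋q⦌) p q 0
      (fundChain p) (fundChain q)) = 0 := by
  have key (f : ⦋0⦌ ⟶ ⦋p⦌) (g : ⦋0⦌ ⟶ ⦋q⦌) : Finsupp.mapDomain (fun _ => v)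
      (linShuffleₗ (k := k) (yoneda.obj ⦋p⦌) (yoneda.obj ⦋q⦌) 0 0 0 (Finsupp.single f 1)
        (Finsupp.single g 1)) = Finsupp.single v 1 := by
    rw [linShuffle_yoneda (n := 0) rfl, Fintype.sum_unique]
    simp [wordCount_zero, wordInv, Finsupp.mapDomain_single]
  have hadd (x y : (simplexProd p q) _⦋0⦌ →₀ k) : Finsupp.mapDomain (fun _ => v) (x + y) =
      Finsupp.mapDomain (fun _ => v) x + Finsupp.mapDomain (fun _ => v) y := Finsupp.mapDomain_add
  have hsmul (r : k) (x : (simplexProd p q) _⦋0⦌ →₀ k) : Finsupp.mapDomain (fun _ => v) (r • x) =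
      r • Finsupp.mapDomain (fun _ => v) x := Finsupp.mapDomain_smul r x
  rw [leibniz_apply]
  obtain ⟨rfl, rfl⟩ | ⟨rfl, rfl⟩ : p = 1 ∧ q = 0 ∨ p = 0 ∧ q = 1 := by omega
  · rw [bdry_fundChain, bdry_zero, Fin.sum_univ_two, map_zero, smul_zero, add_zero, map_add,
      map_smul, map_smul, LinearMap.add_apply, LinearMap.smul_apply, LinearMap.smul_apply, hadd,
      hsmul, hsmul, fundChain]
    refine (congrArg₂ (fun x y => _ • x + _ • y) (key _ _) (key _ _)).trans ?_
    simp
  · rw [bdry_fundChain, bdry_zero, Fin.sum_univ_two, map_zero, LinearMap.zero_apply, zero_add,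
      map_add, map_smul, map_smul, hsmul, hadd, hsmul, hsmul, fundChain]
    refine (congrArg₂ (fun x y => _ • (_ • x + _ • y)) (key _ _) (key _ _)).trans ?_
    simp

/-- The shuffle map satisfies the Leibniz rule modulo degenerate chains.  By naturality it suffices
to consider the fundamental simplices.  Their product is, modulo degenerate chains, the cone `c z`
over the expected boundary `z`, and `d c z = z - c d z`, where `d z` is degenerate by induction. -/
theorem normClass_bdry_linShuffle (n : ℕ) : ∀ (p q : ℕ), p + q = n → ∀ (X Y : SSet.{0})
    (x : X _⦋p⦌ →₀ k) (y : Y _⦋q⦌ →₀ k),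
      normClass (prodSSet X Y) (n - 1) (bdry _ n (linShuffleₗ X Y p q n x y)) =
        normClass _ (n - 1) (leibniz X Y p q (n - 1) x y) := by
  induction n with
  | zero =>
    intro p q h X Y x y
    obtain ⟨rfl, rfl⟩ : p = 0 ∧ q = 0 := by omega
    rw [leibniz_apply, bdry_zero, bdry_zero, bdry_zero]
    simp only [map_zero, LinearMap.zero_apply, smul_zero, add_zero]
  | succ n ih =>
    intro p q h X Y x y
    suffices H : (linShuffleₗ X Y p q (n + 1)).compr₂
        (normClass (k := k) (prodSSet X Y) n ∘ₗ bdry _ (n + 1)) =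
      (leibniz X Y p q n).compr₂ (normClass _ n) from congrArg (fun F => F x y) H
    refine bilinear_ext fun a b => ?_
    simp only [LinearMap.compr₂_apply, LinearMap.comp_apply]
    rw [single_eq_chainMap_fundChain X a, single_eq_chainMap_fundChain Y b,
      ← chainMap_linShuffleₗ, ← chainMap_leibniz]
    suffices U : normClass (k := k) (simplexProd p q) n (bdry _ (n + 1)
        (linShuffleₗ _ _ p q (n + 1) (fundChain p) (fundChain q))) =
        normClass (simplexProd p q) n (leibniz _ _ p q n (fundChain p) (fundChain q)) by
      have e := chainMap_bdry (k := k) (prodSSetMap (classify a) (classify b)) (n + 1)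
        (linShuffleₗ _ _ p q (n + 1) (fundChain p) (fundChain q))
      rw [normClass_chainMap, ← U]
      exact congrArg (normClass (prodSSet X Y) n) e.symm
    have h1 := congrArg
      (((normalization k).obj ((linearization k).obj (simplexProd p q))).d (n + 1) n).hom
      (normClass_cone_leibniz (k := k) h)
    refine h1.symm.trans ?_
    change normClass (simplexProd p q) n (bdry _ (n + 1) (cone p q n _)) = _
    cases n with
    | zero =>
      rw [bdry_cone_zero, mapDomain_const_leibniz h, sub_zero]
    | succ n =>
      have h2 := normClass_bdry_leibniz (fun p' q' h' x y => ih p' q' h' _ _ x y) h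
        (fundChain (k := k) p) (fundChain q)
      have h3 := cone_mem_degenerate p q n (normClass_eq_zero_iff.1 h2)
      rw [bdry_cone, map_sub, normClass_eq_zero_iff.2 h3, sub_zero]

/-! ### Eilenberg–Zilber maps and the maps induced by functors -/

variable (k) in
/-- The normalized chains of a simplicial set. -/
abbrev normChains (X : SSet.{0}) : ChainComplex (ModuleCat.{u} k) ℕ :=
  (normalization k).obj ((linearization k).obj X)

variable (k) in
/-- The map on normalized chains induced by a map of simplicial sets. -/
abbrev normChainsMap {X Y : SSet.{0}} (φ : X ⟶ Y) : normChains k X ⟶ normChains k Y :=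
  (normalization k).map ((linearization k).map φ)

variable (k) in
/-- The Eilenberg–Zilber map. -/
def ezMap (X Y : SSet.{0}) : normChains k X ⊗ normChains k Y ⟶ normChains k (prodSSet X Y) :=
  tensorDesc (ezBilin X Y) fun p q n h x y => by
    obtain ⟨x, rfl⟩ := normClass_surjective X p x
    obtain ⟨y, rfl⟩ := normClass_surjective Y q y
    have h1 : ezBilin X Y (p - 1) q (n - 1) (((normChains k X).d p (p - 1)).hom (normClass X p x))
        (normClass Y q y) = normClass (prodSSet X Y) (n - 1)
          (linShuffleₗ X Y (p - 1) q (n - 1) (bdry X p x) y) := by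
      rw [← normClass_bdry]
      cases p with
      | zero => rw [bdry_zero]; simp only [map_zero, LinearMap.zero_apply]
      | succ p => exact ezBilin_normClass X Y (by omega) _ _
    have h2 : ezBilin X Y p (q - 1) (n - 1) (normClass X p x)
        (((normChains k Y).d q (q - 1)).hom (normClass Y q y)) = normClass (prodSSet X Y) (n - 1)
          (linShuffleₗ X Y p (q - 1) (n - 1) x (bdry Y q y)) := by
      rw [← normClass_bdry]
      cases q with
      | zero => rw [bdry_zero]; simp only [map_zero]
      | succ q => exact ezBilin_normClass X Y (by omega) _ _
    rw [h1, h2, ezBilin_normClass X Y h, ← map_smul, ← map_add]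
    exact normClass_bdry_linShuffle n p q h X Y x y

lemma ezMap_tmul {X Y : SSet.{0}} {p q n : ℕ} (h : p + q = n) (x : X _⦋p⦌ →₀ k) (y : Y _⦋q⦌ →₀ k) :
    ((ezMap k X Y).f n).hom (tmul h (normClass X p x) (normClass Y q y)) =
      normClass (prodSSet X Y) n (linShuffle X Y p q n x y) :=
  (tensorDesc_tmul _ _ h _ _).trans (ezBilin_normClass X Y h x y)

/-- The identification of `X_1 × (X_2 × … × X_m)` with `X_1 × … × X_m`. -/
def consMap {m : ℕ} (X : Fin (m + 1) → SSet.{0}) :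
    prodSSet (X 0) (piSSet fun s => X s.succ) ⟶ piSSet X where
  app Δ := ↾fun y => Fin.cons (α := fun s => (X s).obj Δ) y.1 y.2
  naturality Δ Δ' f := by
    refine ConcreteCategory.hom_ext _ _ fun y => funext fun s => ?_
    induction s using Fin.cases with
    | zero => rfl
    | succ s => rfl

variable (k) in
/-- The iterated Eilenberg–Zilber map. -/
def iterEZ {m : ℕ} (X : Fin m → SSet.{0}) :
    tensorFam (fun s => normChains k (X s)) ⟶ normChains k (piSSet X) :=
  match m, X with
  | 0, X => unitDesc (normClass (piSSet X) 0 (Finsupp.single (fun s => s.elim0) 1))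
  | _ + 1, X => (𝟙 (normChains k (X 0)) ⊗ₘ iterEZ fun s => X s.succ) ≫
      ezMap k (X 0) (piSSet fun s => X s.succ) ≫ normChainsMap k (consMap X)

/-- The iterated Eilenberg–Zilber map is given by iterated shuffle products. -/
lemma iterEZ_tprod {m : ℕ} (X : Fin m → SSet.{0}) (q : Fin m → ℕ) (x : ∀ s, (X s) _⦋q s⦌ →₀ k) :
    ((iterEZ k X).f (∑ s, q s)).hom (tprod fun s => normClass (X s) (q s) (x s)) =
      normClass (piSSet X) (∑ s, q s) (iterShuffle X q (∑ s, q s) x) := by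
  induction m with
  | zero => exact unitDesc_unitElem _
  | succ m ih =>
    have h1 := tensorHom_tmul (𝟙 (normChains k (X 0))) (iterEZ k fun s => X s.succ)
      (Fin.sum_univ_succ q).symm (normClass (X 0) (q 0) (x 0))
      (tprod fun s : Fin m => normClass (X s.succ) (q s.succ) (x s.succ))
    rw [ih] at h1
    refine (congrArg (fun z => ((ezMap k _ _ ≫ normChainsMap k (consMap X)).f _).hom z) h1).trans ?_
    have h2 := ezMap_tmul (Y := piSSet fun s => X s.succ) (Fin.sum_univ_succ q).symm (x 0)
      (iterShuffle (fun s => X s.succ) (fun s => q s.succ) (∑ s, q (Fin.succ s)) fun s => x s.succ)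
    exact congrArg (fun z => ((normChainsMap k (consMap X)).f _).hom z) h2

/-- The map of simplicial sets `N C × N B_1 × … × N B_m → N E` induced by a functor. -/
def nerveActMap {C E : Type} [Category.{0} C] [Category.{0} E] {m : ℕ} {B : Fin m → Type}
    [∀ s, Category.{0} (B s)] (F : C × (∀ s, B s) ⥤ E) :
    prodSSet (nerve C) (piSSet fun s => nerve (B s)) ⟶ nerve E where
  app Δ := ↾fun x => nerveAct F Δ.unop.len x
  naturality _ _ _ := rfl

/-- The map `F_*` on normalized chains. -/
def inducedMap {C E : Type} [Category.{0} C] [Category.{0} E] {m : ℕ} {B : Fin m → Type}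
    [∀ s, Category.{0} (B s)] (F : C × (∀ s, B s) ⥤ E) :
    normChains k (nerve C) ⊗ tensorFam (fun s => normChains k (nerve (B s))) ⟶
      normChains k (nerve E) :=
  (𝟙 (normChains k (nerve C)) ⊗ₘ iterEZ k fun s => nerve (B s)) ≫
    ezMap k (nerve C) (piSSet fun s => nerve (B s)) ≫ normChainsMap k (nerveActMap F)

/-- The map `F_*` on classes of chains. -/
lemma inducedMap_tmul {C E : Type} [Category.{0} C] [Category.{0} E] {m : ℕ} {B : Fin m → Type}
    [∀ s, Category.{0} (B s)] (F : C × (∀ s, B s) ⥤ E) {p : ℕ} {q : Fin m → ℕ} {N : ℕ}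
    (h : p + ∑ s, q s = N) (x : nerve C _⦋p⦌ →₀ k) (y : ∀ s, nerve (B s) _⦋q s⦌ →₀ k) :
    ((inducedMap F).f N).hom (tmul h (normClass (nerve C) p x)
      (tprod fun s => normClass (nerve (B s)) (q s) (y s))) =
    normClass (nerve E) N (Finsupp.mapDomain (nerveAct F N)
      (linShuffle (nerve C) (piSSet fun s => nerve (B s)) p (∑ s, q s) N x
        (iterShuffle (fun s => nerve (B s)) q (∑ s, q s) y))) := by
  have h1 := tensorHom_tmul (𝟙 (normChains k (nerve C))) (iterEZ k fun s => nerve (B s)) h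
    (normClass (nerve C) p x) (tprod fun s => normClass (nerve (B s)) (q s) (y s))
  rw [iterEZ_tprod] at h1
  refine (congrArg (fun z => ((ezMap k _ _ ≫ normChainsMap k (nerveActMap F)).f _).hom z) h1).trans
      ?_
  have h2 := ezMap_tmul (Y := piSSet fun s => nerve (B s)) h x
      (iterShuffle (fun s => nerve (B s)) q (∑ s, q s) y)
  exact congrArg (fun z => ((normChainsMap k (nerveActMap F)).f _).hom z) h2

/-- Structure maps on chains from structure functors. -/
def chainStructure {P M : SymmSeq Cat.{0, 0}}
    (F : ∀ (n : ℕ) (j : Fin n → ℕ), (P.obj n × ∀ s, M.obj (j s)) ⥤ M.obj (∑ s, j s)) :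
    StructureMaps (P.map (chains k)) (M.map (chains k)) :=
  fun n j => inducedMap (F n j)

/-- The structure maps on classes of chains are given by the formula for `F_*`. -/
lemma chainStructure_app {P M : SymmSeq Cat.{0, 0}}
    (F : ∀ (n : ℕ) (j : Fin n → ℕ), (P.obj n × ∀ s, M.obj (j s)) ⥤ M.obj (∑ s, j s))
    {n : ℕ} {j : Fin n → ℕ} {p : ℕ} {q : Fin n → ℕ} {N : ℕ} (h : p + ∑ s, q s = N)
    (x : nerve (P.obj n) _⦋p⦌ →₀ k) (y : ∀ s, nerve (M.obj (j s)) _⦋q s⦌ →₀ k) :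
    (chainStructure F).app h (normClass (nerve (P.obj n)) p x)
      (fun s => normClass (nerve (M.obj (j s))) (q s) (y s)) =
    normClass (nerve (M.obj (∑ s, j s))) N (Finsupp.mapDomain (nerveAct (F n j) N)
      (linShuffle (nerve (P.obj n)) (piSSet fun s => nerve (M.obj (j s))) p (∑ s, q s) N x
        (iterShuffle (fun s => nerve (M.obj (j s))) q (∑ s, q s) y))) :=
  inducedMap_tmul (F n j) h x y

/-! ### Words in a disjoint union of two alphabets -/

/-- For a strictly monotone sequence, the terms below a bound are counted by an initial segment. -/
lemma lt_iff_lt_card {n : ℕ} {f : Fin n → ℕ} (hf : StrictMono f) (t : ℕ) (v : Fin n) :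
    f v < t ↔ v.val < ∑ v', indic (f v' < t) := by
  simp only [indic_eq_ite]
  rw [← Finset.card_filter]
  constructor
  · intro h
    have : Finset.Iic v ⊆ Finset.univ.filter (fun v' => f v' < t) := fun v' hv' => by
      simp only [Finset.mem_filter, Finset.mem_univ, true_and]
      exact (hf.monotone (Finset.mem_Iic.1 hv')).trans_lt h
    have := Finset.card_le_card this
    rw [Fin.card_Iic] at this
    omega
  · intro h
    by_contra hc
    have : Finset.univ.filter (fun v' => f v' < t) ⊆ Finset.Iio v := fun v' hv' => by
      simp only [Finset.mem_filter, Finset.mem_univ, true_and] at hv'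
      exact Finset.mem_Iio.2 (hf.lt_iff_lt.1 (hv'.trans_le (not_lt.1 hc)))
    have := Finset.card_le_card this
    rw [Fin.card_Iio] at this
    omega

/-- The positions of the two letters of a word, in increasing order. -/
structure WordSplit {n n' N : ℕ} (c : Fin N → Bool) where
  equiv : Fin n ⊕ Fin n' ≃ Fin N
  strictMono_inl : StrictMono fun v => equiv (Sum.inl v)
  strictMono_inr : StrictMono fun v => equiv (Sum.inr v)
  apply_inl : ∀ v, c (equiv (Sum.inl v)) = false
  apply_inr : ∀ v, c (equiv (Sum.inr v)) = true

lemma WordSplit.nonempty {n n' N : ℕ} (c : Fin N → Bool)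
    (h : wordCount c false N = n ∧ wordCount c true N = n') :
    Nonempty (WordSplit (n := n) (n' := n') c) := by
  have hb (b : Bool) : (Finset.univ.filter (fun u => c u = b)).card = wordCount c b N := by
    rw [Finset.card_filter, wordCount]
    refine Finset.sum_congr rfl fun u _ => ?_
    simp [indic_eq_ite]
  set e := (Finset.univ.filter (fun u => c u = false)).orderEmbOfFin ((hb _).trans h.1)
  set e' := (Finset.univ.filter (fun u => c u = true)).orderEmbOfFin ((hb _).trans h.2)
  have he (v) : c (e v) = false := by
    simpa [-Finset.orderEmbOfFin_mem] using Finset.orderEmbOfFin_mem _ ((hb false).trans h.1) v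
  have he' (v) : c (e' v) = true := by
    simpa [-Finset.orderEmbOfFin_mem] using Finset.orderEmbOfFin_mem _ ((hb true).trans h.2) v
  have hinj : Function.Injective (Sum.elim e e') := by
    refine e.injective.sumElim e'.injective fun a b hab => ?_
    have := he a
    rw [hab, he'] at this
    cases this
  have hcard : Fintype.card (Fin n ⊕ Fin n') = Fintype.card (Fin N) := by
    have := wordCount_bool_add c le_rfl
    rw [Fintype.card_sum, Fintype.card_fin, Fintype.card_fin, Fintype.card_fin]
    omega
  exact ⟨⟨Equiv.ofBijective _ ((Fintype.bijective_iff_injective_and_card _).2 ⟨hinj, hcard⟩),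
    e.strictMono, e'.strictMono, he, he'⟩⟩

namespace WordSplit

variable {n n' N : ℕ} {c : Fin N → Bool} (E : WordSplit (n := n) (n' := n') c)
  {ι ι' : Type} (w : Fin n → ι) (w' : Fin n' → ι')

/-- The word with the letters of `w` and of `w'` in the positions prescribed by `c`. -/
def join : Fin N → ι ⊕ ι' := Sum.map w w' ∘ E.equiv.symm

lemma join_apply (x : Fin n ⊕ Fin n') : E.join w w' (E.equiv x) = Sum.map w w' x := by
  simp [join]

lemma sum_eq {V : Type*} [AddCommMonoid V] (f : Fin N → V) :
    ∑ u, f u = ∑ v, f (E.equiv (Sum.inl v)) + ∑ v, f (E.equiv (Sum.inr v)) := by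
  rw [← Equiv.sum_comp E.equiv, Fintype.sum_sum_type]

lemma wordCount_false (t : ℕ) :
    wordCount c false t = ∑ v, indic ((E.equiv (Sum.inl v)).val < t) := by
  rw [wordCount, E.sum_eq]
  simp [E.apply_inl, E.apply_inr]

lemma wordCount_true (t : ℕ) :
    wordCount c true t = ∑ v, indic ((E.equiv (Sum.inr v)).val < t) := by
  rw [wordCount, E.sum_eq]
  simp [E.apply_inl, E.apply_inr]

lemma lt_iff_inl (t : ℕ) (v : Fin n) :
    (E.equiv (Sum.inl v)).val < t ↔ v.val < wordCount c false t := by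
  rw [E.wordCount_false]
  exact lt_iff_lt_card (f := fun v => (E.equiv (Sum.inl v)).val)
      (fun a b hab => E.strictMono_inl hab) t v

lemma lt_iff_inr (t : ℕ) (v : Fin n') :
    (E.equiv (Sum.inr v)).val < t ↔ v.val < wordCount c true t := by
  rw [E.wordCount_true]
  exact lt_iff_lt_card (f := fun v => (E.equiv (Sum.inr v)).val)
      (fun a b hab => E.strictMono_inr hab) t v

lemma wordCount_join_inl (i : ι) (t : ℕ) :
    wordCount (E.join w w') (Sum.inl i) t = wordCount w i (wordCount c false t) := by
  rw [wordCount, E.sum_eq]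
  conv_rhs => rw [wordCount]
  have h1 (v) : ((E.equiv (Sum.inl v)).val < t ∧ E.join w w' (E.equiv (Sum.inl v)) = Sum.inl i) ↔
      (v.val < wordCount c false t ∧ w v = i) := by
    rw [E.lt_iff_inl, join_apply, Sum.map_inl, Sum.inl.injEq]
  have h2 (v) : ¬ ((E.equiv (Sum.inr v)).val < t ∧ E.join w w' (E.equiv (Sum.inr v)) = Sum.inl
      i) := by
    rw [join_apply]
    simp
  simp only [h1, h2, indic_false, Finset.sum_const_zero, add_zero]

lemma wordCount_join_inr (i : ι') (t : ℕ) :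
    wordCount (E.join w w') (Sum.inr i) t = wordCount w' i (wordCount c true t) := by
  rw [wordCount, E.sum_eq]
  conv_rhs => rw [wordCount]
  have h1 (v) : ((E.equiv (Sum.inr v)).val < t ∧ E.join w w' (E.equiv (Sum.inr v)) = Sum.inr i) ↔
      (v.val < wordCount c true t ∧ w' v = i) := by
    rw [E.lt_iff_inr, join_apply, Sum.map_inr, Sum.inr.injEq]
  have h2 (v) : ¬ ((E.equiv (Sum.inl v)).val < t ∧ E.join w w' (E.equiv (Sum.inl v)) = Sum.inr
      i) := by
    rw [join_apply]
    simp
  simp only [h1, h2, indic_false, Finset.sum_const_zero, zero_add]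

/-- An inversion of a join is an inversion of the pattern or of one of the two subwords. -/
lemma wordInv_join (r : ι → ι → Prop) (r' : ι' → ι' → Prop) :
    wordInv (Sum.Lex r r') (E.join w w') = wordInv (· < ·) c + wordInv r w + wordInv r' w' := by
  have h1 (a b) : (E.equiv (Sum.inl a) < E.equiv (Sum.inl b) ∧ Sum.Lex r r'
      (E.join w w' (E.equiv (Sum.inl b))) (E.join w w' (E.equiv (Sum.inl a)))) ↔
      (a < b ∧ r (w b) (w a)) := by
    rw [join_apply, join_apply, Sum.map_inl, Sum.map_inl, Sum.lex_inl_inl,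
      E.strictMono_inl.lt_iff_lt]
  have h2 (a b) : (E.equiv (Sum.inr a) < E.equiv (Sum.inr b) ∧ Sum.Lex r r'
      (E.join w w' (E.equiv (Sum.inr b))) (E.join w w' (E.equiv (Sum.inr a)))) ↔
      (a < b ∧ r' (w' b) (w' a)) := by
    rw [join_apply, join_apply, Sum.map_inr, Sum.map_inr, Sum.lex_inr_inr,
      E.strictMono_inr.lt_iff_lt]
  have h3 (a b) : ¬ (E.equiv (Sum.inl a) < E.equiv (Sum.inr b) ∧ Sum.Lex r r'
      (E.join w w' (E.equiv (Sum.inr b))) (E.join w w' (E.equiv (Sum.inl a)))) := by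
    rw [join_apply, join_apply, Sum.map_inr, Sum.map_inl]
    simp
  have h4 (a b) : (E.equiv (Sum.inr a) < E.equiv (Sum.inl b) ∧ Sum.Lex r r'
      (E.join w w' (E.equiv (Sum.inl b))) (E.join w w' (E.equiv (Sum.inr a)))) ↔
      (E.equiv (Sum.inr a) < E.equiv (Sum.inl b) ∧ c (E.equiv (Sum.inl b)) < c
          (E.equiv (Sum.inr a))) := by
    rw [join_apply, join_apply, Sum.map_inr, Sum.map_inl, E.apply_inl, E.apply_inr]
    simp
  have h5 (a b) : ¬ (E.equiv (Sum.inl a) < E.equiv b ∧ c (E.equiv b) < c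
      (E.equiv (Sum.inl a))) := by
    rw [E.apply_inl]
    simp
  have h6 (a b) : ¬ (E.equiv (Sum.inr a) < E.equiv (Sum.inr b) ∧
      c (E.equiv (Sum.inr b)) < c (E.equiv (Sum.inr a))) := by
    rw [E.apply_inr, E.apply_inr]
    simp
  simp only [wordInv, E.sum_eq]
  simp only [h1, h2, h3, h4, h5, h6, indic_false, Finset.sum_const_zero, zero_add, add_zero,
    Finset.sum_add_distrib]
  ring

lemma wordChain_join_inl (h : wordCount c false N = n) (i : ι) (q : ℕ) :
    wordChain (E.join w w') (Sum.inl i) q = wordChain c false n ≫ wordChain w i q := by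
  refine simplex_hom_ext fun t => ?_
  rw [wordChain_apply, E.wordCount_join_inl, ← wordChain_apply_of_le c false h.le]
  rfl

lemma wordChain_join_inr (h : wordCount c true N = n') (i : ι') (q : ℕ) :
    wordChain (E.join w w') (Sum.inr i) q = wordChain c true n' ≫ wordChain w' i q := by
  refine simplex_hom_ext fun t => ?_
  rw [wordChain_apply, E.wordCount_join_inr, ← wordChain_apply_of_le c true h.le]
  rfl

lemma isRight_join (u : Fin N) : (E.join w w' u).isRight = c u := by
  obtain ⟨x, rfl⟩ := E.equiv.surjective u
  rw [join_apply]
  cases x <;> simp [E.apply_inl, E.apply_inr]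

lemma join_injective {w v : Fin n → ι} {w' v' : Fin n' → ι'} (h : E.join w w' = E.join v v') :
    w = v ∧ w' = v' := by
  constructor
  · funext a
    have := congrFun h (E.equiv (Sum.inl a))
    simpa [join_apply] using this
  · funext a
    have := congrFun h (E.equiv (Sum.inr a))
    simpa [join_apply] using this

/-- A word with pattern `c` is obtained from its two subwords. -/
lemma exists_join (W : Fin N → ι ⊕ ι') (hW : ∀ u, (W u).isRight = c u) :
    ∃ w w', E.join w w' = W := by
  have h1 (v : Fin n) : ∃ i, W (E.equiv (Sum.inl v)) = Sum.inl i := by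
    have := hW (E.equiv (Sum.inl v))
    rw [E.apply_inl] at this
    cases h : W (E.equiv (Sum.inl v)) with
    | inl i => exact ⟨i, rfl⟩
    | inr i => rw [h] at this; cases this
  have h2 (v : Fin n') : ∃ i, W (E.equiv (Sum.inr v)) = Sum.inr i := by
    have := hW (E.equiv (Sum.inr v))
    rw [E.apply_inr] at this
    cases h : W (E.equiv (Sum.inr v)) with
    | inl i => rw [h] at this; cases this
    | inr i => exact ⟨i, rfl⟩
  choose w hw using h1
  choose w' hw' using h2
  refine ⟨w, w', funext fun u => ?_⟩
  obtain ⟨x, rfl⟩ := E.equiv.surjective u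
  rw [join_apply]
  cases x with
  | inl v => exact (hw v).symm
  | inr v => exact (hw' v).symm

end WordSplit

lemma wordCount_isRight {ι ι' : Type} [Fintype ι] [Fintype ι'] {N : ℕ} (W : Fin N → ι ⊕ ι') :
    wordCount (fun u => (W u).isRight) false N = ∑ i, wordCount W (Sum.inl i) N ∧
      wordCount (fun u => (W u).isRight) true N = ∑ i, wordCount W (Sum.inr i) N := by
  simp only [wordCount, Fin.is_lt, true_and]
  rw [Finset.sum_comm, Finset.sum_comm (s := (Finset.univ : Finset ι'))]
  constructor <;> refine Finset.sum_congr rfl fun u _ => ?_ <;> rcases W u with i | i <;>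
    simp [sum_indic_eq]

open scoped Classical in
/-- A sum over the words in a disjoint union of two alphabets, with `n` letters in the first one and
`n'` letters in the second one, as a sum over a pattern and the two subwords. -/
lemma sum_join {ι ι' : Type} [Fintype ι] [Fintype ι'] {V : Type*} [AddCommMonoid V] {n n' N : ℕ}
    (E : ∀ c : Fin N → Bool, wordCount c false N = n ∧ wordCount c true N = n' →
      WordSplit (n := n) (n' := n') c)
    (f : (Fin N → ι ⊕ ι') → V)
    (hf : ∀ W, f W ≠ 0 → ∑ i, wordCount W (Sum.inl i) N = n ∧ ∑ i, wordCount W (Sum.inr i) N = n') :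
    ∑ W, f W = ∑ c : Fin N → Bool,
      if h : wordCount c false N = n ∧ wordCount c true N = n' then
        ∑ w : Fin n → ι, ∑ w' : Fin n' → ι', f ((E c h).join w w') else 0 := by
  rw [← Finset.sum_fiberwise Finset.univ (fun W : Fin N → ι ⊕ ι' => fun u => (W u).isRight) f]
  refine Finset.sum_congr rfl fun c _ => ?_
  split_ifs with h
  · rw [← Fintype.sum_prod_type']
    symm
    refine Finset.sum_bij (fun x _ => (E c h).join x.1 x.2) ?_ ?_ ?_ ?_
    · intro x _
      simp only [Finset.mem_filter, Finset.mem_univ, true_and]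
      exact funext ((E c h).isRight_join x.1 x.2)
    · intro x _ y _ hxy
      have := (E c h).join_injective hxy
      exact Prod.ext this.1 this.2
    · intro W hW
      obtain ⟨w, w', hw⟩ := (E c h).exists_join W (congrFun (Finset.mem_filter.1 hW).2)
      exact ⟨(w, w'), Finset.mem_univ _, hw⟩
    · intro x _
      rfl
  · refine Finset.sum_eq_zero fun W hW => ?_
    by_contra hc
    have h1 := hf W hc
    rw [← (wordCount_isRight W).1, ← (wordCount_isRight W).2, (Finset.mem_filter.1 hW).2] at h1
    exact h h1

/-- Comparison of the numbers of inversions for two total orders of the alphabet: each pair of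
positions whose letters are ordered differently contributes a sign. -/
lemma neg_one_pow_wordInv {ι : Type} [Fintype ι] {r r' : ι → ι → Prop}
    (hr : ∀ a b, r a b → ¬ r b a) (hr' : ∀ a b, r' a b → ¬ r' b a)
    (ht : ∀ a b, a ≠ b → r a b ∨ r b a) (ht' : ∀ a b, a ≠ b → r' a b ∨ r' b a)
    {n : ℕ} (w : Fin n → ι) :
    (-1 : k) ^ wordInv r w = (-1 : k) ^ (∑ i, ∑ j, indic (r i j ∧ r' j i) *
      (wordCount w i n * wordCount w j n)) * (-1 : k) ^ wordInv r' w := by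
  -- `A` and `B` count the pairs of positions that are inverted for one of the two orders only
  set A := ∑ s : Fin n, ∑ t : Fin n, indic (s < t ∧ r (w s) (w t) ∧ r' (w t) (w s)) with hA
  set B := ∑ s : Fin n, ∑ t : Fin n, indic (s < t ∧ r (w t) (w s) ∧ r' (w s) (w t)) with hB
  have h1 : wordInv r w + A = wordInv r' w + B := by
    rw [wordInv, wordInv, hA, hB, ← Finset.sum_add_distrib, ← Finset.sum_add_distrib]
    refine Finset.sum_congr rfl fun s _ => ?_
    rw [← Finset.sum_add_distrib, ← Finset.sum_add_distrib]
    refine Finset.sum_congr rfl fun t _ => ?_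
    have e1 := hr (w s) (w t)
    have e2 := hr' (w s) (w t)
    by_cases hst : s < t
    · by_cases hw : w s = w t
      · rw [hw] at e1 e2 ⊢
        have e1 : ¬ r (w t) (w t) := fun h => e1 h h
        have e2 : ¬ r' (w t) (w t) := fun h => e2 h h
        simp [e1, e2]
      · have e3 := ht _ _ hw
        have e4 := ht' _ _ hw
        by_cases a1 : r (w s) (w t) <;> by_cases a2 : r (w t) (w s) <;>
          by_cases a3 : r' (w s) (w t) <;> by_cases a4 : r' (w t) (w s) <;> simp_all
    · simp [hst]
  have h2 : (∑ i, ∑ j, indic (r i j ∧ r' j i) * (wordCount w i n * wordCount w j n)) = A + B := by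
    have e1 (i j : ι) : indic (r i j ∧ r' j i) * (wordCount w i n * wordCount w j n) =
        ∑ s : Fin n, ∑ t : Fin n, indic (r (w s) (w t) ∧ r' (w t) (w s)) * (indic (w s = i) *
          indic (w t = j)) := by
      simp only [wordCount, Fin.is_lt, true_and]
      rw [Finset.sum_mul_sum, Finset.mul_sum]
      refine Finset.sum_congr rfl fun s _ => ?_
      rw [Finset.mul_sum]
      refine Finset.sum_congr rfl fun t _ => ?_
      by_cases hi : w s = i
      · by_cases hj : w t = j
        · rw [hi, hj]
        · simp [hj]
      · simp [hi]
    have e2 : A + B = ∑ s : Fin n, ∑ t : Fin n, indic (r (w s) (w t) ∧ r' (w t) (w s)) := by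
      rw [hB, Finset.sum_comm, hA, ← Finset.sum_add_distrib]
      refine Finset.sum_congr rfl fun s _ => ?_
      rw [← Finset.sum_add_distrib]
      refine Finset.sum_congr rfl fun t _ => ?_
      rcases lt_trichotomy s t with h | h | h
      · simp [h, h.not_gt]
      · subst h
        have : ¬ r (w s) (w s) := fun e => hr _ _ e e
        simp [this]
      · simp [h, h.not_gt]
    rw [e2]
    simp only [e1]
    have e3 (i : ι) : (∑ j, ∑ s : Fin n, ∑ t : Fin n, indic (r (w s) (w t) ∧ r' (w t) (w s)) *
        (indic (w s = i) * indic (w t = j))) = ∑ s : Fin n, ∑ t : Fin n,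
          indic (r (w s) (w t) ∧ r' (w t) (w s)) * indic (w s = i) := by
      rw [Finset.sum_comm]
      refine Finset.sum_congr rfl fun s _ => ?_
      rw [Finset.sum_comm]
      refine Finset.sum_congr rfl fun t _ => ?_
      rw [← Finset.mul_sum, ← Finset.mul_sum, sum_indic_eq, mul_one]
    simp only [e3]
    rw [Finset.sum_comm]
    refine Finset.sum_congr rfl fun s _ => ?_
    rw [Finset.sum_comm]
    refine Finset.sum_congr rfl fun t _ => ?_
    rw [← Finset.mul_sum, sum_indic_eq, mul_one]
  rw [h2, ← pow_add]
  have h3 : wordInv r w + 2 * A = A + B + wordInv r' w := by omega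
  rw [← h3, pow_add, pow_mul]
  simp

/-! ### Cross products of families of chains -/

section piChain

variable {ι : Type} [Fintype ι]

open scoped Classical in
/-- The tensor product of a finite family of chains, as a chain on the product. -/
def piChain {B : ι → Type} : MultilinearMap k (fun i => B i →₀ k) ((∀ i, B i) →₀ k) :=
  PiTensorProduct.ofFinsuppEquiv'.toLinearMap.compMultilinearMap (PiTensorProduct.tprod k)

lemma piChain_apply {B : ι → Type} (x : ∀ i, B i →₀ k) (b : ∀ i, B i) :
    piChain x b = ∏ i, x i (b i) := by
  classical
  exact PiTensorProduct.ofFinsuppEquiv'_apply_apply x b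

lemma piChain_single {B : ι → Type} (b : ∀ i, B i) (r : ι → k) :
    piChain (fun i => Finsupp.single (b i) (r i)) = Finsupp.single b (∏ i, r i) := by
  classical
  exact PiTensorProduct.ofFinsuppEquiv'_tprod_single b r

lemma mapDomain_piChain {B B' : ι → Type} (f : ∀ i, B i → B' i) (x : ∀ i, B i →₀ k) :
    Finsupp.mapDomain (fun b i => f i (b i)) (piChain x) =
      piChain fun i => Finsupp.mapDomain (f i) (x i) := by
  have h : (Finsupp.lmapDomain k k (fun (b : ∀ i, B i) i => f i (b i))).compMultilinearMap piChain =
      piChain.compLinearMap fun i => Finsupp.lmapDomain k k (f i) := by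
    refine Module.Basis.ext_multilinear (fun _ => Finsupp.basisSingleOne) fun v => ?_
    simp [piChain_single]
  exact congrArg (fun F => F x) h

lemma piChain_reindex {ι' : Type} [Fintype ι'] (e : ι ≃ ι') {B : ι' → Type} (x : ∀ i, B i →₀ k) :
    Finsupp.mapDomain (fun b i => b (e i)) (piChain x) = piChain fun i => x (e i) := by
  refine Finsupp.ext fun b => ?_
  have h : (fun (b : ∀ i, B i) i => b (e i)) = (Equiv.piCongrLeft B e).symm := rfl
  rw [h, Finsupp.mapDomain_equiv_apply, piChain_apply, piChain_apply, ← Equiv.prod_comp e]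
  refine Finset.prod_congr rfl fun i _ => ?_
  rw [Equiv.symm_symm, Equiv.piCongrLeft_apply_apply]

lemma pairChain_piChain {ι' : Type} [Fintype ι'] {B : ι ⊕ ι' → Type} (x : ∀ i, B i →₀ k) :
    pairChain (piChain fun i => x (Sum.inl i)) (piChain fun i => x (Sum.inr i)) =
      Finsupp.mapDomain (fun b => (fun i => b (Sum.inl i), fun i => b (Sum.inr i)))
          (piChain x) := by
  refine Finsupp.ext fun b => ?_
  have h : (fun (b : ∀ i, B i) => ((fun i => b (Sum.inl i), fun i => b (Sum.inr i)) :
    (∀ i, B (Sum.inl i)) × (∀ i, B (Sum.inr i)))) = Equiv.sumPiEquivProdPi B := rfl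
  rw [h, Finsupp.mapDomain_equiv_apply, piChain_apply, Fintype.prod_sum_type]
  refine (finsuppTensorFinsupp'_apply_apply k _ _ _ _ b.1 b.2).trans ?_
  rw [piChain_apply, piChain_apply]
  rfl

end piChain

/-- The degreewise product of a family of simplicial sets. -/
def piFamily {ι : Type} (X : ι → SSet.{0}) : SSet.{0} where
  obj Δ := ∀ s, (X s).obj Δ
  map f := ↾fun x s => (X s).map f (x s)
  map_id Δ := by
    ext x s
    exact congrArg (fun f => f (x s)) ((X s).map_id Δ)
  map_comp f g := by
    ext x s
    exact congrArg (fun h => h (x s)) ((X s).map_comp f g)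

section cross

variable {ι : Type} [Fintype ι]

open scoped Classical in
/-- The coefficient of the maximal chain of a word in the product of simplices of dimensions `q i`:
the sign of the word if its contents are `q`, and zero otherwise. -/
def wordSign (k : Type u) [CommRing k] (r : ι → ι → Prop) (q : ι → ℕ) {n : ℕ} (w : Fin n → ι) : k :=
  if ∀ i, wordCount w i n = q i then (-1) ^ wordInv r w else 0

/-- The term of the cross product that corresponds to a word. -/
def crossTerm (X : ι → SSet.{0}) (q : ι → ℕ) {n : ℕ} (w : Fin n → ι) (x : ∀ i, (X i) _⦋q i⦌ →₀ k) :
    (piFamily X) _⦋n⦌ →₀ k :=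
  piChain fun i => chainOp (X i) (wordChain w i (q i)) (x i)

/-- The cross product of a finite family of chains. The sum is over the maximal chains of a product
of simplices, which are written as words in the set of factors; `r` is the order of the factors. -/
def cross (r : ι → ι → Prop) (X : ι → SSet.{0}) (q : ι → ℕ) (n : ℕ) (x : ∀ i, (X i) _⦋q i⦌ →₀ k) :
    (piFamily X) _⦋n⦌ →₀ k :=
  ∑ w : Fin n → ι, wordSign k r q w • crossTerm X q w x

lemma chainOp_comp (X : SSet.{0}) {l m n : ℕ} (f : ⦋l⦌ ⟶ ⦋m⦌) (g : ⦋m⦌ ⟶ ⦋n⦌) (x : X _⦋n⦌ →₀ k) :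
    chainOp X f (chainOp X g x) = chainOp X (f ≫ g) x := by
  simp only [chainOp, Finsupp.lmapDomain_apply, ← Finsupp.mapDomain_comp]
  congr 1
  exact funext fun a => map_op_map X f g a

lemma chainOp_id (X : SSet.{0}) {n : ℕ} (x : X _⦋n⦌ →₀ k) : chainOp X (𝟙 ⦋n⦌) x = x := by
  have h : ⇑(X.map (𝟙 ⦋n⦌).op) = id := funext fun a => map_op_id X a
  simp only [chainOp, Finsupp.lmapDomain_apply, h, Finsupp.mapDomain_id]

lemma chainOp_crossTerm (X : ι → SSet.{0}) (q : ι → ℕ) {m n : ℕ} (f : ⦋m⦌ ⟶ ⦋n⦌) (w : Fin n → ι)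
    (x : ∀ i, (X i) _⦋q i⦌ →₀ k) :
    chainOp (piFamily X) f (crossTerm X q w x) =
      piChain fun i => chainOp (X i) (f ≫ wordChain w i (q i)) (x i) := by
  refine (mapDomain_piChain (fun i => (X i).map f.op) _).trans ?_
  exact congrArg piChain (funext fun i => chainOp_comp _ _ _ _)

/-- Reindexing a cross product along a bijection that respects the orders of the factors. -/
lemma cross_reindex {ι' : Type} [Fintype ι'] (e : ι ≃ ι') {r : ι → ι → Prop} {r' : ι' → ι' → Prop}
    (hr : ∀ i j, r i j ↔ r' (e i) (e j)) (X : ι' → SSet.{0}) (q : ι' → ℕ) (n : ℕ)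
    (x : ∀ i, (X i) _⦋q i⦌ →₀ k) :
    cross r (fun i => X (e i)) (fun i => q (e i)) n (fun i => x (e i)) =
      Finsupp.mapDomain (fun b i => b (e i)) (cross r' X q n x) := by
  have hsum := map_sum (Finsupp.lmapDomain k k (fun (b : (piFamily X) _⦋n⦌) (i : ι) => b (e i)))
    (fun w : Fin n → ι' => wordSign k r' q w • crossTerm X q w x) Finset.univ
  refine Eq.trans ?_ hsum.symm
  rw [← Equiv.sum_comp (Equiv.arrowCongr (Equiv.refl (Fin n)) e)]
  refine Finset.sum_congr rfl fun w _ => ?_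
  have hc (i : ι) (t : ℕ) : wordCount (Equiv.arrowCongr (Equiv.refl (Fin n)) e w) (e i) t =
      wordCount w i t := by
    simp [wordCount]
  have hsign : wordSign k r (fun i => q (e i)) w =
      wordSign k r' q (Equiv.arrowCongr (Equiv.refl (Fin n)) e w) := by
    rw [wordSign, wordSign]
    refine if_congr ?_ ?_ rfl
    · rw [← e.forall_congr_right]
      simp only [hc]
    · simp [wordInv, hr]
  rw [map_smul, hsign]
  refine congrArg _ ?_
  refine Eq.trans ?_ (piChain_reindex e fun i => chainOp (X i)
    (wordChain (Equiv.arrowCongr (Equiv.refl (Fin n)) e w) i (q i)) (x i)).symm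
  refine congrArg piChain (funext fun i => ?_)
  have : wordChain (Equiv.arrowCongr (Equiv.refl (Fin n)) e w) (e i) (q (e i)) =
      wordChain w i (q (e i)) := simplex_hom_ext fun t => by
    rw [wordChain_apply, wordChain_apply, hc]
  rw [this]

/-- The sign rule for a change of the order of the factors. -/
lemma cross_reorder {r r' : ι → ι → Prop}
    (hr : ∀ a b, r a b → ¬ r b a) (hr' : ∀ a b, r' a b → ¬ r' b a)
    (ht : ∀ a b, a ≠ b → r a b ∨ r b a) (ht' : ∀ a b, a ≠ b → r' a b ∨ r' b a)
    (X : ι → SSet.{0}) (q : ι → ℕ) (n : ℕ) (x : ∀ i, (X i) _⦋q i⦌ →₀ k) :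
    cross r X q n x = (-1 : k) ^ (∑ i, ∑ j, indic (r i j ∧ r' j i) * (q i * q j)) •
      cross r' X q n x := by
  rw [cross, cross, Finset.smul_sum]
  refine Finset.sum_congr rfl fun w _ => ?_
  rw [smul_smul]
  refine congrArg (· • _) ?_
  by_cases h : ∀ i, wordCount w i n = q i
  · rw [wordSign, wordSign, if_pos h, if_pos h, neg_one_pow_wordInv hr hr' ht ht']
    simp only [h]
  · rw [wordSign, wordSign, if_neg h, if_neg h, mul_zero]

end cross

/-- The shuffle map as a sum over words with two letters. -/
lemma linShuffle_eq_sum_words (X Y : SSet.{0}) {p q n : ℕ} (h : p + q = n) (x : X _⦋p⦌ →₀ k)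
    (y : Y _⦋q⦌ →₀ k) :
    linShuffle X Y p q n x y = ∑ c : Fin n → Bool, wordSign k (· < ·) (fun b => cond b q p) c •
      pairChain (chainOp X (wordChain c false p) x) (chainOp Y (wordChain c true q) y) := by
  rw [linShuffle_eq_sum]
  refine (sum_shuffle h fun i f g => (-1 : k) ^ i • pairChain (chainOp X f x) (chainOp Y g y)).trans
      ?_
  refine Finset.sum_congr rfl fun c _ => ?_
  by_cases hc : wordCount c false n = p ∧ wordCount c true n = q
  · rw [if_pos hc, wordSign, if_pos (by rintro (_ | _); exacts [hc.1, hc.2])]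
  · rw [if_neg hc, wordSign, if_neg fun h => hc ⟨h false, h true⟩, zero_smul]

/-- The term of a joined word is the product of the terms of the subwords, pulled back along the two
components of the pattern. -/
lemma crossTerm_join {ι ι' : Type} [Fintype ι] [Fintype ι'] (Z : ι ⊕ ι' → SSet.{0}) (q : ι ⊕ ι' → ℕ)
    {n n' N : ℕ} {c : Fin N → Bool} (E : WordSplit (n := n) (n' := n') c)
    (hc : wordCount c false N = n ∧ wordCount c true N = n') (w : Fin n → ι) (w' : Fin n' → ι')
    (z : ∀ i, (Z i) _⦋q i⦌ →₀ k) :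
    pairChain (chainOp (piFamily fun i => Z (Sum.inl i)) (wordChain c false n)
        (crossTerm (fun i => Z (Sum.inl i)) (fun i => q (Sum.inl i)) w fun i => z (Sum.inl i)))
      (chainOp (piFamily fun i => Z (Sum.inr i)) (wordChain c true n')
        (crossTerm (fun i => Z (Sum.inr i)) (fun i => q (Sum.inr i)) w' fun i => z (Sum.inr i))) =
    Finsupp.mapDomain (fun b => (fun i => b (Sum.inl i), fun i => b (Sum.inr i)))
      (crossTerm Z q (E.join w w') z) := by
  rw [chainOp_crossTerm, chainOp_crossTerm]
  refine Eq.trans ?_ (pairChain_piChain fun i => chainOp (Z i) (wordChain (E.join w w') i (q i))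
      (z i))
  simp only [E.wordChain_join_inl w w' hc.1, E.wordChain_join_inr w w' hc.2]
  rfl

lemma wordSign_join {ι ι' : Type} [Fintype ι] [Fintype ι'] (r : ι → ι → Prop)
    (r' : ι' → ι' → Prop) (q : ι ⊕ ι' → ℕ)
    {n n' N : ℕ} {c : Fin N → Bool} (E : WordSplit (n := n) (n' := n') c)
    (hc : wordCount c false N = n ∧ wordCount c true N = n') (w : Fin n → ι) (w' : Fin n' → ι') :
    wordSign k (Sum.Lex r r') q (E.join w w') = (-1 : k) ^ wordInv (· < ·) c *
      (wordSign k r (fun i => q (Sum.inl i)) w * wordSign k r' (fun i => q (Sum.inr i)) w') := by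
  have h : (∀ i, wordCount (E.join w w') i N = q i) ↔
      (∀ i, wordCount w i n = q (Sum.inl i)) ∧ ∀ i, wordCount w' i n' = q (Sum.inr i) := by
    rw [Sum.forall]
    simp only [E.wordCount_join_inl, E.wordCount_join_inr, hc.1, hc.2]
  by_cases h1 : ∀ i, wordCount w i n = q (Sum.inl i)
  · by_cases h2 : ∀ i, wordCount w' i n' = q (Sum.inr i)
    · rw [wordSign, if_pos (h.2 ⟨h1, h2⟩), wordSign, if_pos h1, wordSign, if_pos h2, E.wordInv_join,
        pow_add, pow_add, mul_assoc]
    · rw [wordSign, if_neg fun h' => h2 (h.1 h').2, wordSign, wordSign, if_neg h2, mul_zero,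
          mul_zero]
  · rw [wordSign, if_neg fun h' => h1 (h.1 h').1, wordSign, if_neg h1, zero_mul, mul_zero]

/-- The shuffle product of two cross products is the cross product over the disjoint union. -/
theorem linShuffle_cross {ι ι' : Type} [Fintype ι] [Fintype ι'] (r : ι → ι → Prop)
    (r' : ι' → ι' → Prop) (Z : ι ⊕ ι' → SSet.{0}) (q : ι ⊕ ι' → ℕ) {n n' N : ℕ}
    (hn : ∑ i, q (Sum.inl i) = n) (hn' : ∑ i, q (Sum.inr i) = n') (hN : n + n' = N)
    (z : ∀ i, (Z i) _⦋q i⦌ →₀ k) :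
    linShuffle (piFamily fun i => Z (Sum.inl i)) (piFamily fun i => Z (Sum.inr i)) n n' N
      (cross r (fun i => Z (Sum.inl i)) (fun i => q (Sum.inl i)) n fun i => z (Sum.inl i))
      (cross r' (fun i => Z (Sum.inr i)) (fun i => q (Sum.inr i)) n' fun i => z (Sum.inr i)) =
    Finsupp.mapDomain (fun b => (fun i => b (Sum.inl i), fun i => b (Sum.inr i)))
      (cross (Sum.Lex r r') Z q N z) := by
  classical
  have E : ∀ c : Fin N → Bool, wordCount c false N = n ∧ wordCount c true N = n' →
    WordSplit (n := n) (n' := n') c := fun c h => (WordSplit.nonempty c h).some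
  have hsum := map_sum (Finsupp.lmapDomain k k (fun (b : (piFamily Z) _⦋N⦌) =>
    ((fun i => b (Sum.inl i), fun i => b (Sum.inr i)) :
      (∀ i, (Z (Sum.inl i)) _⦋N⦌) × (∀ i, (Z (Sum.inr i)) _⦋N⦌))))
    (fun W : Fin N → ι ⊕ ι' => wordSign k (Sum.Lex r r') q W • crossTerm Z q W z) Finset.univ
  refine Eq.trans ?_ hsum.symm
  rw [sum_join E]
  · rw [linShuffle_eq_sum_words _ _ hN]
    refine Finset.sum_congr rfl fun c _ => ?_
    split_ifs with hc
    · have hsign : wordSign k (· < ·) (fun b => cond b n' n) c = (-1 : k) ^ wordInv (· < ·) c := by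
        rw [wordSign, if_pos]
        rintro (_ | _)
        · exact hc.1
        · exact hc.2
      rw [hsign, cross, cross, map_sum, map_sum, LinearMap.sum_apply, Finset.smul_sum]
      refine Finset.sum_congr rfl fun w _ => ?_
      rw [map_sum, map_smul, map_smul, LinearMap.smul_apply, map_sum, Finset.smul_sum,
          Finset.smul_sum]
      refine Finset.sum_congr rfl fun w' _ => ?_
      rw [map_smul, map_smul, smul_smul, smul_smul, wordSign_join r r' q (E c hc) hc, map_smul,
        crossTerm_join Z q (E c hc) hc, mul_assoc]
      rfl
    · rw [wordSign, if_neg (fun h => hc ⟨h false, h true⟩), zero_smul]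
      rfl
  · intro W hW
    have h : ∀ i, wordCount W i N = q i := by
      by_contra h
      rw [wordSign, if_neg h, zero_smul, map_zero] at hW
      exact hW rfl
    simp only [h]
    exact ⟨hn, hn'⟩

/-! ### Iterated shuffle maps as cross products -/

/-- The product of a family of maps of simplicial sets. -/
def piSSetMap {m : ℕ} {X Y : Fin m → SSet.{0}} (φ : ∀ s, X s ⟶ Y s) : piSSet X ⟶ piSSet Y where
  app Δ := ↾fun x s => (φ s).app Δ (x s)
  naturality Δ Δ' f := by
    refine ConcreteCategory.hom_ext _ _ fun x => funext fun i => ?_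
    exact congrArg (fun h => h (x i)) ((φ i).naturality f)

lemma chainMap_comp {X Y Z : SSet.{0}} (φ : X ⟶ Y) (ψ : Y ⟶ Z) (n : ℕ) (x : X _⦋n⦌ →₀ k) :
    chainMap ψ n (chainMap φ n x) = chainMap (φ ≫ ψ) n x :=
  (Finsupp.mapDomain_comp (f := φ.app (op ⦋n⦌)) (g := ψ.app (op ⦋n⦌))).symm

lemma chainMap_id (X : SSet.{0}) (n : ℕ) (x : X _⦋n⦌ →₀ k) : chainMap (𝟙 X) n x = x :=
  Finsupp.mapDomain_id

/-- The iterated shuffle map is natural. -/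
lemma chainMap_iterShuffle {m : ℕ} {X Y : Fin m → SSet.{0}} (φ : ∀ s, X s ⟶ Y s) (q : Fin m → ℕ)
    (n : ℕ) (x : ∀ s, (X s) _⦋q s⦌ →₀ k) :
    chainMap (piSSetMap φ) n (iterShuffle X q n x) =
      iterShuffle Y q n fun s => chainMap (φ s) (q s) (x s) := by
  induction m generalizing n with
  | zero =>
    refine (chainMap_single _ _ _ _).trans ?_
    exact congrArg (fun b => Finsupp.single b 1) (funext fun s => s.elim0)
  | succ m ih =>
    have h1 := chainMap_comp (consMap X) (piSSetMap φ) n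
      (linShuffle (X 0) (piSSet fun s => X s.succ) (q 0) (∑ s, q (Fin.succ s)) n (x 0)
        (iterShuffle (fun s => X s.succ) (fun s => q s.succ) (∑ s, q (Fin.succ s))
          fun s => x s.succ))
    have h2 : consMap X ≫ piSSetMap φ = prodSSetMap (φ 0) (piSSetMap fun s => φ s.succ) ≫
        consMap Y := by
      refine NatTrans.ext (funext fun Δ => ConcreteCategory.hom_ext _ _ fun b => funext fun s => ?_)
      induction s using Fin.cases with
      | zero => rfl
      | succ s => rfl
    refine h1.trans ?_
    rw [h2]
    refine (chainMap_comp (prodSSetMap (φ 0) (piSSetMap fun s => φ s.succ)) (consMap Y) n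
        _).symm.trans
      (congrArg _ ((chainMap_linShuffle _ _ _ _ _ _ _).trans ?_))
    exact congrArg (linShuffle (Y 0) (piSSet fun s => Y s.succ) (q 0) _ n
        (chainMap (φ 0) (q 0) (x 0)))
      (ih (fun s => φ s.succ) _ _ _)

/-- The projection from a product with a single factor. -/
def evalUnit (Z : Unit → SSet.{0}) : piFamily Z ⟶ Z () where
  app _ := ↾fun b => b ()
  naturality _ _ _ := rfl

/-- A cross product with a single factor. -/
lemma evalUnit_cross (Z : Unit → SSet.{0}) (q : Unit → ℕ) (z : ∀ u, (Z u) _⦋q u⦌ →₀ k) :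
    chainMap (evalUnit Z) (q ()) (cross (fun _ _ => False) Z q (q ()) z) = z () := by
  have hw (w : Fin (q ()) → Unit) (t : ℕ) (ht : t ≤ q ()) : wordCount w () t = t := by
    have := wordCount_bool_add (n := q ()) (fun _ => true) ht
    simpa [wordCount] using this
  rw [cross, Fintype.sum_unique, map_smul]
  have h1 : wordSign k (fun _ _ => False) q (default : Fin (q ()) → Unit) = 1 := by
    rw [wordSign, if_pos fun i => hw _ _ le_rfl]
    simp [wordInv]
  have h2 : wordChain (default : Fin (q ()) → Unit) () (q ()) = 𝟙 _ := simplex_hom_ext fun t => by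
    rw [wordChain_apply, hw _ _ (Nat.lt_succ_iff.1 t.2), min_eq_right (Nat.lt_succ_iff.1 t.2)]
    rfl
  rw [h1, one_smul]
  have h3 : chainMap (evalUnit Z) (q ()) (piChain z) = z () := by
    refine Finsupp.ext fun b => ?_
    have h4 : ⇑((evalUnit Z).app (op ⦋q ()⦌)) = (Equiv.piUnique fun u => (Z u) _⦋q ()⦌) := rfl
    refine (congrArg (fun f => Finsupp.mapDomain f (piChain z) b) h4).trans ?_
    rw [Finsupp.mapDomain_equiv_apply, piChain_apply, Fintype.prod_unique]
    rfl
  refine Eq.trans (congrArg _ (congrArg piChain (funext fun u => ?_))) h3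
  rw [show wordChain (default : Fin (q ()) → Unit) u (q u) = 𝟙 _ from h2, chainOp_id]

/-- The empty cross product. -/
lemma cross_isEmpty {ι : Type} [Fintype ι] [IsEmpty ι] (r : ι → ι → Prop) (Z : ι → SSet.{0})
    (q : ι → ℕ) (z : ∀ i, (Z i) _⦋q i⦌ →₀ k) :
    cross r Z q 0 z = Finsupp.single (fun i => isEmptyElim i) 1 := by
  rw [cross, Fintype.sum_unique, wordSign, if_pos fun i => isEmptyElim i]
  have h : crossTerm Z q (default : Fin 0 → ι) z = Finsupp.single (fun i => isEmptyElim i) 1 := by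
    refine Finsupp.ext fun b => ?_
    refine (piChain_apply _ b).trans ?_
    have hb : (fun i => isEmptyElim i) = b := funext fun i => isEmptyElim i
    refine (Fintype.prod_empty _).trans ?_
    exact (congrArg (fun c => Finsupp.single c (1 : k) b) hb |>.trans Finsupp.single_eq_same).symm
  rw [h]
  simp only [wordInv, Finset.univ_eq_empty, Finset.sum_empty, pow_zero]
  exact one_smul k _

/-- The identification of a product over a disjoint union with an iterated product. -/
def curryMap {m : ℕ} {ι : Fin m → Type} (Z : (Σ s, ι s) → SSet.{0}) :
    piFamily Z ⟶ piSSet fun s => piFamily fun i => Z ⟨s, i⟩ where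
  app _ := ↾fun b s i => b ⟨s, i⟩
  naturality _ _ _ := rfl

/-- The disjoint union of a family indexed by `Fin (m + 1)`, with the first set split off. -/
def sigmaFinSuccEquiv {m : ℕ} (ι : Fin (m + 1) → Type) : (ι 0 ⊕ Σ s : Fin m, ι s.succ) ≃ Σ s, ι s
    where
  toFun := Sum.elim (fun i => ⟨0, i⟩) (fun x => ⟨x.1.succ, x.2⟩)
  invFun x := Fin.cases (motive := fun s => ι s → ι 0 ⊕ Σ s : Fin m, ι s.succ)
    (fun i => Sum.inl i) (fun s i => Sum.inr ⟨s, i⟩) x.1 x.2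
  left_inv x := by rcases x with i | ⟨s, i⟩ <;> rfl
  right_inv x := by
    obtain ⟨s, i⟩ := x
    induction s using Fin.cases with
    | zero => rfl
    | succ s => rfl

lemma sigmaLex_mk_iff {m : ℕ} {ι : Fin m → Type} {r : ∀ s, ι s → ι s → Prop} {s : Fin m}
    {i j : ι s} :
    Sigma.Lex (· < ·) r ⟨s, i⟩ ⟨s, j⟩ ↔ r s i j := by
  rw [Sigma.lex_iff]
  simp

lemma sigmaLex_mk_iff_of_ne {m : ℕ} {ι : Fin m → Type} {r : ∀ s, ι s → ι s → Prop} {s t : Fin m}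
    (h : s ≠ t) {i : ι s} {j : ι t} : Sigma.Lex (· < ·) r ⟨s, i⟩ ⟨t, j⟩ ↔ s < t := by
  rw [Sigma.lex_iff]
  simp [h]

/-- The iterated shuffle product of cross products is the cross product over the disjoint union. -/
theorem iterShuffle_cross {m : ℕ} {ι : Fin m → Type} [∀ s, Fintype (ι s)]
    (r : ∀ s, ι s → ι s → Prop) (Z : (Σ s, ι s) → SSet.{0}) (q : (Σ s, ι s) → ℕ) (n : Fin m → ℕ)
    (hn : ∀ s, ∑ i, q ⟨s, i⟩ = n s) (N : ℕ) (hN : ∑ s, n s = N) (z : ∀ i, (Z i) _⦋q i⦌ →₀ k) :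
    iterShuffle (fun s => piFamily fun i => Z ⟨s, i⟩) n N
      (fun s => cross (r s) (fun i => Z ⟨s, i⟩) (fun i => q ⟨s, i⟩) (n s) fun i => z ⟨s, i⟩) =
    chainMap (curryMap Z) N (cross (Sigma.Lex (· < ·) r) Z q N z) := by
  induction m generalizing N with
  | zero =>
    have hN : N = 0 := hN.symm
    subst hN
    refine Eq.trans ?_ ((congrArg (chainMap (curryMap Z) 0) (cross_isEmpty _ Z q z)).trans
      (chainMap_single _ _ _ _)).symm
    exact congrArg (fun b => Finsupp.single b 1) (funext fun s => s.elim0)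
  | succ m ih =>
    have h1 := ih (fun s => r s.succ) (fun x => Z ⟨x.1.succ, x.2⟩) (fun x => q ⟨x.1.succ, x.2⟩)
      (fun s => n s.succ) (fun s => hn s.succ) (∑ s : Fin m, n s.succ) rfl
      (fun x => z ⟨x.1.succ, x.2⟩)
    have h2 := linShuffle_cross (k := k) (r 0) (Sigma.Lex (· < ·) fun s : Fin m => r s.succ)
      (fun x => Z (sigmaFinSuccEquiv ι x)) (fun x => q (sigmaFinSuccEquiv ι x)) (n := n 0)
      (n' := ∑ s : Fin m, n s.succ) (N := N) (hn 0)
      (by rw [Fintype.sum_sigma]; exact Finset.sum_congr rfl fun s _ => hn s.succ)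
      (by rw [← hN, Fin.sum_univ_succ]) (fun x => z (sigmaFinSuccEquiv ι x))
    have h3 := chainMap_linShuffle (𝟙 (piFamily fun i => Z ⟨0, i⟩))
      (curryMap fun x : Σ s : Fin m, ι s.succ => Z ⟨x.1.succ, x.2⟩) (n 0) (∑ s : Fin m, n s.succ) N
      (cross (r 0) (fun i => Z ⟨0, i⟩) (fun i => q ⟨0, i⟩) (n 0) fun i => z ⟨0, i⟩)
      (cross (Sigma.Lex (· < ·) fun s : Fin m => r s.succ) (fun x => Z ⟨x.1.succ, x.2⟩)
        (fun x => q ⟨x.1.succ, x.2⟩) (∑ s : Fin m, n s.succ) (fun x => z ⟨x.1.succ, x.2⟩))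
    have h4 := cross_reindex (k := k) (sigmaFinSuccEquiv ι)
      (r := Sum.Lex (r 0) (Sigma.Lex (· < ·) fun s : Fin m => r s.succ))
      (r' := Sigma.Lex (· < ·) r) (by
        rintro (i | ⟨s, i⟩) (j | ⟨t, j⟩)
        · exact (Sum.lex_inl_inl.trans sigmaLex_mk_iff.symm)
        · refine iff_of_true (Sum.Lex.sep _ _) ?_
          exact Sigma.Lex.left _ _ (Fin.succ_pos t)
        · refine iff_of_false (by simp) ?_
          refine (sigmaLex_mk_iff_of_ne (Fin.succ_ne_zero s)).not.2 (by simp)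
        · rw [Sum.lex_inr_inr]
          by_cases hst : s = t
          · subst hst
            exact sigmaLex_mk_iff.trans sigmaLex_mk_iff.symm
          · refine (sigmaLex_mk_iff_of_ne hst).trans (Iff.trans ?_ (sigmaLex_mk_iff_of_ne
              (fun h => hst (Fin.succ_injective _ h))).symm)
            exact Fin.succ_lt_succ_iff.symm) Z q N z
    rw [chainMap_id, ← h1] at h3
    refine (congrArg (Finsupp.mapDomain _) (h3.symm.trans (congrArg _ (h2.trans
      (congrArg (Finsupp.mapDomain _) h4))))).trans ?_
    refine (congrArg (Finsupp.mapDomain _) (congrArg (Finsupp.mapDomain _)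
      Finsupp.mapDomain_comp.symm)).trans ?_
    refine (congrArg (Finsupp.mapDomain _) Finsupp.mapDomain_comp.symm).trans ?_
    refine Finsupp.mapDomain_comp.symm.trans ?_
    refine congrArg (fun f => Finsupp.mapDomain f (cross (Sigma.Lex (· < ·) r) Z q N z)) ?_
    refine funext fun b => funext fun s => ?_
    induction s using Fin.cases with
    | zero => rfl
    | succ s => rfl

/-- The order of one letter followed by the letters of `ι`. -/
abbrev headLex {ι : Type} (r : ι → ι → Prop) : Unit ⊕ ι → Unit ⊕ ι → Prop :=
  Sum.Lex (fun _ _ => False) r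

/-- The shuffle product of a chain with a cross product. -/
lemma linShuffle_head_cross {ι : Type} [Fintype ι] (r : ι → ι → Prop) (Z : Unit ⊕ ι → SSet.{0})
    (q : Unit ⊕ ι → ℕ) {n N : ℕ} (hn : ∑ i, q (Sum.inr i) = n) (hN : q (Sum.inl ()) + n = N)
    (z : ∀ i, (Z i) _⦋q i⦌ →₀ k) :
    linShuffle (Z (Sum.inl ())) (piFamily fun i => Z (Sum.inr i)) (q (Sum.inl ())) n N
      (z (Sum.inl ()))
      (cross r (fun i => Z (Sum.inr i)) (fun i => q (Sum.inr i)) n fun i => z (Sum.inr i)) =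
    Finsupp.mapDomain (fun b => (b (Sum.inl ()), fun i => b (Sum.inr i)))
      (cross (headLex r) Z q N z) := by
  have h1 := linShuffle_cross (k := k) (fun _ _ => False) r Z q (n := q (Sum.inl ())) (n' := n)
    (N := N) (by simp) hn hN z
  have h2 := chainMap_linShuffle (evalUnit fun u => Z (Sum.inl u))
    (𝟙 (piFamily fun i => Z (Sum.inr i))) (q (Sum.inl ())) n N
    (cross (fun _ _ => False) (fun i => Z (Sum.inl i)) (fun i => q (Sum.inl i)) _
      fun i => z (Sum.inl i))
    (cross r (fun i => Z (Sum.inr i)) (fun i => q (Sum.inr i)) n fun i => z (Sum.inr i))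
  have h3 := evalUnit_cross (fun u => Z (Sum.inl u)) (fun u => q (Sum.inl u)) fun u => z (Sum.inl u)
  rw [chainMap_id, h1, h3] at h2
  exact h2.symm.trans Finsupp.mapDomain_comp.symm

/-- The iterated shuffle map is the cross product. -/
lemma iterShuffle_eq_cross {m : ℕ} (X : Fin m → SSet.{0}) (q : Fin m → ℕ) {N : ℕ}
    (hN : ∑ s, q s = N) (x : ∀ s, (X s) _⦋q s⦌ →₀ k) :
    iterShuffle X q N x = cross (· < ·) X q N x := by
  have h1 := iterShuffle_cross (k := k) (ι := fun _ : Fin m => Unit) (fun _ _ _ => False)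
    (fun y => X y.1) (fun y => q y.1) q (by simp) N hN (fun y => x y.1)
  have h2 := chainMap_iterShuffle (fun s => evalUnit fun _ => X s) q N fun s =>
    cross (fun _ _ => False) (fun _ => X s) (fun _ => q s) (q s) fun _ => x s
  have h3 := cross_reindex (k := k) (Equiv.sigmaUnique (Fin m) fun _ => Unit)
    (r := Sigma.Lex (· < ·) fun _ _ _ => False)
    (r' := (· < ·)) (by
      rintro ⟨s, i⟩ ⟨t, j⟩
      rw [Sigma.lex_iff]
      simp) X q N x
  have h4 (s : Fin m) := evalUnit_cross (k := k) (fun _ => X s) (fun _ => q s) fun _ => x s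
  simp only [h4] at h2
  refine h2.symm.trans ((congrArg _ (h1.trans (congrArg _ h3))).trans ?_)
  refine (congrArg (Finsupp.mapDomain _) Finsupp.mapDomain_comp.symm).trans ?_
  refine Finsupp.mapDomain_comp.symm.trans ?_
  exact Finsupp.mapDomain_id

/-! ### Associativity of the shuffle map -/

/-- The identification of the product over `Unit ⊕ ι` with the product of the first factor and the
product over `ι`. -/
def headSplit {ι : Type} (Z : Unit ⊕ ι → SSet.{0}) :
    piFamily Z ⟶ prodSSet (Z (Sum.inl ())) (piFamily fun i => Z (Sum.inr i)) where
  app _ := ↾fun b => (b (Sum.inl ()), fun i => b (Sum.inr i))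
  naturality _ _ _ := rfl

/-- The shuffle product of a chain with an iterated shuffle product is a cross product. -/
lemma linShuffle_iterShuffle_eq_cross {m : ℕ} (Z : Unit ⊕ Fin m → SSet.{0}) (q : Unit ⊕ Fin m → ℕ)
    {N : ℕ} (hN : q (Sum.inl ()) + ∑ s, q (Sum.inr s) = N) (z : ∀ i, (Z i) _⦋q i⦌ →₀ k) :
    linShuffle (Z (Sum.inl ())) (piSSet fun s => Z (Sum.inr s)) (q (Sum.inl ()))
      (∑ s, q (Sum.inr s)) N (z (Sum.inl ())) (iterShuffle (fun s => Z (Sum.inr s))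
        (fun s => q (Sum.inr s)) (∑ s, q (Sum.inr s)) fun s => z (Sum.inr s)) =
    chainMap (headSplit Z) N (cross (headLex (· < ·)) Z q N z) := by
  rw [iterShuffle_eq_cross _ _ rfl]
  exact linShuffle_head_cross (· < ·) Z q rfl hN z

section assoc

variable {n : ℕ} {j : Fin n → ℕ}

variable (j) in
/-- The factors of an iterated product `x ⊗ (y_1 ⊗ (z_{11} ⊗ …)) ⊗ … ⊗ (y_n ⊗ (z_{n1} ⊗ …))`. -/
abbrev NestedIndex : Type := Unit ⊕ Σ s : Fin n, Unit ⊕ Fin (j s)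

variable (j) in
/-- The factors of `(x ⊗ y_1 ⊗ … ⊗ y_n) ⊗ z_{11} ⊗ …`, in bijection with those of the nested
product. -/
def nestedEquiv : (Unit ⊕ Fin n) ⊕ Fin (∑ s, j s) ≃ NestedIndex j where
  toFun := Sum.elim (Sum.elim (fun _ => Sum.inl ()) fun s => Sum.inr ⟨s, Sum.inl ()⟩)
    fun r => Sum.inr ⟨(blockOf r).1, Sum.inr (blockOf r).2⟩
  invFun := Sum.elim (fun _ => Sum.inl (Sum.inl ()))
    fun y => Sum.elim (fun _ => Sum.inl (Sum.inr y.1))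
        (fun r => Sum.inr (finSigmaFinEquiv ⟨y.1, r⟩)) y.2
  left_inv := by
    rintro ((_ | s) | r)
    · rfl
    · rfl
    · exact congrArg Sum.inr (finSigmaFinEquiv.apply_symm_apply r)
  right_inv := by
    rintro (_ | ⟨s, _ | r⟩)
    · rfl
    · rfl
    · have h : blockOf (finSigmaFinEquiv ⟨s, r⟩) = ⟨s, r⟩ := finSigmaFinEquiv.symm_apply_apply _
      exact congrArg (fun x : Σ s, Fin (j s) => (Sum.inr ⟨x.1, Sum.inr x.2⟩ : NestedIndex j)) h

lemma sum_castLE (f : Fin n → ℕ) (s : Fin n) :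
    ∑ t : Fin s.val, f (Fin.castLE s.is_lt.le t) = ∑ t ∈ Finset.Iio s, f t := by
  refine Finset.sum_bij (fun t _ => Fin.castLE s.is_lt.le t) (fun t _ => ?_) (fun t _ t' _ h => ?_)
    (fun t ht => ?_) fun _ _ => rfl
  · exact Finset.mem_Iio.2 t.is_lt
  · exact Fin.castLE_injective _ h
  · exact ⟨⟨t, Fin.lt_def.1 (Finset.mem_Iio.1 ht)⟩, Finset.mem_univ _, rfl⟩

lemma finSigmaFinEquiv_lt {x y : Σ s, Fin (j s)} (h : Sigma.Lex (· < ·) (fun _ => (· < ·)) x y) :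
    finSigmaFinEquiv x < finSigmaFinEquiv y := by
  rw [Fin.lt_def, finSigmaFinEquiv_apply, finSigmaFinEquiv_apply, sum_castLE, sum_castLE]
  cases h with
  | @left s t a b h =>
    have h1 : Finset.Iic s ⊆ Finset.Iio t := fun u hu => by
      rw [Finset.mem_Iic] at hu
      exact Finset.mem_Iio.2 (hu.trans_lt h)
    have h2 := Finset.sum_le_sum_of_subset (f := j) h1
    rw [← Finset.Iio_insert s, Finset.sum_insert (by simp)] at h2
    have := a.is_lt
    dsimp only
    omega
  | right a b h => exact Nat.add_lt_add_left h _

/-- Letters of `j_1 + … + j_n` are ordered lexicographically. -/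
lemma lt_iff_blockOf (a b : Fin (∑ s, j s)) :
    a < b ↔ Sigma.Lex (· < ·) (fun _ => (· < ·)) (blockOf a) (blockOf b) := by
  constructor
  · intro h
    rcases trichotomous_of (Sigma.Lex (· < ·) fun s (x y : Fin (j s)) => x < y) (blockOf a)
      (blockOf b) with h' | h' | h'
    · exact h'
    · exact absurd (finSigmaFinEquiv.symm.injective h') h.ne
    · have := finSigmaFinEquiv_lt h'
      rw [Equiv.apply_symm_apply, Equiv.apply_symm_apply] at this
      exact absurd this h.asymm
  · intro h
    simpa only [Equiv.apply_symm_apply] using finSigmaFinEquiv_lt h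

/-- A family indexed by the factors of the nested product. -/
def nestedFamily {V : NestedIndex j → Type*} (x : V (Sum.inl ()))
    (y : ∀ s, V (Sum.inr ⟨s, Sum.inl ()⟩)) (z : ∀ s r, V (Sum.inr ⟨s, Sum.inr r⟩)) :
        (i : NestedIndex j) → V i :=
  fun i => match i with
  | Sum.inl () => x
  | Sum.inr ⟨s, Sum.inl ()⟩ => y s
  | Sum.inr ⟨s, Sum.inr r⟩ => z s r

/-- The order in which the factors appear in the nested product: `x`, then `y_1`, `z_{11}`,
`z_{12}`, …, then `y_2`, and so on. -/
abbrev nestedLex : NestedIndex j → NestedIndex j → Prop :=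
  headLex (Sigma.Lex (· < ·) fun _ => headLex (· < ·))

/-- The sign of the associativity axiom: the pairs of factors that the two bracketings order
differently are the pairs `y_s`, `z_{t r}` with `t < s`. -/
lemma nested_sign (q : NestedIndex j → ℕ) :
    (∑ u, ∑ v, indic (Sum.Lex (headLex (· < ·)) (· < ·) u v ∧
      nestedLex (nestedEquiv j v) (nestedEquiv j u)) * (q (nestedEquiv j u) * q (nestedEquiv j v)))
          =
    ∑ s, ∑ t, if t < s then q (Sum.inr ⟨s, Sum.inl ()⟩) * ∑ r, q (Sum.inr ⟨t, Sum.inr r⟩) else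
        0 := by
  -- `x` comes first in both orders
  have h1 (v) : ¬ (Sum.Lex (headLex (· < ·)) (· < ·) (Sum.inl (Sum.inl ())) v ∧
      nestedLex (nestedEquiv j v) (nestedEquiv j (Sum.inl (Sum.inl ())))) := by
    rintro ⟨-, h⟩
    have h : headLex (Sigma.Lex (· < ·) fun s => headLex (ι := Fin (j s)) (· < ·))
      (nestedEquiv j v) (Sum.inl ()) := h
    generalize nestedEquiv j v = w at h
    rcases w with w | w
    · exact Sum.lex_inl_inl.1 h
    · exact Sum.lex_inr_inl h
  -- the `y_s` are in the same order among themselves, and follow `x`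
  have h2 (s : Fin n) (v) : ¬ (Sum.Lex (headLex (· < ·)) (· < · : Fin (∑ s, j s) → _ → Prop)
      (Sum.inl (Sum.inr s)) (Sum.inl v) ∧
      nestedLex (nestedEquiv j (Sum.inl v)) (nestedEquiv j (Sum.inl (Sum.inr s)))) := by
    rcases v with _ | t
    · rintro ⟨h, -⟩
      cases h with
      | inl h => cases h
    · rintro ⟨h, h'⟩
      have h : s < t := Sum.lex_inr_inr.1 (Sum.lex_inl_inl.1 h)
      have h' := (sigmaLex_mk_iff_of_ne h.ne').1 (Sum.lex_inr_inr.1 h')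
      exact h.asymm h'
  -- `y_s` precedes every `z_{t r}` in the one order, and follows those with `t < s` in the other
  have h3 (s : Fin n) (r : Fin (∑ s, j s)) : (Sum.Lex (headLex (· < ·)) (· < ·)
      (Sum.inl (Sum.inr s)) (Sum.inr r) ∧
      nestedLex (nestedEquiv j (Sum.inr r)) (nestedEquiv j (Sum.inl (Sum.inr s)))) ↔
      (blockOf r).1 < s := by
    refine ⟨fun h => ?_, fun h => ⟨Sum.Lex.sep _ _, Sum.lex_inr_inr.2 (Sigma.Lex.left _ _ h)⟩⟩
    have h' := Sum.lex_inr_inr.1 h.2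
    rw [Sigma.lex_iff] at h'
    rcases h' with h' | ⟨h', h''⟩
    · exact h'
    · have h' : (blockOf r).1 = s := h'
      subst h'
      cases h''
  -- the `z_{t r}` are in the same order among themselves
  have h4 (r : Fin (∑ s, j s)) (v) : ¬ (Sum.Lex (headLex (· < ·)) (· < ·)
      (Sum.inr r) v ∧ nestedLex (nestedEquiv j v) (nestedEquiv j (Sum.inr r))) := by
    rcases v with v | r'
    · rintro ⟨h, -⟩
      cases h
    · rintro ⟨h, h'⟩
      have h := Sum.lex_inr_inr.1 h
      refine h.asymm ((lt_iff_blockOf _ _).2 ?_)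
      have h' := Sum.lex_inr_inr.1 h'
      rw [Sigma.lex_iff] at h' ⊢
      rcases h' with h' | ⟨e, h'⟩
      · exact Or.inl h'
      · refine Or.inr ⟨e, ?_⟩
        generalize blockOf r = u at *
        generalize blockOf r' = v at *
        obtain ⟨s, a⟩ := u
        obtain ⟨t, b⟩ := v
        cases e
        exact Sum.lex_inr_inr.1 h'
  have h5 (s : Fin n) : (∑ r : Fin (∑ s, j s), indic ((blockOf r).1 < s) *
      (q (Sum.inr ⟨s, Sum.inl ()⟩) * q (Sum.inr ⟨(blockOf r).1, Sum.inr (blockOf r).2⟩))) =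
      ∑ t, if t < s then q (Sum.inr ⟨s, Sum.inl ()⟩) * ∑ r, q (Sum.inr ⟨t, Sum.inr r⟩) else 0 := by
    rw [sum_blockOf fun t r => indic (t < s) *
      (q (Sum.inr ⟨s, Sum.inl ()⟩) * q (Sum.inr ⟨t, Sum.inr r⟩))]
    refine Finset.sum_congr rfl fun t _ => ?_
    rw [indic_eq_ite, ← Finset.mul_sum, ← Finset.mul_sum]
    split_ifs <;> simp
  simp only [Fintype.sum_sum_type, Fintype.sum_unique, indic_of_not (h1 _), indic_of_not (h2 _ _),
    indic_of_not (h4 _ _), h3, zero_mul, Finset.sum_const_zero, zero_add, add_zero]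
  exact Finset.sum_congr rfl fun s _ => h5 s

lemma nestedLex_asymm (a b : NestedIndex j) (h : nestedLex a b) : ¬ nestedLex b a := by
  intro h'
  rcases a with a | ⟨s, a⟩ <;> rcases b with b | ⟨t, b⟩
  · exact Sum.lex_inl_inl.1 h
  · exact Sum.lex_inr_inl h'
  · exact Sum.lex_inr_inl h
  · have h := Sum.lex_inr_inr.1 h
    have h' := Sum.lex_inr_inr.1 h'
    by_cases hst : s = t
    · subst hst
      have h := sigmaLex_mk_iff.1 h
      have h' := sigmaLex_mk_iff.1 h'
      rcases a with a | a <;> rcases b with b | b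
      · exact Sum.lex_inl_inl.1 h
      · exact Sum.lex_inr_inl h'
      · exact Sum.lex_inr_inl h
      · exact (Sum.lex_inr_inr.1 h).asymm (Sum.lex_inr_inr.1 h')
    · exact ((sigmaLex_mk_iff_of_ne hst).1 h).asymm ((sigmaLex_mk_iff_of_ne (Ne.symm hst)).1 h')

lemma nestedLex_total (a b : NestedIndex j) (h : a ≠ b) : nestedLex a b ∨ nestedLex b a := by
  rcases a with a | ⟨s, a⟩ <;> rcases b with b | ⟨t, b⟩
  · exact absurd rfl h
  · exact Or.inl (Sum.Lex.sep _ _)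
  · exact Or.inr (Sum.Lex.sep _ _)
  · by_cases hst : s = t
    · subst hst
      have key : headLex (· < ·) a b ∨ headLex (· < ·) b a := by
        rcases a with a | a <;> rcases b with b | b
        · exact absurd rfl h
        · exact Or.inl (Sum.Lex.sep _ _)
        · exact Or.inr (Sum.Lex.sep _ _)
        · rcases lt_or_gt_of_ne (fun e : a = b => h (by rw [e])) with h | h
          · exact Or.inl (Sum.lex_inr_inr.2 h)
          · exact Or.inr (Sum.lex_inr_inr.2 h)
      exact key.imp (fun h => Sum.lex_inr_inr.2 (sigmaLex_mk_iff.2 h))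
        (fun h => Sum.lex_inr_inr.2 (sigmaLex_mk_iff.2 h))
    · rcases lt_or_gt_of_ne hst with h | h
      · exact Or.inl (Sum.lex_inr_inr.2 (Sigma.Lex.left _ _ h))
      · exact Or.inr (Sum.lex_inr_inr.2 (Sigma.Lex.left _ _ h))

lemma headLex_asymm {ι : Type} {r : ι → ι → Prop} (hr : ∀ a b, r a b → ¬ r b a) (a b : Unit ⊕ ι)
    (h : headLex r a b) : ¬ headLex r b a := by
  intro h'
  rcases a with a | a <;> rcases b with b | b
  · exact Sum.lex_inl_inl.1 h
  · exact Sum.lex_inr_inl h'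
  · exact Sum.lex_inr_inl h
  · exact hr _ _ (Sum.lex_inr_inr.1 h) (Sum.lex_inr_inr.1 h')

/-- The comparison of the two ways of bracketing an iterated product. -/
def nestedAssoc (Z : NestedIndex j → SSet.{0}) :
    prodSSet (Z (Sum.inl ())) (piSSet fun s => prodSSet (Z (Sum.inr ⟨s, Sum.inl ()⟩))
      (piSSet fun r => Z (Sum.inr ⟨s, Sum.inr r⟩))) ⟶
    prodSSet (prodSSet (Z (Sum.inl ())) (piSSet fun s => Z (Sum.inr ⟨s, Sum.inl ()⟩)))
      (piSSet fun r : Fin (∑ s, j s) => Z (Sum.inr ⟨(blockOf r).1, Sum.inr (blockOf r).2⟩)) where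
  app _ := ↾fun w => ((w.1, fun s => (w.2 s).1), fun r => (w.2 (blockOf r).1).2 (blockOf r).2)
  naturality _ _ _ := rfl

/-- The nested iterated shuffle product is a cross product over `NestedIndex`. -/
lemma linShuffle_nested (Z : NestedIndex j → SSet.{0}) (q : NestedIndex j → ℕ) {N : ℕ}
    (hN : q (Sum.inl ()) + ∑ s, (q (Sum.inr ⟨s, Sum.inl ()⟩) + ∑ r, q (Sum.inr ⟨s, Sum.inr r⟩)) = N)
    (z : ∀ i, (Z i) _⦋q i⦌ →₀ k) :
    ∃ φ : piFamily Z ⟶ prodSSet (Z (Sum.inl ())) (piSSet fun s =>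
      prodSSet (Z (Sum.inr ⟨s, Sum.inl ()⟩)) (piSSet fun r => Z (Sum.inr ⟨s, Sum.inr r⟩))),
    (∀ Δ b, φ.app Δ b = (b (Sum.inl ()), fun s => (b (Sum.inr ⟨s, Sum.inl ()⟩),
      fun r => b (Sum.inr ⟨s, Sum.inr r⟩)))) ∧
    linShuffle (Z (Sum.inl ())) (piSSet fun s => prodSSet (Z (Sum.inr ⟨s, Sum.inl ()⟩))
        (piSSet fun r => Z (Sum.inr ⟨s, Sum.inr r⟩))) (q (Sum.inl ()))
      (∑ s, (q (Sum.inr ⟨s, Sum.inl ()⟩) + ∑ r, q (Sum.inr ⟨s, Sum.inr r⟩))) N (z (Sum.inl ()))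
      (iterShuffle (fun s => prodSSet (Z (Sum.inr ⟨s, Sum.inl ()⟩))
        (piSSet fun r => Z (Sum.inr ⟨s, Sum.inr r⟩)))
        (fun s => q (Sum.inr ⟨s, Sum.inl ()⟩) + ∑ r, q (Sum.inr ⟨s, Sum.inr r⟩)) _
        fun s => linShuffle (Z (Sum.inr ⟨s, Sum.inl ()⟩))
            (piSSet fun r => Z (Sum.inr ⟨s, Sum.inr r⟩))
          (q (Sum.inr ⟨s, Sum.inl ()⟩)) (∑ r, q (Sum.inr ⟨s, Sum.inr r⟩)) _
          (z (Sum.inr ⟨s, Sum.inl ()⟩)) (iterShuffle (fun r => Z (Sum.inr ⟨s, Sum.inr r⟩))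
            (fun r => q (Sum.inr ⟨s, Sum.inr r⟩)) _ fun r => z (Sum.inr ⟨s, Sum.inr r⟩))) =
    chainMap φ N (cross nestedLex Z q N z) := by
  have h1 (s : Fin n) := linShuffle_iterShuffle_eq_cross (k := k) (fun i => Z (Sum.inr ⟨s, i⟩))
    (fun i => q (Sum.inr ⟨s, i⟩)) rfl fun i => z (Sum.inr ⟨s, i⟩)
  have h2 := chainMap_iterShuffle (k := k) (fun s => headSplit fun i => Z (Sum.inr ⟨s, i⟩))
    (fun s => q (Sum.inr ⟨s, Sum.inl ()⟩) + ∑ r, q (Sum.inr ⟨s, Sum.inr r⟩))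
    (∑ s, (q (Sum.inr ⟨s, Sum.inl ()⟩) + ∑ r, q (Sum.inr ⟨s, Sum.inr r⟩))) fun s =>
      cross (headLex (· < ·)) (fun i => Z (Sum.inr ⟨s, i⟩)) (fun i => q (Sum.inr ⟨s, i⟩)) _
        fun i => z (Sum.inr ⟨s, i⟩)
  have h3 := iterShuffle_cross (k := k) (fun s => headLex (ι := Fin (j s)) (· < ·))
    (fun y => Z (Sum.inr y)) (fun y => q (Sum.inr y))
    (fun s => q (Sum.inr ⟨s, Sum.inl ()⟩) + ∑ r, q (Sum.inr ⟨s, Sum.inr r⟩))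
    (fun s => by simp) _ rfl fun y => z (Sum.inr y)
  have h4 := linShuffle_head_cross (k := k)
    (Sigma.Lex (· < ·) fun s => headLex (ι := Fin (j s)) (· < ·)) Z q
    (n := ∑ s, (q (Sum.inr ⟨s, Sum.inl ()⟩) + ∑ r, q (Sum.inr ⟨s, Sum.inr r⟩)))
    (by rw [Fintype.sum_sigma]; simp) hN z
  have h5 := chainMap_linShuffle (k := k) (𝟙 (Z (Sum.inl ()))) (curryMap (fun y => Z (Sum.inr y)) ≫
      piSSetMap fun s => headSplit fun i => Z (Sum.inr ⟨s, i⟩)) (q (Sum.inl ()))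
    (∑ s, (q (Sum.inr ⟨s, Sum.inl ()⟩) + ∑ r, q (Sum.inr ⟨s, Sum.inr r⟩))) N (z (Sum.inl ()))
    (cross (Sigma.Lex (· < ·) fun s => headLex (ι := Fin (j s)) (· < ·)) (fun y => Z (Sum.inr y))
      (fun y => q (Sum.inr y)) _ fun y => z (Sum.inr y))
  rw [← chainMap_comp, ← h3, chainMap_id] at h5
  refine ⟨headSplit Z ≫ prodSSetMap (𝟙 (Z (Sum.inl ()))) (curryMap (fun y => Z (Sum.inr y)) ≫
      piSSetMap fun s => headSplit fun i => Z (Sum.inr ⟨s, i⟩)), fun _ _ => rfl, ?_⟩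
  refine (congrArg (linShuffle _ _ _ _ _ _) ((congrArg (iterShuffle _ _ _) (funext h1)).trans
    h2.symm)).trans (h5.symm.trans ?_)
  refine (congrArg _ h4).trans ?_
  exact Finsupp.mapDomain_comp.symm

/-- Associativity of the shuffle map. The two sides are cross products of the same chains, in
different orders of the factors, which gives the sign. -/
theorem linShuffle_assoc (Z : NestedIndex j → SSet.{0}) (q : NestedIndex j → ℕ) {N : ℕ}
    (hN : q (Sum.inl ()) + ∑ s, (q (Sum.inr ⟨s, Sum.inl ()⟩) + ∑ r, q (Sum.inr ⟨s, Sum.inr r⟩)) = N)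
    (hN' : (q (Sum.inl ()) + ∑ s, q (Sum.inr ⟨s, Sum.inl ()⟩)) + ∑ r : Fin (∑ s, j s),
      q (Sum.inr ⟨(blockOf r).1, Sum.inr (blockOf r).2⟩) = N)
    (z : ∀ i, (Z i) _⦋q i⦌ →₀ k) :
    linShuffle (prodSSet (Z (Sum.inl ())) (piSSet fun s => Z (Sum.inr ⟨s, Sum.inl ()⟩)))
      (piSSet fun r : Fin (∑ s, j s) => Z (Sum.inr ⟨(blockOf r).1, Sum.inr (blockOf r).2⟩))
      (q (Sum.inl ()) + ∑ s, q (Sum.inr ⟨s, Sum.inl ()⟩))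
      (∑ r : Fin (∑ s, j s), q (Sum.inr ⟨(blockOf r).1, Sum.inr (blockOf r).2⟩)) N
      (linShuffle (Z (Sum.inl ())) (piSSet fun s => Z (Sum.inr ⟨s, Sum.inl ()⟩)) (q (Sum.inl ()))
        (∑ s, q (Sum.inr ⟨s, Sum.inl ()⟩)) _ (z (Sum.inl ()))
        (iterShuffle (fun s => Z (Sum.inr ⟨s, Sum.inl ()⟩)) (fun s => q (Sum.inr ⟨s, Sum.inl ()⟩)) _
          fun s => z (Sum.inr ⟨s, Sum.inl ()⟩)))
      (iterShuffle (fun r => Z (Sum.inr ⟨(blockOf r).1, Sum.inr (blockOf r).2⟩))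
        (fun r => q (Sum.inr ⟨(blockOf r).1, Sum.inr (blockOf r).2⟩)) _
          fun r => z (Sum.inr ⟨(blockOf r).1, Sum.inr (blockOf r).2⟩)) =
    (-1 : k) ^ (∑ s, ∑ t, if t < s then
      q (Sum.inr ⟨s, Sum.inl ()⟩) * ∑ r, q (Sum.inr ⟨t, Sum.inr r⟩) else 0) •
    chainMap (nestedAssoc Z) N (linShuffle (Z (Sum.inl ())) (piSSet fun s =>
        prodSSet (Z (Sum.inr ⟨s, Sum.inl ()⟩)) (piSSet fun r => Z (Sum.inr ⟨s, Sum.inr r⟩)))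
      (q (Sum.inl ())) (∑ s, (q (Sum.inr ⟨s, Sum.inl ()⟩) + ∑ r, q (Sum.inr ⟨s, Sum.inr r⟩))) N
      (z (Sum.inl ())) (iterShuffle (fun s => prodSSet (Z (Sum.inr ⟨s, Sum.inl ()⟩))
        (piSSet fun r => Z (Sum.inr ⟨s, Sum.inr r⟩)))
        (fun s => q (Sum.inr ⟨s, Sum.inl ()⟩) + ∑ r, q (Sum.inr ⟨s, Sum.inr r⟩)) _
        fun s => linShuffle (Z (Sum.inr ⟨s, Sum.inl ()⟩))
            (piSSet fun r => Z (Sum.inr ⟨s, Sum.inr r⟩))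
          (q (Sum.inr ⟨s, Sum.inl ()⟩)) (∑ r, q (Sum.inr ⟨s, Sum.inr r⟩)) _
          (z (Sum.inr ⟨s, Sum.inl ()⟩)) (iterShuffle (fun r => Z (Sum.inr ⟨s, Sum.inr r⟩))
            (fun r => q (Sum.inr ⟨s, Sum.inr r⟩)) _ fun r => z (Sum.inr ⟨s, Sum.inr r⟩)))) := by
  obtain ⟨φ, hφ, h0⟩ := linShuffle_nested Z q hN z
  refine Eq.trans ?_ (congrArg (fun c => _ • chainMap (nestedAssoc Z) N c) h0).symm
  have h1 := linShuffle_iterShuffle_eq_cross (k := k) (fun i => Z (nestedEquiv j (Sum.inl i)))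
    (fun i => q (nestedEquiv j (Sum.inl i))) rfl fun i => z (nestedEquiv j (Sum.inl i))
  have h2 := iterShuffle_eq_cross (k := k) (fun i => Z (nestedEquiv j (Sum.inr i)))
    (fun i => q (nestedEquiv j (Sum.inr i))) rfl fun i => z (nestedEquiv j (Sum.inr i))
  have h3 := linShuffle_cross (k := k) (headLex (· < ·)) (· < ·) (fun i => Z (nestedEquiv j i))
    (fun i => q (nestedEquiv j i)) (n := q (nestedEquiv j (Sum.inl (Sum.inl ()))) +
      ∑ s, q (nestedEquiv j (Sum.inl (Sum.inr s)))) (n' := ∑ r, q (nestedEquiv j (Sum.inr r)))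
    (by rw [Fintype.sum_sum_type, Fintype.sum_unique]) rfl hN' fun i => z (nestedEquiv j i)
  have h4 := chainMap_linShuffle (k := k) (headSplit fun i => Z (nestedEquiv j (Sum.inl i)))
    (𝟙 (piFamily fun i => Z (nestedEquiv j (Sum.inr i))))
    (q (nestedEquiv j (Sum.inl (Sum.inl ()))) + ∑ s, q (nestedEquiv j (Sum.inl (Sum.inr s))))
    (∑ r, q (nestedEquiv j (Sum.inr r))) N
    (cross (headLex (· < ·)) (fun i => Z (nestedEquiv j (Sum.inl i)))
      (fun i => q (nestedEquiv j (Sum.inl i))) _ fun i => z (nestedEquiv j (Sum.inl i)))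
    (cross (· < ·) (fun i => Z (nestedEquiv j (Sum.inr i)))
      (fun i => q (nestedEquiv j (Sum.inr i))) _ fun i => z (nestedEquiv j (Sum.inr i)))
  have h5 := cross_reorder (k := k) (r := Sum.Lex (headLex (· < ·)) (· < ·))
    (r' := fun u v => nestedLex (nestedEquiv j u) (nestedEquiv j v))
    (by
      rintro (a | a) (b | b) h h'
      · exact headLex_asymm (fun _ _ => lt_asymm) a b (Sum.lex_inl_inl.1 h) (Sum.lex_inl_inl.1 h')
      · exact Sum.lex_inr_inl h'
      · exact Sum.lex_inr_inl h
      · exact (Sum.lex_inr_inr.1 h).asymm (Sum.lex_inr_inr.1 h'))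
    (fun a b => nestedLex_asymm _ _)
    (by
      rintro (a | a) (b | b) h
      · rcases a with a | a <;> rcases b with b | b
        · exact absurd rfl h
        · exact Or.inl (Sum.lex_inl_inl.2 (Sum.Lex.sep _ _))
        · exact Or.inr (Sum.lex_inl_inl.2 (Sum.Lex.sep _ _))
        · exact (lt_or_gt_of_ne (fun e : a = b => h (by rw [e]))).imp
            (fun h => Sum.lex_inl_inl.2 (Sum.lex_inr_inr.2 h))
            (fun h => Sum.lex_inl_inl.2 (Sum.lex_inr_inr.2 h))
      · exact Or.inl (Sum.Lex.sep _ _)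
      · exact Or.inr (Sum.Lex.sep _ _)
      · exact (lt_or_gt_of_ne (fun e : a = b => h (by rw [e]))).imp
            (fun h => Sum.lex_inr_inr.2 h) (fun h => Sum.lex_inr_inr.2 h))
    (fun a b h => nestedLex_total _ _ fun e => h ((nestedEquiv j).injective e))
    (fun i => Z (nestedEquiv j i)) (fun i => q (nestedEquiv j i)) N fun i => z (nestedEquiv j i)
  have h6 := cross_reindex (k := k) (nestedEquiv j)
    (r := fun u v => nestedLex (nestedEquiv j u) (nestedEquiv j v)) (fun _ _ => Iff.rfl) Z q N z
  rw [nested_sign, h6] at h5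
  rw [chainMap_id, ← h1, ← h2] at h4
  rw [← h2] at h3
  refine h4.symm.trans ((congrArg _ (h3.trans (congrArg _ h5))).trans ?_)
  have h7 : ∀ ψ : prodSSet (piFamily fun i => Z (nestedEquiv j (Sum.inl i)))
        (piFamily fun i => Z (nestedEquiv j (Sum.inr i))) ⟶
      prodSSet (prodSSet (Z (Sum.inl ())) (piSSet fun s => Z (Sum.inr ⟨s, Sum.inl ()⟩)))
      (piSSet fun r : Fin (∑ s, j s) => Z (Sum.inr ⟨(blockOf r).1, Sum.inr (blockOf r).2⟩)),
      (∀ Δ b, ψ.app Δ b = ((b.1 (Sum.inl ()), fun s => b.1 (Sum.inr s)), fun r => b.2 r)) →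
      ∀ (ε : k) (c : (piFamily Z) _⦋N⦌ →₀ k),
      chainMap ψ N (Finsupp.lmapDomain k k (fun b =>
          (fun i => b (Sum.inl i), fun i => b (Sum.inr i)))
        (ε • Finsupp.lmapDomain k k (fun (b : (piFamily Z) _⦋N⦌) i => b (nestedEquiv j i)) c)) =
      ε • chainMap (nestedAssoc Z) N (chainMap φ N c) := by
    intro ψ hψ ε c
    rw [map_smul]
    refine (map_smul (chainMap ψ N) ε _).trans (congrArg _ ?_)
    refine (congrArg (Finsupp.mapDomain _) Finsupp.mapDomain_comp.symm).trans
      (Finsupp.mapDomain_comp.symm.trans (Eq.trans ?_ Finsupp.mapDomain_comp))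
    refine congrArg (fun f => Finsupp.mapDomain f c) (funext fun b => ?_)
    refine (hψ _ _).trans (Eq.trans ?_ (congrArg ((nestedAssoc Z).app _) (hφ _ _)).symm)
    rfl
  exact h7 _ (fun _ _ => rfl) _ _

end assoc

/-! ### Symmetry of the shuffle map, and shuffle products with vertices -/

/-- Symmetry of the iterated shuffle map.  Both sides are cross products of the same chains, for the
orders `s < t` and `σ⁻¹ s < σ⁻¹ t` of the factors. -/
theorem iterShuffle_perm {m : ℕ} (σ : Equiv.Perm (Fin m)) (X : Fin m → SSet.{0}) (q : Fin m → ℕ)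
    {N : ℕ} (hN : ∑ s, q s = N) (x : ∀ s, (X s) _⦋q s⦌ →₀ k) :
    iterShuffle (fun s => X (σ⁻¹ s)) (fun s => q (σ⁻¹ s)) N (fun s => x (σ⁻¹ s)) =
      (-1 : k) ^ (∑ s, ∑ t, if s < t ∧ σ t < σ s then q s * q t else 0) •
        Finsupp.mapDomain (fun w s => w (σ⁻¹ s)) (iterShuffle X q N x) := by
  rw [iterShuffle_eq_cross X q hN, iterShuffle_eq_cross (fun s => X (σ⁻¹ s)) _
    ((Equiv.sum_comp σ⁻¹ q).trans hN)]
  have h1 := cross_reindex (k := k) σ⁻¹ (r := fun s t => σ⁻¹ s < σ⁻¹ t) (r' := (· < ·))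
    (fun _ _ => Iff.rfl) X q N x
  have h2 := cross_reorder (k := k) (r := (· < · : Fin m → Fin m → Prop))
    (r' := fun s t => σ⁻¹ s < σ⁻¹ t) (fun _ _ h => h.asymm) (fun _ _ h => h.asymm)
    (fun _ _ h => lt_or_gt_of_ne h) (fun _ _ h => lt_or_gt_of_ne fun e => h (σ⁻¹.injective e))
    (fun s => X (σ⁻¹ s)) (fun s => q (σ⁻¹ s)) N fun s => x (σ⁻¹ s)
  have h3 : (∑ s, ∑ t, indic (s < t ∧ σ⁻¹ t < σ⁻¹ s) * (q (σ⁻¹ s) * q (σ⁻¹ t))) =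
      ∑ s, ∑ t, if s < t ∧ σ t < σ s then q s * q t else 0 := by
    rw [← Equiv.sum_comp σ, Finset.sum_congr rfl fun s _ => (Equiv.sum_comp σ _).symm,
      Finset.sum_comm]
    refine Finset.sum_congr rfl fun s _ => Finset.sum_congr rfl fun t _ => ?_
    have hs (s) : σ⁻¹ (σ s) = s := σ.symm_apply_apply s
    rw [hs, hs, indic_eq_ite, ite_mul, one_mul, zero_mul, mul_comm (q t)]
    exact if_congr and_comm rfl rfl
  rw [h3, h1] at h2
  exact h2

lemma wordCount_const {n : ℕ} (b : Bool) {t : ℕ} (ht : t ≤ n) :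
    wordCount (fun _ : Fin n => b) b t = t := by
  have := wordCount_bool_add (n := n) (fun _ => b) ht
  cases b <;> simpa [wordCount] using this

lemma wordChain_const {n : ℕ} (b : Bool) : wordChain (fun _ : Fin n => b) b n = 𝟙 _ :=
  simplex_hom_ext fun t => by
    rw [wordChain_apply, wordCount_const b (Nat.lt_succ_iff.1 t.2),
      min_eq_right (Nat.lt_succ_iff.1 t.2)]
    rfl

lemma eq_const_of_wordCount {n : ℕ} {c : Fin n → Bool} {b : Bool} (h : wordCount c (!b) n = 0) :
    c = fun _ => b := by
  funext u
  by_contra hu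
  have h1 : c u = !b := by
    revert hu
    cases c u <;> cases b <;> simp
  have h2 := Finset.single_le_sum (f := fun u : Fin n => indic (u.val < n ∧ c u = !b))
    (fun _ _ => Nat.zero_le _) (Finset.mem_univ u)
  rw [indic_of ⟨u.2, h1⟩] at h2
  have h3 : wordCount c (!b) n = ∑ u : Fin n, indic (u.val < n ∧ c u = !b) := rfl
  omega

lemma wordSign_const {n : ℕ} (b : Bool) (q : Bool → ℕ) (h : q b = n) (h' : q (!b) = 0) :
    wordSign k (· < ·) q (fun _ : Fin n => b) = 1 := by
  rw [wordSign, if_pos]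
  · simp [wordInv]
  · intro i
    by_cases hi : i = b
    · rw [hi, wordCount_const b le_rfl, h]
    · have hi : i = !b := by revert hi; cases i <;> cases b <;> simp
      rw [hi, h']
      cases b <;> simp [wordCount]

/-- The shuffle product with a vertex, from the left. -/
lemma linShuffle_vertex_left (X Y : SSet.{0}) (q : ℕ) (a : X _⦋0⦌) (y : Y _⦋q⦌ →₀ k) :
    linShuffle X Y 0 q q (Finsupp.single a 1) y =
      Finsupp.mapDomain (fun b => (X.map (SimplexCategory.const ⦋q⦌ ⦋0⦌ 0).op a, b)) y := by
  rw [linShuffle_eq_sum_words X Y (zero_add q), Finset.sum_eq_single (fun _ => true)]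
  · have e : wordSign k (· < ·) (fun b => cond b q 0) (fun _ : Fin q => true) = 1 :=
      wordSign_const true _ rfl rfl
    rw [e, one_smul, wordChain_const, chainOp_id]
    have h : wordChain (fun _ : Fin q => true) false 0 = SimplexCategory.const ⦋q⦌ ⦋0⦌ 0 :=
      simplex_hom_ext fun t => congrArg Fin.val (Subsingleton.elim (α := Fin 1) _ _)
    rw [h, chainOp_single]
    induction y using Finsupp.induction_linear with
    | zero => simp
    | add f g hf hg => rw [map_add, hf, hg, Finsupp.mapDomain_add]
    | single b r => rw [pairChain_single, Finsupp.mapDomain_single, one_mul]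
  · intro c _ hc
    rw [wordSign, if_neg, zero_smul]
    exact fun h => hc (eq_const_of_wordCount (h false))
  · exact fun h => absurd (Finset.mem_univ _) h

/-- The shuffle product with a vertex, from the right. -/
lemma linShuffle_vertex_right (X Y : SSet.{0}) (p : ℕ) (x : X _⦋p⦌ →₀ k) (b : Y _⦋0⦌) :
    linShuffle X Y p 0 p x (Finsupp.single b 1) =
      Finsupp.mapDomain (fun a => (a, Y.map (SimplexCategory.const ⦋p⦌ ⦋0⦌ 0).op b)) x := by
  rw [linShuffle_eq_sum_words X Y (add_zero p), Finset.sum_eq_single (fun _ => false)]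
  · have e : wordSign k (· < ·) (fun b => cond b 0 p) (fun _ : Fin p => false) = 1 :=
      wordSign_const false _ rfl rfl
    rw [e, one_smul, wordChain_const, chainOp_id]
    have h : wordChain (fun _ : Fin p => false) true 0 = SimplexCategory.const ⦋p⦌ ⦋0⦌ 0 :=
      simplex_hom_ext fun t => congrArg Fin.val (Subsingleton.elim (α := Fin 1) _ _)
    rw [h, chainOp_single]
    induction x using Finsupp.induction_linear with
    | zero => simp
    | add f g hf hg => rw [map_add, LinearMap.add_apply, hf, hg, Finsupp.mapDomain_add]
    | single a r => rw [pairChain_single, Finsupp.mapDomain_single, mul_one]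
  · intro c _ hc
    rw [wordSign, if_neg, zero_smul]
    exact fun h => hc (eq_const_of_wordCount (h true))
  · exact fun h => absurd (Finset.mem_univ _) h

/-- The iterated shuffle product of vertices. -/
lemma iterShuffle_vertices {m : ℕ} (X : Fin m → SSet.{0}) (a : ∀ s, (X s) _⦋0⦌) :
    iterShuffle X (fun _ => 0) 0 (fun s => Finsupp.single (a s) (1 : k)) = Finsupp.single a 1 := by
  rw [iterShuffle_eq_cross X _ (by simp), cross, Fintype.sum_unique, wordSign,
    if_pos fun i => by simp [wordCount]]
  have h : crossTerm X (fun _ => 0) (default : Fin 0 → Fin m)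
      (fun s => Finsupp.single (a s) (1 : k)) =
      Finsupp.single a 1 := by
    have h1 (s : Fin m) : chainOp (X s) (wordChain (default : Fin 0 → Fin m) s 0)
        (Finsupp.single (a s) (1 : k)) = Finsupp.single (a s) 1 := by
      rw [show wordChain (default : Fin 0 → Fin m) s 0 = 𝟙 _ from simplex_hom_ext fun t => congrArg
          Fin.val (Subsingleton.elim (α := Fin 1) _ _),
        chainOp_id]
    refine (congrArg piChain (funext h1)).trans ((piChain_single a _).trans ?_)
    rw [Finset.prod_const_one]
  rw [h]
  simp only [wordInv, Finset.univ_eq_empty, Finset.sum_empty, pow_zero]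
  exact one_smul k _

/-- The iterated shuffle map for a single factor. -/
lemma iterShuffle_one (X : SSet.{0}) {q Q : ℕ} (hQ : q = Q) (x : X _⦋q⦌ →₀ k) :
    iterShuffle (fun _ : Fin 1 => X) (fun _ => q) Q (fun _ => x) =
      Finsupp.mapDomain (fun b (_ : Fin 1) => b) (hQ ▸ x : X _⦋Q⦌ →₀ k) := by
  subst hQ
  have h (Q : ℕ) (hQ : Q = 0) : linShuffle X (piSSet fun _ : Fin 0 => X) q Q q x
      (Finsupp.single (fun s => s.elim0) 1) = Finsupp.mapDomain (fun b => (b, fun s => s.elim0))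
          x := by
    subst hQ
    refine (linShuffle_vertex_right X (piSSet fun _ : Fin 0 => X) q x fun s => s.elim0).trans ?_
    exact congrArg (fun f => Finsupp.mapDomain f x) (funext fun b => Prod.ext rfl
      (funext fun s => s.elim0))
  refine (congrArg (Finsupp.mapDomain _) (h _ rfl)).trans (Finsupp.mapDomain_comp.symm.trans ?_)
  refine congrArg (fun f => Finsupp.mapDomain f x) (funext fun b => funext fun s => ?_)
  obtain rfl : s = 0 := Subsingleton.elim (α := Fin 1) _ _
  rfl

/-! ### Operad and module axioms on chains from axioms for functors -/

/-- Families of functors `P(n) × M(j_1) × … × M(j_n) ⥤ M(j_1 + … + j_n)`. -/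
abbrev StructureFunctors (P M : SymmSeq Cat.{0, 0}) :=
  ∀ (n : ℕ) (j : Fin n → ℕ), (P.obj n × ∀ s, M.obj (j s)) ⥤ M.obj (∑ s, j s)

/-- The axioms of a left module `M` in categories, with structure functors `F`, over an operad `P`
in categories with structure functors `G` and unit `e`.  The diagrams of functors are evaluated at
sequences of composable arrows, that is, at simplices of the nerves. -/
structure NerveLaws {P M : SymmSeq Cat.{0, 0}} (G : StructureFunctors P P) (e : P.obj 1)
    (F : StructureFunctors P M) : Prop where
  assoc : ∀ {n : ℕ} {j : Fin n → ℕ} {i : ∀ s, Fin (j s) → ℕ} {N : ℕ}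
    (x : ComposableArrows (P.obj n) N) (y : ∀ s, ComposableArrows (P.obj (j s)) N)
    (z : ∀ s r, ComposableArrows (M.obj (i s r)) N),
    nerveAct (F (∑ s, j s) fun r => i (blockOf r).1 (blockOf r).2) N
        (nerveAct (G n j) N (x, y), fun r => z (blockOf r).1 (blockOf r).2) ⋙
      (M.cast (sum_blockOf i)).toFunctor =
    nerveAct (F n fun s => ∑ r, i s r) N (x, fun s => nerveAct (F (j s) (i s)) N (y s, z s))
  left_unit : ∀ {j N : ℕ} (x : ComposableArrows (M.obj j) N) (h : ∑ _s : Fin 1, j = j),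
    nerveAct (F 1 fun _ => j) N ((Functor.const _).obj e, fun _ => x) ⋙ (M.cast h).toFunctor = x
  equivariance_A : ∀ {n : ℕ} {j : Fin n → ℕ} {N : ℕ} (σ : Equiv.Perm (Fin n))
    (x : ComposableArrows (P.obj n) N) (y : ∀ s, ComposableArrows (M.obj (j s)) N),
    nerveAct (F n j) N (x ⋙ (P.act σ).toFunctor, y) =
      (nerveAct (F n fun s => j (σ⁻¹ s)) N (x, fun s => y (σ⁻¹ s)) ⋙
        (M.cast (Equiv.sum_comp σ⁻¹ j)).toFunctor) ⋙ (M.act (blockPerm σ j)).toFunctor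
  equivariance_B : ∀ {n : ℕ} {j : Fin n → ℕ} {N : ℕ} (τ : ∀ s, Equiv.Perm (Fin (j s)))
    (x : ComposableArrows (P.obj n) N) (y : ∀ s, ComposableArrows (M.obj (j s)) N),
    nerveAct (F n j) N (x, fun s => y s ⋙ (M.act (τ s)).toFunctor) =
      nerveAct (F n j) N (x, y) ⋙ (M.act (sumPerm τ)).toFunctor

/-- The map on chains of the nerves that is induced by a functor. -/
abbrev nerveChainMap {C D : Cat.{0, 0}} (φ : C ⟶ D) (N : ℕ) :
    (nerve C _⦋N⦌ →₀ k) →ₗ[k] (nerve D _⦋N⦌ →₀ k) :=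
  chainMap (nerveFunctor.map φ) N

lemma act_normClass (P : SymmSeq Cat.{0, 0}) {n N : ℕ} (σ : Equiv.Perm (Fin n))
    (x : nerve (P.obj n) _⦋N⦌ →₀ k) :
    (((P.map (chains k)).act σ).f N).hom (normClass (nerve (P.obj n)) N x) =
      normClass (nerve (P.obj n)) N (nerveChainMap (P.act σ) N x) := rfl

lemma cast_normClass (P : SymmSeq Cat.{0, 0}) {a b N : ℕ} (h : a = b)
    (x : nerve (P.obj a) _⦋N⦌ →₀ k) :
    (((P.map (chains k)).cast h).f N).hom (normClass (nerve (P.obj a)) N x) =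
      normClass (nerve (P.obj b)) N (nerveChainMap (P.cast h) N x) := by
  subst h
  have h : nerveChainMap (P.cast (rfl : a = a)) N x = x := Finsupp.mapDomain_id
  rw [h]
  rfl

/-- The unit of the operad of chains: it sends `1` to the class of the vertex `e`. -/
def chainUnit (P : SymmSeq Cat.{0, 0}) (e : P.obj 1) :
    𝟙_ (ChainComplex (ModuleCat.{u} k) ℕ) ⟶ (P.map (chains k)).obj 1 :=
  unitDesc (normClass (nerve (P.obj 1)) 0 (Finsupp.single (ComposableArrows.mk₀ e) 1))

lemma chainUnit_unitElem (P : SymmSeq Cat.{0, 0}) (e : P.obj 1) :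
    ((chainUnit P e).f 0).hom (unitElem k) =
      normClass (nerve (P.obj 1)) 0 (Finsupp.single (ComposableArrows.mk₀ e) 1) :=
  unitDesc_unitElem _

section chainLaws

variable {P M : SymmSeq Cat.{0, 0}} {G : StructureFunctors P P} {e : P.obj 1}
  {F : StructureFunctors P M}

lemma chainMap_linShuffle_left {X Y X' : SSet.{0}} (φ : X ⟶ X') (p q n : ℕ) (x : X _⦋p⦌ →₀ k)
    (y : Y _⦋q⦌ →₀ k) : chainMap (prodSSetMap φ (𝟙 Y)) n (linShuffle X Y p q n x y) =
      linShuffle X' Y p q n (chainMap φ p x) y := by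
  rw [chainMap_linShuffle, chainMap_id]

lemma chainMap_linShuffle_right {X Y Y' : SSet.{0}} (ψ : Y ⟶ Y') (p q n : ℕ) (x : X _⦋p⦌ →₀ k)
    (y : Y _⦋q⦌ →₀ k) : chainMap (prodSSetMap (𝟙 X) ψ) n (linShuffle X Y p q n x y) =
      linShuffle X Y' p q n x (chainMap ψ q y) := by
  rw [chainMap_linShuffle, chainMap_id]

/-- The associativity axiom on unnormalized chains. -/
lemma chain_assoc (L : NerveLaws G e F) {n : ℕ} {j : Fin n → ℕ} {i : ∀ s, Fin (j s) → ℕ} {a : ℕ}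
    {b : Fin n → ℕ} {c : ∀ s, Fin (j s) → ℕ} {N : ℕ} (x : nerve (P.obj n) _⦋a⦌ →₀ k)
    (y : ∀ s, nerve (P.obj (j s)) _⦋b s⦌ →₀ k) (z : ∀ s r, nerve (M.obj (i s r)) _⦋c s r⦌ →₀ k)
    (h : (a + ∑ s, b s) + ∑ r : Fin (∑ s, j s), c (blockOf r).1 (blockOf r).2 = N)
    (h' : a + ∑ s, (b s + ∑ r, c s r) = N) :
    nerveChainMap (M.cast (sum_blockOf i)) N (chainMap (nerveActMap
      (F (∑ s, j s) fun r => i (blockOf r).1 (blockOf r).2)) N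
      (linShuffle (nerve (P.obj (∑ s, j s)))
        (piSSet fun r : Fin (∑ s, j s) => nerve (M.obj (i (blockOf r).1 (blockOf r).2)))
        (a + ∑ s, b s) (∑ r : Fin (∑ s, j s), c (blockOf r).1 (blockOf r).2) N
        (chainMap (nerveActMap (G n j)) (a + ∑ s, b s)
          (linShuffle (nerve (P.obj n)) (piSSet fun s => nerve (P.obj (j s))) a (∑ s, b s) _ x
            (iterShuffle (fun s => nerve (P.obj (j s))) b _ y)))
        (iterShuffle (fun r => nerve (M.obj (i (blockOf r).1 (blockOf r).2)))
          (fun r => c (blockOf r).1 (blockOf r).2) _ fun r => z (blockOf r).1 (blockOf r).2))) =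
    (-1 : k) ^ (∑ s, ∑ t, if t < s then b s * ∑ r, c t r else 0) •
      chainMap (nerveActMap (F n fun s => ∑ r, i s r)) N
        (linShuffle (nerve (P.obj n)) (piSSet fun s => nerve (M.obj (∑ r, i s r))) a
          (∑ s, (b s + ∑ r, c s r)) N x
          (iterShuffle (fun s => nerve (M.obj (∑ r, i s r))) (fun s => b s + ∑ r, c s r) _ fun s =>
            chainMap (nerveActMap (F (j s) (i s))) (b s + ∑ r, c s r)
              (linShuffle (nerve (P.obj (j s))) (piSSet fun r => nerve (M.obj (i s r))) (b s)
                (∑ r, c s r) _ (y s)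
                (iterShuffle (fun r => nerve (M.obj (i s r))) (c s) _ (z s))))) := by
  have h1 := chainMap_linShuffle_left (k := k)
    (Y := piSSet fun r : Fin (∑ s, j s) => nerve (M.obj (i (blockOf r).1 (blockOf r).2)))
    (nerveActMap (G n j))
    (a + ∑ s, b s) (∑ r : Fin (∑ s, j s), c (blockOf r).1 (blockOf r).2) N
    (linShuffle (nerve (P.obj n)) (piSSet fun s => nerve (P.obj (j s))) a (∑ s, b s) _ x
            (iterShuffle (fun s => nerve (P.obj (j s))) b _ y))
    (iterShuffle (fun r => nerve (M.obj (i (blockOf r).1 (blockOf r).2)))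
          (fun r => c (blockOf r).1 (blockOf r).2) _ fun r => z (blockOf r).1 (blockOf r).2)
  have h2 := chainMap_linShuffle_right (k := k) (X := nerve (P.obj n))
    (piSSetMap fun s => nerveActMap (F (j s) (i s))) a (∑ s, (b s + ∑ r, c s r)) N x
    (iterShuffle (fun s => prodSSet (nerve (P.obj (j s))) (piSSet fun r => nerve (M.obj (i s r))))
      (fun s => b s + ∑ r, c s r) _ fun s =>
              (linShuffle (nerve (P.obj (j s))) (piSSet fun r => nerve (M.obj (i s r))) (b s)
                (∑ r, c s r) _ (y s)
                (iterShuffle (fun r => nerve (M.obj (i s r))) (c s) _ (z s))))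
  have h3 := linShuffle_assoc (k := k) (j := j) (N := N)
    (nestedFamily (V := fun _ => SSet) (nerve (P.obj n)) (fun s => nerve (P.obj (j s)))
      (fun s r => nerve (M.obj (i s r))))
    (nestedFamily (V := fun _ => ℕ) a b c) h' h (nestedFamily x y z)
  have h4 := chainMap_iterShuffle (k := k) (fun s => nerveActMap (F (j s) (i s)))
    (fun s => b s + ∑ r, c s r) (∑ s, (b s + ∑ r, c s r)) fun s =>
              (linShuffle (nerve (P.obj (j s))) (piSSet fun r => nerve (M.obj (i s r))) (b s)
                (∑ r, c s r) _ (y s)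
                (iterShuffle (fun r => nerve (M.obj (i s r))) (c s) _ (z s)))
  refine (congrArg (fun v => nerveChainMap (M.cast (sum_blockOf i)) N (chainMap _ N v))
    (h1.symm.trans (congrArg _ h3))).trans ?_
  refine Eq.trans ?_ (congrArg (fun v => (-1 : k) ^
      (∑ s, ∑ t, if t < s then b s * ∑ r, c t r else 0) • v)
    (congrArg (chainMap (nerveActMap (F n fun s => ∑ r, i s r)) N)
      (h2.trans (congrArg (linShuffle _ _ _ _ _ _) h4))))
  have h5 (c) : nerveChainMap (M.cast (sum_blockOf i)) N (chainMap (nerveActMap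
      (F (∑ s, j s) fun r => i (blockOf r).1 (blockOf r).2)) N
        (chainMap (prodSSetMap (nerveActMap (G n j))
          (𝟙 (piSSet fun r : Fin (∑ s, j s) => nerve (M.obj (i (blockOf r).1 (blockOf r).2))))) N
          (chainMap (nestedAssoc (nestedFamily (V := fun _ => SSet) (nerve (P.obj n))
            (fun s => nerve (P.obj (j s))) (fun s r => nerve (M.obj (i s r))))) N c))) =
      chainMap (nerveActMap (F n fun s => ∑ r, i s r)) N
          (chainMap (prodSSetMap (𝟙 (nerve (P.obj n)))
        (piSSetMap fun s => nerveActMap (F (j s) (i s)))) N (c : _ →₀ k)) := by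
    refine (congrArg (Finsupp.mapDomain _) ((congrArg (Finsupp.mapDomain _)
      Finsupp.mapDomain_comp.symm).trans Finsupp.mapDomain_comp.symm)).trans
      (Finsupp.mapDomain_comp.symm.trans (Eq.trans ?_ Finsupp.mapDomain_comp))
    refine congrArg (fun f => Finsupp.mapDomain f c) (funext fun w => ?_)
    exact L.assoc w.1 (fun s => (w.2 s).1) fun s => (w.2 s).2
  refine Eq.trans ?_ (congrArg _ (h5 _))
  refine (congrArg (fun v => nerveChainMap _ N (chainMap _ N v))
      (map_smul (chainMap _ N) _ _)).trans ?_
  refine (congrArg (fun v => nerveChainMap _ N v) (map_smul (chainMap _ N) _ _)).trans ?_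
  exact map_smul (nerveChainMap _ N) _ _

/-- The left unit axiom on unnormalized chains. -/
lemma chain_left_unit (L : NerveLaws G e F) {j q Q : ℕ} (hQ : Q = q) (h : ∑ _s : Fin 1, j = j)
    (x : nerve (M.obj j) _⦋q⦌ →₀ k) :
    nerveChainMap (M.cast h) q (chainMap (nerveActMap (F 1 fun _ => j)) q
      (linShuffle (nerve (P.obj 1)) (piSSet fun _ : Fin 1 => nerve (M.obj j)) 0 Q q
        (Finsupp.single (ComposableArrows.mk₀ e) 1)
        (iterShuffle (fun _ : Fin 1 => nerve (M.obj j)) (fun _ => q) Q fun _ => x))) = x := by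
  subst hQ
  have h1 := linShuffle_vertex_left (k := k) (nerve (P.obj 1))
    (piSSet fun _ : Fin 1 => nerve (M.obj j)) Q (ComposableArrows.mk₀ e)
    (iterShuffle (fun _ : Fin 1 => nerve (M.obj j)) (fun _ => Q) Q fun _ => x)
  have h2 := iterShuffle_one (nerve (M.obj j)) rfl x
  refine (congrArg (fun v => nerveChainMap (M.cast h) Q (chainMap _ Q v))
    (h1.trans (congrArg (Finsupp.mapDomain _) h2))).trans ?_
  refine (congrArg (Finsupp.mapDomain _) ((congrArg (Finsupp.mapDomain _)
      Finsupp.mapDomain_comp.symm).trans Finsupp.mapDomain_comp.symm)).trans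
      (Finsupp.mapDomain_comp.symm.trans (Eq.trans ?_ Finsupp.mapDomain_id))
  refine congrArg (fun f => Finsupp.mapDomain f x) (funext fun w => ?_)
  exact L.left_unit w h

lemma linShuffle_congr_degree {X : SSet.{0}} {m : ℕ} {B : Fin m → SSet.{0}} {q : Fin m → ℕ}
    {p Q Q' N : ℕ} (h : Q = Q') (x : X _⦋p⦌ →₀ k) (y : ∀ s, (B s) _⦋q s⦌ →₀ k) :
    linShuffle X (piSSet B) p Q N x (iterShuffle B q Q y) =
      linShuffle X (piSSet B) p Q' N x (iterShuffle B q Q' y) := by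
  rw [h]

/-- Permuting the factors `y_s` in `x ⊗ y_1 ⊗ … ⊗ y_n` costs the Koszul sign. -/
lemma linShuffle_iterShuffle_perm {n p : ℕ} (σ : Equiv.Perm (Fin n)) (X : SSet.{0})
    (Y : Fin n → SSet.{0}) {q : Fin n → ℕ} {N : ℕ} (x : X _⦋p⦌ →₀ k) (y : ∀ s, (Y s) _⦋q s⦌ →₀ k) :
    linShuffle X (piSSet fun s => Y (σ⁻¹ s)) p (∑ s, q (σ⁻¹ s)) N x
      (iterShuffle (fun s => Y (σ⁻¹ s)) (fun s => q (σ⁻¹ s)) _ fun s => y (σ⁻¹ s)) =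
    (-1 : k) ^ (∑ s, ∑ t, if s < t ∧ σ t < σ s then q s * q t else 0) •
      Finsupp.mapDomain (fun w : X _⦋N⦌ × (∀ s, (Y s) _⦋N⦌) => (w.1, fun s => w.2 (σ⁻¹ s)))
        (linShuffle X (piSSet Y) p (∑ s, q s) N x (iterShuffle Y q _ y)) := by
  let ψ : piSSet Y ⟶ piSSet fun s => Y (σ⁻¹ s) :=
    { app := fun _ => ↾fun b s => b (σ⁻¹ s), naturality := fun _ _ _ => rfl }
  have h0 := linShuffle_congr_degree (k := k) (X := X) (N := N) (B := fun s => Y (σ⁻¹ s))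
    (q := fun s => q (σ⁻¹ s)) (Equiv.sum_comp σ⁻¹ q) x fun s => y (σ⁻¹ s)
  have h1 := iterShuffle_perm (k := k) σ Y q rfl y
  have h2 := chainMap_linShuffle_right (k := k) ψ p (∑ s, q s) N x (iterShuffle Y q _ y)
  refine h0.trans ((congrArg (linShuffleₗ X (piSSet fun s => Y (σ⁻¹ s)) p (∑ s, q s) N x) h1).trans
    ((map_smul (linShuffleₗ X (piSSet fun s => Y (σ⁻¹ s)) p (∑ s, q s) N x) _ _).trans ?_))
  exact congrArg _ h2.symm

/-- The equivariance axiom for block permutations on unnormalized chains. -/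
lemma chain_equivariance_A (L : NerveLaws G e F) {n : ℕ} {j : Fin n → ℕ} {p : ℕ} {q : Fin n → ℕ}
    {N : ℕ} (σ : Equiv.Perm (Fin n)) (x : nerve (P.obj n) _⦋p⦌ →₀ k)
    (y : ∀ s, nerve (M.obj (j s)) _⦋q s⦌ →₀ k) :
    chainMap (nerveActMap (F n j)) N
      (linShuffle (nerve (P.obj n)) (piSSet fun s => nerve (M.obj (j s))) p (∑ s, q s) N
        (nerveChainMap (P.act σ) p x) (iterShuffle (fun s => nerve (M.obj (j s))) q _ y)) =
    (-1 : k) ^ (∑ s, ∑ t, if s < t ∧ σ t < σ s then q s * q t else 0) •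
      nerveChainMap (M.act (blockPerm σ j)) N (nerveChainMap (M.cast (Equiv.sum_comp σ⁻¹ j)) N
        (chainMap (nerveActMap (F n fun s => j (σ⁻¹ s))) N
          (linShuffle (nerve (P.obj n)) (piSSet fun s => nerve (M.obj (j (σ⁻¹ s)))) p
            (∑ s, q (σ⁻¹ s)) N x (iterShuffle (fun s => nerve (M.obj (j (σ⁻¹ s))))
              (fun s => q (σ⁻¹ s)) _ fun s => y (σ⁻¹ s))))) := by
  have h1 := chainMap_linShuffle_left (k := k) (Y := piSSet fun s => nerve (M.obj (j s)))
    (nerveFunctor.map (P.act σ)) p (∑ s, q s) N x (iterShuffle (fun s => nerve (M.obj (j s))) q _ y)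
  have h2 := linShuffle_iterShuffle_perm (k := k) (N := N) σ (nerve (P.obj n))
    (fun s => nerve (M.obj (j s))) x y
  refine (congrArg (chainMap (nerveActMap (F n j)) N) h1.symm).trans ?_
  refine Eq.trans ?_ (congrArg (fun v => (-1 : k) ^
      (∑ s, ∑ t, if s < t ∧ σ t < σ s then q s * q t else 0) •
    nerveChainMap (M.act (blockPerm σ j)) N (nerveChainMap (M.cast (Equiv.sum_comp σ⁻¹ j)) N
        (chainMap (nerveActMap (F n fun s => j (σ⁻¹ s))) N v))) h2.symm)
  -- the sign of the symmetry is its own inverse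
  have h3 (ε : k) (hε : ε * ε = 1) (c) : chainMap (nerveActMap (F n j)) N
      (chainMap (prodSSetMap (nerveFunctor.map (P.act σ)) (𝟙 (piSSet fun s => nerve (M.obj (j s)))))
          N c) =
      ε • nerveChainMap (M.act (blockPerm σ j)) N (nerveChainMap (M.cast (Equiv.sum_comp σ⁻¹ j)) N
        (chainMap (nerveActMap (F n fun s => j (σ⁻¹ s))) N (ε •
          Finsupp.lmapDomain k k (fun w : nerve (P.obj n) _⦋N⦌ × (∀ s, nerve (M.obj (j s)) _⦋N⦌) =>
            (w.1, fun s => w.2 (σ⁻¹ s))) c))) := by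
    have h4 : chainMap (nerveActMap (F n j)) N (chainMap (prodSSetMap (nerveFunctor.map (P.act σ))
        (𝟙 (piSSet fun s => nerve (M.obj (j s))))) N c) =
        nerveChainMap (M.act (blockPerm σ j)) N (nerveChainMap (M.cast (Equiv.sum_comp σ⁻¹ j)) N
        (chainMap (nerveActMap (F n fun s => j (σ⁻¹ s))) N
          (Finsupp.lmapDomain k k (fun w : nerve (P.obj n) _⦋N⦌ × (∀ s, nerve (M.obj (j s)) _⦋N⦌) =>
            (w.1, fun s => w.2 (σ⁻¹ s))) c))) := by
      refine Finsupp.mapDomain_comp.symm.trans (Eq.trans ?_ ((congrArg (Finsupp.mapDomain _)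
        ((congrArg (Finsupp.mapDomain _) Finsupp.mapDomain_comp.symm).trans
          Finsupp.mapDomain_comp.symm)).trans Finsupp.mapDomain_comp.symm).symm)
      refine congrArg (fun f => Finsupp.mapDomain f c) (funext fun w => ?_)
      exact L.equivariance_A σ w.1 w.2
    refine h4.trans ?_
    refine Eq.trans ?_ (congrArg (fun v => ε • nerveChainMap (M.act (blockPerm σ j)) N
      (nerveChainMap (M.cast (Equiv.sum_comp σ⁻¹ j)) N v)) (map_smul (chainMap _ N) ε _)).symm
    rw [map_smul, map_smul, smul_smul, hε, one_smul]
  refine h3 _ ?_ _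
  rw [← pow_add, ← two_mul, pow_mul]
  simp

/-- The equivariance axiom for sums of permutations on unnormalized chains. -/
lemma chain_equivariance_B (L : NerveLaws G e F) {n : ℕ} {j : Fin n → ℕ} {p : ℕ} {q : Fin n → ℕ}
    {N : ℕ} (τ : ∀ s, Equiv.Perm (Fin (j s))) (x : nerve (P.obj n) _⦋p⦌ →₀ k)
    (y : ∀ s, nerve (M.obj (j s)) _⦋q s⦌ →₀ k) :
    chainMap (nerveActMap (F n j)) N
      (linShuffle (nerve (P.obj n)) (piSSet fun s => nerve (M.obj (j s))) p (∑ s, q s) N x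
        (iterShuffle (fun s => nerve (M.obj (j s))) q _ fun s => nerveChainMap (M.act (τ s)) (q s)
            (y s))) =
    nerveChainMap (M.act (sumPerm τ)) N (chainMap (nerveActMap (F n j)) N
      (linShuffle (nerve (P.obj n)) (piSSet fun s => nerve (M.obj (j s))) p (∑ s, q s) N x
        (iterShuffle (fun s => nerve (M.obj (j s))) q _ y))) := by
  have h1 := chainMap_iterShuffle (k := k) (fun s => nerveFunctor.map (M.act (τ s))) q (∑ s, q s) y
  have h2 := chainMap_linShuffle_right (k := k) (piSSetMap fun s => nerveFunctor.map (M.act (τ s)))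
    p (∑ s, q s) N x (iterShuffle (fun s => nerve (M.obj (j s))) q _ y)
  refine (congrArg (chainMap (nerveActMap (F n j)) N) ((congrArg (linShuffle _ _ _ _ _ _)
    h1.symm).trans h2.symm)).trans ?_
  refine Finsupp.mapDomain_comp.symm.trans (Eq.trans ?_ Finsupp.mapDomain_comp)
  refine congrArg (fun f => Finsupp.mapDomain f _) (funext fun w => ?_)
  exact L.equivariance_B τ w.1 w.2

/-- Module laws for functors give module laws for the induced maps on chains. -/
theorem moduleLaws_chainStructure (L : NerveLaws G e F) :
    ModuleLaws (chainStructure (k := k) G) (chainUnit P e) (chainStructure F) where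
  assoc {n j i a b c N} x y z h h' := by
    obtain ⟨x, rfl⟩ := normClass_surjective (nerve (P.obj n)) a x
    choose y' hy using fun s => normClass_surjective (nerve (P.obj (j s))) (b s) (y s)
    obtain rfl : (fun s => normClass (nerve (P.obj (j s))) (b s) (y' s)) = y := funext hy
    choose z' hz using fun s r => normClass_surjective (nerve (M.obj (i s r))) (c s r) (z s r)
    obtain rfl : (fun s r => normClass (nerve (M.obj (i s r))) (c s r) (z' s r)) = z :=
      funext fun s => funext fun r => hz s r
    have h1 := chainStructure_app (k := k) G rfl x y'
    have h2 (s : Fin n) := chainStructure_app (k := k) F rfl (y' s) (z' s)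
    refine (congrArg (fun v => (((M.map (chains k)).cast (sum_blockOf i)).f N).hom
      ((chainStructure F).app h v _)) h1).trans ?_
    refine Eq.trans ?_ (congrArg (fun v => (-1 : k) ^
        (∑ s, ∑ t, if t < s then b s * ∑ r, c t r else 0) •
      (chainStructure F).app h' (normClass (nerve (P.obj n)) a x) v) (funext h2)).symm
    refine (congrArg _ (chainStructure_app F h _ _)).trans ?_
    refine Eq.trans ?_ (congrArg _ (chainStructure_app F h' _ _)).symm
    refine (cast_normClass M (sum_blockOf i) _).trans ?_
    refine Eq.trans ?_ (map_smul (normClass _ N) _ _)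
    exact congrArg (normClass _ N) (chain_assoc L x y' z' h h')
  left_unit {j q} x h := by
    obtain ⟨x, rfl⟩ := normClass_surjective (nerve (M.obj j)) q x
    have h1 := chainUnit_unitElem (k := k) P e
    refine (congrArg (fun v => (((M.map (chains k)).cast _).f q).hom
      ((chainStructure F).app h v _)) h1).trans ?_
    refine (congrArg _ (chainStructure_app F h _ _)).trans ?_
    refine (cast_normClass M _ _).trans ?_
    exact congrArg (normClass _ q) (chain_left_unit L (by simp) _ x)
  equivariance_A {n j p q N} σ x y h h' := by
    obtain ⟨x, rfl⟩ := normClass_surjective (nerve (P.obj n)) p x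
    choose y' hy using fun s => normClass_surjective (nerve (M.obj (j s))) (q s) (y s)
    obtain rfl : (fun s => normClass (nerve (M.obj (j s))) (q s) (y' s)) = y := funext hy
    refine (congrArg (fun v => (chainStructure F).app h v _) (act_normClass P σ x)).trans ?_
    refine (chainStructure_app F h _ _).trans ?_
    refine Eq.trans ?_ (congrArg (fun v => (-1 : k) ^
        (∑ s, ∑ t, if s < t ∧ σ t < σ s then q s * q t else 0) •
      (((M.map (chains k)).act (blockPerm σ j)).f N).hom
        ((((M.map (chains k)).cast (Equiv.sum_comp σ⁻¹ j)).f N).hom v))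
        (chainStructure_app F h' x fun s => y' (σ⁻¹ s))).symm
    refine Eq.trans ?_ (congrArg (fun v => (-1 : k) ^
        (∑ s, ∑ t, if s < t ∧ σ t < σ s then q s * q t else 0) •
      (((M.map (chains k)).act (blockPerm σ j)).f N).hom v) (cast_normClass M _ _)).symm
    refine Eq.trans ?_ (map_smul (normClass _ N) _ _)
    exact congrArg (normClass _ N) (chain_equivariance_A L σ x y')
  equivariance_B {n j p q N} τ x y h := by
    obtain ⟨x, rfl⟩ := normClass_surjective (nerve (P.obj n)) p x
    choose y' hy using fun s => normClass_surjective (nerve (M.obj (j s))) (q s) (y s)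
    obtain rfl : (fun s => normClass (nerve (M.obj (j s))) (q s) (y' s)) = y := funext hy
    refine (chainStructure_app F h x fun s => nerveChainMap (M.act (τ s)) (q s) (y' s)).trans ?_
    refine Eq.trans ?_ (congrArg (((M.map (chains k)).act (sumPerm τ)).f N).hom
      (chainStructure_app F h x y')).symm
    exact congrArg (normClass _ N) (chain_equivariance_B L τ x y')

end chainLaws

/-! ### Right units and the chains of a point -/

/-- The right unit axiom on unnormalized chains. -/
lemma chain_right_unit {P : SymmSeq Cat.{0, 0}} {G : StructureFunctors P P} {e : P.obj 1}
    {j p Q : ℕ} (hQ : Q = 0) (h : ∑ _s : Fin j, 1 = j)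
    (L : ∀ x : ComposableArrows (P.obj j) p, nerveAct (G j fun _ => 1) p
      (x, fun _ => (Functor.const _).obj e) ⋙ (P.cast h).toFunctor = x)
    (x : nerve (P.obj j) _⦋p⦌ →₀ k) :
    nerveChainMap (P.cast h) p (chainMap (nerveActMap (G j fun _ => 1)) p
      (linShuffle (nerve (P.obj j)) (piSSet fun _ : Fin j => nerve (P.obj 1)) p Q p x
        (iterShuffle (fun _ : Fin j => nerve (P.obj 1)) (fun _ => 0) Q fun _ =>
          Finsupp.single (ComposableArrows.mk₀ e) 1))) = x := by
  subst hQ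
  have h1 := linShuffle_vertex_right (k := k) (nerve (P.obj j))
    (piSSet fun _ : Fin j => nerve (P.obj 1)) p x fun _ => ComposableArrows.mk₀ e
  have h2 := iterShuffle_vertices (k := k) (fun _ : Fin j => nerve (P.obj 1))
    fun _ => ComposableArrows.mk₀ e
  refine (congrArg (fun v => nerveChainMap (P.cast h) p (chainMap _ p v))
    ((congrArg (linShuffle _ _ _ _ _ _) h2).trans h1)).trans ?_
  refine (congrArg (Finsupp.mapDomain _) Finsupp.mapDomain_comp.symm).trans
      (Finsupp.mapDomain_comp.symm.trans (Eq.trans ?_ Finsupp.mapDomain_id))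
  exact congrArg (fun f => Finsupp.mapDomain f x) (funext fun w => L w)

/-- The right unit condition on chains follows from that for functors. -/
lemma right_unit_chainStructure {P : SymmSeq Cat.{0, 0}} {G : StructureFunctors P P} {e : P.obj 1}
    {j p : ℕ} (h : ∑ _s : Fin j, 1 = j)
    (L : ∀ x : ComposableArrows (P.obj j) p, nerveAct (G j fun _ => 1) p
      (x, fun _ => (Functor.const _).obj e) ⋙ (P.cast h).toFunctor = x)
    (x : ((P.map (chains k)).obj j).X p) (h' : p + ∑ _s : Fin j, 0 = p) :
    (((P.map (chains k)).cast h).f p).hom ((chainStructure G).app (j := fun _ : Fin j => 1)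
      (q := fun _ => 0) h' x fun _ => ((chainUnit P e).f 0).hom (unitElem k)) = x := by
  obtain ⟨x, rfl⟩ := normClass_surjective (nerve (P.obj j)) p x
  have h1 := chainUnit_unitElem (k := k) P e
  refine (congrArg (fun v => (((P.map (chains k)).cast h).f p).hom
    ((chainStructure G).app (j := fun _ : Fin j => 1) (q := fun _ => 0) h'
      (normClass (nerve (P.obj j)) p x) fun _ => v)) h1).trans ?_
  refine (congrArg _ (chainStructure_app G h' _ _)).trans ?_
  refine (cast_normClass P h _).trans ?_
  exact congrArg (normClass _ p) (chain_right_unit (by simp) h L x)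

/-- The normalized chains of a simplicial set with a single simplex in each dimension are the unit
complex. -/
lemma isIso_unitDesc_of_subsingleton {X : SSet.{0}} (v : X _⦋0⦌) [hX : ∀ n, Subsingleton (X _⦋n⦌)] :
    IsIso (unitDesc (normClass (k := k) X 0 (Finsupp.single v 1))) := by
  have h0 : Function.Bijective fun r : k => normClass (k := k) X 0 (Finsupp.single v r) := by
    constructor
    · intro r r' h
      have h1 : normClass (k := k) X 0 (Finsupp.single v r - Finsupp.single v r') = 0 := by
        rw [map_sub]
        exact sub_eq_zero.2 h
      rw [normClass_eq_zero_iff] at h1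
      have h2 : Finsupp.single v r - Finsupp.single v r' = 0 := h1
      exact Finsupp.single_injective v (sub_eq_zero.1 h2)
    · intro x
      obtain ⟨x, rfl⟩ := normClass_surjective X 0 x
      refine ⟨x v, congrArg (normClass X 0) (Finsupp.ext fun b => ?_)⟩
      rw [Subsingleton.elim b v, Finsupp.single_eq_same]
  have : ∀ n, IsIso ((unitDesc (normClass (k := k) X 0 (Finsupp.single v 1))).f n) := by
    intro n
    cases n with
    | zero =>
      have h1 : (unitDesc (normClass (k := k) X 0 (Finsupp.single v 1))).f 0 =
        (HomologicalComplex.singleObjXSelf (ComplexShape.down ℕ) 0 (𝟙_ (ModuleCat.{u} k))).hom ≫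
          ModuleCat.ofHom (LinearMap.toSpanSingleton k _
              (normClass (k := k) X 0 (Finsupp.single v 1))) :=
        HomologicalComplex.mkHomFromSingle_f _ _
      rw [h1]
      have : IsIso (ModuleCat.ofHom (LinearMap.toSpanSingleton k _
          (normClass (k := k) X 0 (Finsupp.single v 1)))) := by
        rw [ConcreteCategory.isIso_iff_bijective]
        convert h0 using 2 with r
        refine (map_smul (normClass X 0) _ _).symm.trans (congrArg _ ?_)
        rw [Finsupp.smul_single, smul_eq_mul, mul_one]
        rfl
      infer_instance
    | succ n =>
      have h1 : Limits.IsZero ((𝟙_ (ChainComplex (ModuleCat.{u} k) ℕ)).X (n + 1)) :=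
        HomologicalComplex.isZero_single_obj_X _ _ _ _ (Nat.succ_ne_zero n)
      have h2 : Limits.IsZero ((normChains k X).X (n + 1)) := by
        have : Subsingleton ((normChains k X).X (n + 1)) := by
          refine ⟨fun a b => ?_⟩
          have h (x : (normChains k X).X (n + 1)) : x = 0 := by
            obtain ⟨x, rfl⟩ := normClass_surjective X (n + 1) x
            rw [normClass_eq_zero_iff]
            induction x using Finsupp.induction_linear with
            | zero => exact Submodule.zero_mem _
            | add f g hf hg => exact Submodule.add_mem _ hf hg
            | single b r =>
              have h := single_map_σ_mem_degenerate (k := k) X (0 : Fin (n + 1))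
                (X.map (SimplexCategory.const ⦋n⦌ ⦋0⦌ 0).op v) r
              rwa [Subsingleton.elim (X.map (SimplexCategory.σ 0).op _) b] at h
          rw [h a, h b]
        exact ModuleCat.isZero_of_subsingleton _
      exact h1.isIso h2 _
  exact HomologicalComplex.Hom.isIso_of_components _

instance (n : ℕ) : Subsingleton (nerve (Codiscrete (Equiv.Perm (Fin 0))) _⦋n⦌) := by
  refine ⟨fun a b => CategoryTheory.Functor.ext (fun i => ?_) (fun i j f => rfl)⟩
  exact Codiscrete.ext (Subsingleton.elim _ _)

/-- `E S_0` is a point, so that its normalized chains are the unit complex. -/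
lemma nonempty_obj_zero_iso :
    Nonempty ((Dch k).obj 0 ≅ 𝟙_ (ChainComplex (ModuleCat.{u} k) ℕ)) :=
  have := isIso_unitDesc_of_subsingleton (k := k) (X := nerve (Codiscrete (Equiv.Perm (Fin 0))))
    (ComposableArrows.mk₀ ⟨1⟩)
  ⟨(asIso (unitDesc (normClass (k := k) (nerve (Codiscrete (Equiv.Perm (Fin 0)))) 0
    (Finsupp.single (ComposableArrows.mk₀ ⟨1⟩) 1)))).symm⟩

/-! ### Block permutations and the order of letters -/

/-- A strictly monotone map between finite ordinals of the same size is the identity. -/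
lemma cast_eq_of_strictMono {a b : ℕ} (h : a = b) {f : Fin a → Fin b} (hf : StrictMono f)
    (x : Fin a) :
    f x = Fin.cast h x := by
  subst h
  have e : f = id := by
    have h1 : (Finset.univ : Finset (Fin a)).card = a := by simp
    have h2 := Finset.orderEmbOfFin_unique h1 (fun x => Finset.mem_univ (f x)) hf
    have h3 := Finset.orderEmbOfFin_unique h1 (fun x => Finset.mem_univ (id x)) strictMono_id
    exact h2.trans h3.symm
  rw [e]
  rfl

/-- Permutations that order the letters in the same way agree. -/
lemma perm_eq_of_lt {a b : ℕ} (h : a = b) (e : Equiv.Perm (Fin a)) (e' : Equiv.Perm (Fin b))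
    (H : ∀ x y, e x < e y → e' (Fin.cast h x) < e' (Fin.cast h y)) (x : Fin a) :
    e' (Fin.cast h x) = Fin.cast h (e x) := by
  have h1 : StrictMono fun x => e' (Fin.cast h (e.symm x)) := fun x y hxy =>
    H _ _ (by rwa [Equiv.apply_symm_apply, Equiv.apply_symm_apply])
  have h2 := cast_eq_of_strictMono h h1 (e x)
  simpa using h2

lemma finSigmaFinEquiv_lt_iff {n : ℕ} {j : Fin n → ℕ} {x y : Σ s, Fin (j s)} :
    finSigmaFinEquiv x < finSigmaFinEquiv y ↔ Sigma.Lex (· < ·) (fun _ => (· < ·)) x y := by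
  rw [lt_iff_blockOf, blockOf, blockOf, Equiv.symm_apply_apply, Equiv.symm_apply_apply]

/-- If the inner blocks of two letters are in lexicographic order, then so are the letters, as
letters of the outer blocks. -/
lemma nested_lex {n : ℕ} {j : Fin n → ℕ} {i : ∀ s, Fin (j s) → ℕ} (R S : Σ s, Fin (j s))
    (x : Fin (i R.1 R.2)) (y : Fin (i S.1 S.2)) (h : Sigma.Lex (· < ·) (fun _ => (· < ·)) R S) :
    Sigma.Lex (· < ·) (fun _ => (· < ·))
      (⟨R.1, finSigmaFinEquiv (n := i R.1) ⟨R.2, x⟩⟩ : Σ s, Fin (∑ r, i s r))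
      ⟨S.1, finSigmaFinEquiv (n := i S.1) ⟨S.2, y⟩⟩ := by
  cases h with
  | left _ _ h => exact Sigma.Lex.left _ _ h
  | right _ _ h => exact Sigma.Lex.right _ _ (finSigmaFinEquiv_lt (Sigma.Lex.left _ _ h))

/-- The letters of an iterated sum. -/
lemma cast_sum_blockOf {n : ℕ} {j : Fin n → ℕ} (i : ∀ s, Fin (j s) → ℕ)
    (X : Σ r : Fin (∑ s, j s), Fin (i (blockOf r).1 (blockOf r).2)) :
    Fin.cast (sum_blockOf i) (finSigmaFinEquiv X) =
      finSigmaFinEquiv (n := fun s => ∑ r, i s r) ⟨(blockOf X.1).1,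
        finSigmaFinEquiv (n := i (blockOf X.1).1) ⟨(blockOf X.1).2, X.2⟩⟩ := by
  set g : (Σ r : Fin (∑ s, j s), Fin (i (blockOf r).1 (blockOf r).2)) → Fin (∑ s, ∑ r, i s r) :=
    fun X => finSigmaFinEquiv (n := fun s => ∑ r, i s r) ⟨(blockOf X.1).1,
        finSigmaFinEquiv (n := i (blockOf X.1).1) ⟨(blockOf X.1).2, X.2⟩⟩ with hg
  have h : StrictMono (g ∘ blockOf) := by
    intro x y hxy
    have hxy := (lt_iff_blockOf _ _).1 hxy
    have key (X Y) (h : Sigma.Lex (· < ·) (fun _ => (· < ·)) X Y) : g X < g Y := by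
      refine finSigmaFinEquiv_lt ?_
      cases h with
      | left x y h => exact nested_lex _ _ x y ((lt_iff_blockOf _ _).1 h)
      | right _ _ h => exact Sigma.Lex.right _ _ (finSigmaFinEquiv_lt (Sigma.Lex.right _ _ h))
    exact key _ _ hxy
  refine (cast_eq_of_strictMono (sum_blockOf i) h (finSigmaFinEquiv X)).symm.trans ?_
  exact congrArg g (Equiv.symm_apply_apply _ X)

/-- The block permutation carries the block `σ⁻¹ t` to position `t`. -/
lemma blockPerm_inv_cast {m : ℕ} (σ : Equiv.Perm (Fin m)) (j : Fin m → ℕ)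
    (X : Σ t, Fin (j (σ⁻¹ t))) :
    (blockPerm σ j)⁻¹ (Fin.cast (Equiv.sum_comp σ⁻¹ j) (finSigmaFinEquiv X)) =
      finSigmaFinEquiv (⟨σ⁻¹ X.1, X.2⟩ : Σ s, Fin (j s)) := by
  change finSigmaFinEquiv (Equiv.sigmaCongrLeft (β := fun s => Fin (j s)) σ⁻¹
    (finSigmaFinEquiv.symm (finSigmaFinEquiv X))) = _
  rw [Equiv.symm_apply_apply]
  rfl

/-- A block permutation orders the letters by the positions of their blocks, and then inside the
blocks. -/
lemma blockPerm_lt_iff {m : ℕ} (σ : Equiv.Perm (Fin m)) {j : Fin m → ℕ} (X Y : Σ s, Fin (j s)) :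
    blockPerm σ j (finSigmaFinEquiv X) < blockPerm σ j (finSigmaFinEquiv Y) ↔
      Sigma.Lex (fun s t => σ s < σ t) (fun _ => (· < ·)) X Y := by
  have key (X : Σ s, Fin (j s)) : ∃ X' : Σ t, Fin (j (σ⁻¹ t)), (⟨σ⁻¹ X'.1, X'.2⟩ : Σ s, Fin (j s)) =
      X ∧
      blockPerm σ j (finSigmaFinEquiv X) = Fin.cast (Equiv.sum_comp σ⁻¹ j)
          (finSigmaFinEquiv X') := by
    set X' : Σ t, Fin (j (σ⁻¹ t)) := finSigmaFinEquiv.symm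
      (Fin.cast (Equiv.sum_comp σ⁻¹ j).symm (blockPerm σ j (finSigmaFinEquiv X))) with hX'
    have h1 : Fin.cast (Equiv.sum_comp σ⁻¹ j) (finSigmaFinEquiv X') =
        blockPerm σ j (finSigmaFinEquiv X) := by
      rw [hX', Equiv.apply_symm_apply]
      rfl
    refine ⟨X', ?_, h1.symm⟩
    have h2 := blockPerm_inv_cast σ j X'
    rw [h1] at h2
    have h3 : finSigmaFinEquiv X = _ := (Equiv.symm_apply_apply (blockPerm σ j) _).symm.trans h2
    exact (finSigmaFinEquiv.injective h3).symm
  obtain ⟨⟨s, x⟩, rfl, hX⟩ := key X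
  obtain ⟨⟨t, y⟩, rfl, hY⟩ := key Y
  rw [hX, hY]
  refine (finSigmaFinEquiv_lt_iff (j := fun t => j (σ⁻¹ t)) (x := ⟨s, x⟩) (y := ⟨t, y⟩)).trans ?_
  have hσ (s) : σ (σ⁻¹ s) = s := σ.apply_symm_apply s
  rw [Sigma.lex_iff, Sigma.lex_iff]
  dsimp only
  rw [hσ, hσ]
  refine or_congr Iff.rfl ?_
  constructor
  · rintro ⟨rfl, h⟩
    exact ⟨rfl, h⟩
  · rintro ⟨h, h'⟩
    obtain rfl := σ⁻¹.injective h
    exact ⟨rfl, h'⟩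

lemma blockPerm_one {m : ℕ} (j : Fin m → ℕ) : blockPerm 1 j = 1 := by
  refine Equiv.ext fun x => ?_
  refine (perm_eq_of_lt rfl 1 (blockPerm 1 j) (fun x y h => ?_) x)
  obtain ⟨X, rfl⟩ := finSigmaFinEquiv.surjective x
  obtain ⟨Y, rfl⟩ := finSigmaFinEquiv.surjective y
  exact (blockPerm_lt_iff 1 X Y).2 (finSigmaFinEquiv_lt_iff.1 h)

lemma sumPerm_apply {m : ℕ} {j : Fin m → ℕ} (τ : ∀ s, Equiv.Perm (Fin (j s))) (X : Σ s, Fin (j s)) :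
    sumPerm τ (finSigmaFinEquiv X) = finSigmaFinEquiv (⟨X.1, τ X.1 X.2⟩ : Σ s, Fin (j s)) := by
  change finSigmaFinEquiv (Equiv.sigmaCongrRight τ (finSigmaFinEquiv.symm (finSigmaFinEquiv X))) = _
  rw [Equiv.symm_apply_apply]
  rfl

/-- If the permutations `τ` and `σ` put the inner block of one letter before that of another letter,
then they put the letter itself first, blocks of blocks being permuted inside the outer blocks by
`τ` and as outer blocks by `σ`. -/
lemma nested_blockPerm_lex {n : ℕ} {j : Fin n → ℕ} {i : ∀ s, Fin (j s) → ℕ} (σ : Equiv.Perm (Fin n))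
    (τ : ∀ s, Equiv.Perm (Fin (j s))) (R S : Σ s, Fin (j s)) (x : Fin (i R.1 R.2))
    (y : Fin (i S.1 S.2)) (h : Sigma.Lex (fun s t => σ s < σ t) (fun _ => (· < ·))
      (⟨R.1, τ R.1 R.2⟩ : Σ s, Fin (j s)) ⟨S.1, τ S.1 S.2⟩) :
    Sigma.Lex (fun s t => σ s < σ t) (fun _ => (· < ·))
      (⟨R.1, blockPerm (τ R.1) (i R.1) (finSigmaFinEquiv (n := i R.1) ⟨R.2, x⟩)⟩ :
        Σ s, Fin (∑ r, i s r))
      ⟨S.1, blockPerm (τ S.1) (i S.1) (finSigmaFinEquiv (n := i S.1) ⟨S.2, y⟩)⟩ := by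
  obtain ⟨s, r⟩ := R
  obtain ⟨s', r'⟩ := S
  rw [Sigma.lex_iff] at h
  rcases h with h | ⟨e, h⟩
  · exact Sigma.Lex.left _ _ h
  · dsimp only at e
    subst e
    exact Sigma.Lex.right _ _ ((blockPerm_lt_iff _ _ _).2 (Sigma.Lex.left _ _ h))

/-- Block permutations of block permutations. -/
lemma cast_blockPerm_blockPerm {n : ℕ} {j : Fin n → ℕ} (σ : Equiv.Perm (Fin n))
    (τ : ∀ s, Equiv.Perm (Fin (j s))) (i : ∀ s, Fin (j s) → ℕ)
    (x : Fin (∑ r : Fin (∑ s, j s), i (blockOf r).1 (blockOf r).2)) :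
    (blockPerm σ (fun s => ∑ r, i s r) * sumPerm fun s => blockPerm (τ s) (i s))
        (Fin.cast (sum_blockOf i) x) =
      Fin.cast (sum_blockOf i) (blockPerm (blockPerm σ j * sumPerm τ)
        (fun r => i (blockOf r).1 (blockOf r).2) x) := by
  refine perm_eq_of_lt _ _ _ (fun x y h => ?_) x
  obtain ⟨⟨R, x⟩, rfl⟩ := finSigmaFinEquiv.surjective x
  obtain ⟨⟨S, y⟩, rfl⟩ := finSigmaFinEquiv.surjective y
  rw [cast_sum_blockOf, cast_sum_blockOf, Equiv.Perm.mul_apply, Equiv.Perm.mul_apply, sumPerm_apply,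
    sumPerm_apply, blockPerm_lt_iff]
  rw [blockPerm_lt_iff] at h
  have hb (R : Fin (∑ s, j s)) : (blockPerm σ j * sumPerm τ) R =
      blockPerm σ j (finSigmaFinEquiv (⟨(blockOf R).1, τ _ (blockOf R).2⟩ : Σ s, Fin (j s))) := by
    rw [Equiv.Perm.mul_apply, ← sumPerm_apply, blockOf, Equiv.apply_symm_apply]
  cases h with
  | left _ _ h =>
    rw [hb, hb, blockPerm_lt_iff] at h
    exact nested_blockPerm_lex σ τ _ _ x y h
  | right _ _ h =>
    exact Sigma.Lex.right _ _ ((blockPerm_lt_iff _ _ _).2 (Sigma.Lex.right _ _ h))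

/-! ### Identities between morphisms of non-commutative sets -/

/-- The identity, as a morphism between equal objects. -/
def castHom {a b : ℕ} (h : a = b) : NCSet.mk a ⟶ NCSet.mk b := eqToHom (congrArg NCSet.mk h)

lemma castHom_rfl (a : ℕ) : castHom (rfl : a = a) = 𝟙 _ := rfl

@[simp] lemma castHom_comp {a b c : ℕ} (h : a = b) (h' : b = c) :
    castHom h ≫ castHom h' = castHom (h.trans h') := by
  subst h
  subst h'
  rw [castHom_rfl, Category.comp_id]

/-- A morphism of non-commutative sets is determined by the ordered preimages. -/
lemma ncHom_ext {X Y : NCSet} {f g : X ⟶ Y} (h : ∀ i, NCHom.fib f i = NCHom.fib g i) : f = g := by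
  refine NCHom.ext (funext fun a => ?_) (funext h)
  have h1 := (NCHom.mem_fib f (NCHom.toFun f a) a).2 rfl
  rw [h] at h1
  exact ((NCHom.mem_fib g _ a).1 h1).symm

lemma fib_comp_permHom {X : NCSet} {n : ℕ} (f : X ⟶ NCSet.mk n) (σ : Equiv.Perm (Fin n))
    (i : Fin n) :
    NCHom.fib (f ≫ permHom σ) i = NCHom.fib f (σ⁻¹ i) := by
  change List.flatMap (NCHom.fib f) [σ⁻¹ i] = _
  rw [List.flatMap_singleton]

lemma fib_permHom_comp {Y : NCSet} {n : ℕ} (σ : Equiv.Perm (Fin n)) (f : NCSet.mk n ⟶ Y)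
    (i : Fin Y.card) : NCHom.fib (permHom σ ≫ f) i = (NCHom.fib f i).map ⇑σ⁻¹ := by
  change List.flatMap (fun b => [σ⁻¹ b]) (NCHom.fib f i) = _
  rw [← List.map_eq_flatMap]

lemma fib_comp_castHom {X : NCSet} {a b : ℕ} (f : X ⟶ NCSet.mk a) (h : a = b) (i : Fin b) :
    NCHom.fib (f ≫ castHom h) i = NCHom.fib f (Fin.cast h.symm i) := by
  subst h
  rw [castHom_rfl, Category.comp_id]
  rfl

lemma fib_castHom_comp {Y : NCSet} {a b : ℕ} (h : a = b) (f : NCSet.mk b ⟶ Y) (i : Fin Y.card) :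
    NCHom.fib (castHom h ≫ f) i = (NCHom.fib f i).map (Fin.cast h.symm) := by
  subst h
  rw [castHom_rfl, Category.id_comp]
  exact (List.map_id _).symm

lemma fib_oplusHom {m : ℕ} {X Y : Fin m → NCSet} (f : ∀ s, X s ⟶ Y s) (x : Σ s, Fin (Y s).card) :
    NCHom.fib (oplusHom f) (finSigmaFinEquiv x) =
      (NCHom.fib (f x.1) x.2).map fun a => finSigmaFinEquiv (⟨x.1, a⟩ : Σ s, Fin (X s).card) := by
  change List.map _ (NCHom.sigmaFib f (finSigmaFinEquiv.symm (finSigmaFinEquiv x))) = _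
  rw [Equiv.symm_apply_apply]
  exact List.map_map

lemma permHom_injective {n : ℕ} : Function.Injective (permHom (n := n)) := fun _ _ h =>
  Equiv.ext fun i => congrFun (congrArg NCHom.toFun h) i

lemma permHom_inv_comp {n : ℕ} (σ : Equiv.Perm (Fin n)) : permHom σ⁻¹ ≫ permHom σ = 𝟙 _ := by
  rw [← permHom_mul, mul_inv_cancel, permHom_one]

lemma permHom_comp_inv {n : ℕ} (σ : Equiv.Perm (Fin n)) : permHom σ ≫ permHom σ⁻¹ = 𝟙 _ := by
  rw [← permHom_mul, inv_mul_cancel, permHom_one]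

lemma oplusHom_permHom {m : ℕ} {j : Fin m → ℕ} (τ : ∀ s, Equiv.Perm (Fin (j s))) :
    oplusHom (X := fun s => NCSet.mk (j s)) (fun s => permHom (τ s)) = permHom (sumPerm τ) :=
  NCHom.ext rfl (funext fun _ => rfl)

lemma permHom_castHom {a b : ℕ} (h : a = b) (σ : Equiv.Perm (Fin a)) (τ : Equiv.Perm (Fin b))
    (H : ∀ x, τ (Fin.cast h x) = Fin.cast h (σ x)) : permHom σ ≫ castHom h = castHom h ≫ permHom
        τ := by
  subst h
  obtain rfl : τ = σ := Equiv.ext H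
  rw [castHom_rfl, Category.comp_id, Category.id_comp]

/-- A disjoint union of disjoint unions is the disjoint union of all morphisms. -/
lemma oplusHom_oplusHom {n : ℕ} {j : Fin n → ℕ} {X Y : ∀ s, Fin (j s) → NCSet}
    (f : ∀ s r, X s r ⟶ Y s r) :
    oplusHom (X := fun r : Fin (∑ s, j s) => X (blockOf r).1 (blockOf r).2)
        (fun r => f (blockOf r).1 (blockOf r).2) ≫ castHom (sum_blockOf fun s r => (Y s r).card) =
      castHom (sum_blockOf fun s r => (X s r).card) ≫
        oplusHom (X := fun s => NCSet.mk (∑ r, (X s r).card))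
          (Y := fun s => NCSet.mk (∑ r, (Y s r).card)) fun s => oplusHom (f s) := by
  refine ncHom_ext fun i => ?_
  obtain ⟨i, rfl⟩ : ∃ i', Fin.cast (sum_blockOf fun s r => (Y s r).card) i' = i :=
    ⟨Fin.cast (sum_blockOf fun s r => (Y s r).card).symm i, rfl⟩
  obtain ⟨i, rfl⟩ := finSigmaFinEquiv.surjective i
  refine (fib_comp_castHom _ _ _).trans (Eq.trans ?_ (fib_castHom_comp _ _ _).symm)
  refine (fib_oplusHom (fun r : Fin (∑ s, j s) => f (blockOf r).1 (blockOf r).2) i).trans ?_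
  rw [cast_sum_blockOf fun s r => (Y s r).card]
  refine Eq.trans ?_ (congrArg (List.map _) ((fib_oplusHom
    (X := fun s => NCSet.mk (∑ r, (X s r).card)) (Y := fun s => NCSet.mk (∑ r, (Y s r).card))
    (fun s => oplusHom (f s)) ⟨(blockOf i.1).1, finSigmaFinEquiv ⟨(blockOf i.1).2, i.2⟩⟩).trans
      (congrArg (List.map _) (fib_oplusHom (f (blockOf i.1).1) ⟨(blockOf i.1).2, i.2⟩)))).symm
  rw [List.map_map, List.map_map]
  refine congrArg (fun F => List.map F _) (funext fun a => ?_)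
  have h := cast_sum_blockOf (fun s r => (X s r).card) ⟨i.1, a⟩
  exact congrArg (Fin.cast (sum_blockOf fun s r => (X s r).card).symm) h

/-- The associativity axiom for `μ` on objects. -/
lemma mu_assoc {n : ℕ} {j : Fin n → ℕ} {X Y : ∀ s, Fin (j s) → NCSet} (f : ∀ s r, X s r ⟶ Y s r)
    (σ : Equiv.Perm (Fin n)) (τ : ∀ s, Equiv.Perm (Fin (j s))) :
    (oplusHom (X := fun r : Fin (∑ s, j s) => X (blockOf r).1 (blockOf r).2)
        (fun r => f (blockOf r).1 (blockOf r).2) ≫ permHom (blockPerm (blockPerm σ j * sumPerm τ)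
          fun r => (Y (blockOf r).1 (blockOf r).2).card)) ≫
      castHom (sum_blockOf fun s r => (Y s r).card) =
    castHom (sum_blockOf fun s r => (X s r).card) ≫
      oplusHom (X := fun s => NCSet.mk (∑ r, (X s r).card))
        (Y := fun s => NCSet.mk (∑ r, (Y s r).card))
        (fun s => oplusHom (f s) ≫ permHom (blockPerm (τ s) fun r => (Y s r).card)) ≫
      permHom (blockPerm σ fun s => ∑ r, (Y s r).card) := by
  have h1 := permHom_castHom (sum_blockOf fun s r => (Y s r).card) _ _
    (cast_blockPerm_blockPerm σ τ fun s r => (Y s r).card)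
  have h2 := oplusHom_comp (X := fun s => NCSet.mk (∑ r, (X s r).card))
    (Y := fun s => NCSet.mk (∑ r, (Y s r).card)) (Z := fun s => NCSet.mk (∑ r, (Y s r).card))
    (fun s => oplusHom (f s)) (fun s => permHom (blockPerm (τ s) fun r => (Y s r).card))
  rw [h2, oplusHom_permHom, Category.assoc, Category.assoc, ← permHom_mul, h1,
    ← Category.assoc, oplusHom_oplusHom, Category.assoc]

/-- Block permutations are natural with respect to disjoint unions of morphisms. -/
lemma oplusHom_blockPerm {n : ℕ} (σ : Equiv.Perm (Fin n)) {X Y : Fin n → NCSet}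
    (f : ∀ s, X s ⟶ Y s) :
    (oplusHom f ≫ permHom (blockPerm σ fun s => (Y s).card)) ≫
        castHom (Equiv.sum_comp σ⁻¹ fun s => (Y s).card).symm =
      (permHom (blockPerm σ fun s => (X s).card) ≫
        castHom (Equiv.sum_comp σ⁻¹ fun s => (X s).card).symm) ≫
          oplusHom (X := fun s => X (σ⁻¹ s)) fun s => f (σ⁻¹ s) := by
  refine ncHom_ext fun i => ?_
  obtain ⟨i, rfl⟩ := finSigmaFinEquiv.surjective i
  refine Eq.trans ?_ (congrArg (fun g => NCHom.fib g _) (Category.assoc _ _ _)).symm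
  refine (fib_comp_castHom _ _ _).trans ((fib_comp_permHom _ _ _).trans
    (Eq.trans ?_ ((fib_permHom_comp _ _ _).trans
        (congrArg (List.map _) (fib_castHom_comp _ _ _))).symm))
  refine (congrArg (NCHom.fib (oplusHom f)) (blockPerm_inv_cast σ (fun s => (Y s).card) i)).trans ?_
  refine (fib_oplusHom f _).trans (Eq.trans ?_ (congrArg (fun l => List.map _ (List.map _ l))
    (fib_oplusHom (fun s => f (σ⁻¹ s)) i)).symm)
  rw [List.map_map, List.map_map]
  refine congrArg (fun F => List.map F _) (funext fun a => ?_)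
  exact (blockPerm_inv_cast σ (fun s => (X s).card) ⟨i.1, a⟩).symm

/-- Block permutations of products of permutations. -/
lemma permHom_blockPerm_mul {n : ℕ} (σ ρ : Equiv.Perm (Fin n)) (p : Fin n → ℕ) :
    permHom (blockPerm (σ * ρ) p) ≫ castHom (Equiv.sum_comp ρ⁻¹ p).symm =
      (permHom (blockPerm ρ p) ≫ castHom (Equiv.sum_comp ρ⁻¹ p).symm) ≫
        permHom (blockPerm σ fun s => p (ρ⁻¹ s)) := by
  refine ncHom_ext fun i => ?_
  obtain ⟨i, rfl⟩ : ∃ i', Fin.cast (Equiv.sum_comp σ⁻¹ fun s => p (ρ⁻¹ s)) i' = i :=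
    ⟨Fin.cast (Equiv.sum_comp σ⁻¹ fun s => p (ρ⁻¹ s)).symm i, rfl⟩
  obtain ⟨i, rfl⟩ := finSigmaFinEquiv.surjective i
  refine (fib_comp_castHom _ _ _).trans (Eq.trans ?_ ((fib_comp_permHom _ _ _).trans
    (fib_comp_castHom _ _ _)).symm)
  refine congrArg (fun x => [x]) ?_
  refine Eq.trans (blockPerm_inv_cast (σ * ρ) p i) ?_
  refine Eq.trans ?_ (congrArg (fun x => (blockPerm ρ p)⁻¹ (Fin.cast (Equiv.sum_comp ρ⁻¹ p) x))
    (blockPerm_inv_cast σ (fun s => p (ρ⁻¹ s)) i)).symm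
  exact (blockPerm_inv_cast ρ p ⟨σ⁻¹ i.1, i.2⟩).symm

/-- The disjoint union of a single morphism. -/
lemma oplusHom_one {X Y : NCSet} (f : X ⟶ Y) (h : ∑ _s : Fin 1, X.card = X.card)
    (h' : ∑ _s : Fin 1, Y.card = Y.card) :
    oplusHom (fun _ : Fin 1 => f) ≫ castHom h' = castHom h ≫ f := by
  have key (Z : NCSet) (hZ : ∑ _s : Fin 1, Z.card = Z.card) (x : Fin Z.card) :
      finSigmaFinEquiv (⟨0, x⟩ : Σ _ : Fin 1, Fin Z.card) = Fin.cast hZ.symm x :=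
    Fin.ext (finSigmaFinEquiv_one _)
  refine ncHom_ext fun i => ?_
  refine (fib_comp_castHom _ _ _).trans (Eq.trans ?_ (fib_castHom_comp _ _ _).symm)
  refine (congrArg (NCHom.fib (oplusHom fun _ : Fin 1 => f)) (key Y h' i).symm).trans ?_
  refine (fib_oplusHom (fun _ : Fin 1 => f) ⟨0, i⟩).trans ?_
  exact congrArg (fun F => List.map F _) (funext fun a => key X h a)

/-! ### The axioms for the functors `μ` -/

/-- Functors to `m \ F(as)` agree if they agree up to identifications `castHom` of equal targets. -/
lemma under_functor_ext {T : Type*} [Category T] {m : ℕ} {A B : T ⥤ Under (NCSet.mk m)}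
    (h : ∀ t, (A.obj t).right.card = (B.obj t).right.card)
    (hobj : ∀ t, (A.obj t).hom ≫ castHom (h t) = (B.obj t).hom)
    (hmap : ∀ t t' (f : t ⟶ t'), (A.map f).right ≫ castHom (h t') = castHom (h t) ≫
        (B.map f).right) :
    A = B := by
  have key (a b : Under (NCSet.mk m)) (h : a.right.card = b.right.card)
      (h' : a.hom ≫ castHom h = b.hom) : ∃ e : a = b, (eqToHom e).right = castHom h := by
    have e : a = b := StructuredArrow.obj_ext _ _ (congrArg NCSet.mk h) h'
    exact ⟨e, StructuredArrow.eqToHom_right e⟩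
  refine CategoryTheory.Functor.ext (fun t => (key _ _ (h t) (hobj t)).1) fun t t' f => ?_
  obtain ⟨e, he⟩ := key _ _ (h t) (hobj t)
  obtain ⟨e', he'⟩ := key _ _ (h t') (hobj t')
  refine Under.UnderMorphism.ext ?_
  change (A.map f).right = (eqToHom e).right ≫ (B.map f).right ≫ (eqToHom e'.symm).right
  have h1 : (eqToHom e').right ≫ (eqToHom e'.symm).right = 𝟙 _ := by
    rw [← Under.comp_right, eqToHom_trans, eqToHom_refl]
    rfl
  rw [he]
  rw [he'] at h1
  rw [← Category.assoc]
  refine Eq.trans ?_ (congrArg (fun g => g ≫ (eqToHom e'.symm).right) (hmap t t' f))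
  refine Eq.trans ?_ (Category.assoc _ _ _).symm
  refine Eq.trans ?_ (congrArg (fun g => (A.map f).right ≫ g) h1).symm
  exact (Category.comp_id _).symm

lemma Kcat_cast {a b : ℕ} (h : a = b) :
    (Kcat.cast h).toFunctor = Under.map (castHom h.symm) := by
  subst h
  exact (Under.mapId_eq _).symm

lemma sumPerm_inv {m : ℕ} {j : Fin m → ℕ} (τ : ∀ s, Equiv.Perm (Fin (j s))) :
    sumPerm (fun s => (τ s)⁻¹) = (sumPerm τ)⁻¹ := rfl

lemma permHom_inv_castHom {a b : ℕ} (h : a = b) (σ : Equiv.Perm (Fin a)) (τ : Equiv.Perm (Fin b))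
    (H : ∀ x, τ (Fin.cast h x) = Fin.cast h (σ x)) :
    permHom σ⁻¹ ≫ castHom h = castHom h ≫ permHom τ⁻¹ := by
  subst h
  obtain rfl : τ = σ := Equiv.ext H
  rw [castHom_rfl, Category.comp_id, Category.id_comp]

/-- The associativity axiom for `μ` on morphisms. -/
lemma mu_assoc_map {n : ℕ} {j : Fin n → ℕ} {X Y : ∀ s, Fin (j s) → NCSet} (f : ∀ s r, X s r ⟶ Y s r)
    (σ σ' : Equiv.Perm (Fin n)) (τ τ' : ∀ s, Equiv.Perm (Fin (j s))) :
    (permHom (blockPerm (blockPerm σ j * sumPerm τ)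
          fun r => (X (blockOf r).1 (blockOf r).2).card)⁻¹ ≫
      oplusHom (X := fun r : Fin (∑ s, j s) => X (blockOf r).1 (blockOf r).2)
        (fun r => f (blockOf r).1 (blockOf r).2) ≫ permHom (blockPerm (blockPerm σ' j * sumPerm τ')
          fun r => (Y (blockOf r).1 (blockOf r).2).card)) ≫
      castHom (sum_blockOf fun s r => (Y s r).card) =
    castHom (sum_blockOf fun s r => (X s r).card) ≫
      permHom (blockPerm σ fun s => ∑ r, (X s r).card)⁻¹ ≫
      oplusHom (X := fun s => NCSet.mk (∑ r, (X s r).card))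
        (Y := fun s => NCSet.mk (∑ r, (Y s r).card))
        (fun s => permHom (blockPerm (τ s) fun r => (X s r).card)⁻¹ ≫
          oplusHom (f s) ≫ permHom (blockPerm (τ' s) fun r => (Y s r).card)) ≫
      permHom (blockPerm σ' fun s => ∑ r, (Y s r).card) := by
  have h1 := permHom_inv_castHom (sum_blockOf fun s r => (X s r).card) _ _
    (cast_blockPerm_blockPerm σ τ fun s r => (X s r).card)
  have h2 := oplusHom_comp (X := fun s => NCSet.mk (∑ r, (X s r).card))
    (Y := fun s => NCSet.mk (∑ r, (X s r).card)) (Z := fun s => NCSet.mk (∑ r, (Y s r).card))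
    (fun s => permHom (blockPerm (τ s) fun r => (X s r).card)⁻¹)
    (fun s => oplusHom (f s) ≫ permHom (blockPerm (τ' s) fun r => (Y s r).card))
  rw [h2, oplusHom_permHom, sumPerm_inv, Category.assoc, mu_assoc f σ' τ', ← Category.assoc, h1,
    mul_inv_rev, permHom_mul]
  simp only [Category.assoc]

/-- The associativity axiom for `μ`. -/
lemma kcat_assoc {n : ℕ} {j : Fin n → ℕ} {i : ∀ s, Fin (j s) → ℕ} {N : ℕ}
    (x : ComposableArrows (Dcat.obj n) N) (y : ∀ s, ComposableArrows (Dcat.obj (j s)) N)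
    (z : ∀ s r, ComposableArrows (Kcat.obj (i s r)) N) :
    nerveAct (muCat (∑ s, j s) fun r => i (blockOf r).1 (blockOf r).2) N
        (nerveAct (deltaCat n j) N (x, y), fun r => z (blockOf r).1 (blockOf r).2) ⋙
      (Kcat.cast (sum_blockOf i)).toFunctor =
    nerveAct (muCat n fun s => ∑ r, i s r) N (x, fun s => nerveAct (muCat (j s) (i s)) N
        (y s, z s)) := by
  refine (congrArg (_ ⋙ ·) (Kcat_cast (sum_blockOf i))).trans (under_functor_ext
    (fun t => sum_blockOf fun s r => ((z s r).obj t).right.card) (fun t => ?_) fun t t' f => ?_)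
  · have h := mu_assoc (X := fun s r => NCSet.mk (i s r)) (fun s r => ((z s r).obj t).hom)
      (x.obj t).as fun s => ((y s).obj t).as
    refine (Category.assoc _ _ _).trans ((congrArg (castHom (sum_blockOf i).symm ≫ ·) h).trans ?_)
    rw [← Category.assoc, castHom_comp]
    exact Category.id_comp _
  · exact mu_assoc_map (fun s r => ((z s r).map f).right) (x.obj t).as (x.obj t').as
      (fun s => ((y s).obj t).as) fun s => ((y s).obj t').as

/-- The equivariance axiom for `μ` and block permutations on objects. -/
lemma oplusHom_blockPerm_mul {n : ℕ} (σ ρ : Equiv.Perm (Fin n)) {X Y : Fin n → NCSet}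
    (f : ∀ s, X s ⟶ Y s) :
    (oplusHom f ≫ permHom (blockPerm (σ * ρ) fun s => (Y s).card)) ≫
        castHom (Equiv.sum_comp ρ⁻¹ fun s => (Y s).card).symm =
      permHom (blockPerm ρ fun s => (X s).card) ≫
        castHom (Equiv.sum_comp ρ⁻¹ fun s => (X s).card).symm ≫
          oplusHom (X := fun s => X (ρ⁻¹ s)) (fun s => f (ρ⁻¹ s)) ≫
            permHom (blockPerm σ fun s => (Y (ρ⁻¹ s)).card) := by
  have h1 := congrArg (oplusHom f ≫ ·) (permHom_blockPerm_mul σ ρ fun s => (Y s).card)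
  have h2 := congrArg (· ≫ permHom (blockPerm σ fun s => (Y (ρ⁻¹ s)).card)) (oplusHom_blockPerm ρ f)
  refine (Category.assoc _ _ _).trans (h1.trans (Eq.trans ?_ (h2.trans ?_)))
  · simp only [Category.assoc]
  · simp only [Category.assoc]

/-- The equivariance axiom for `μ` and block permutations on morphisms. -/
lemma blockPerm_mul_map {n : ℕ} (σ σ' ρ : Equiv.Perm (Fin n)) {X Y : Fin n → NCSet}
    (f : ∀ s, X s ⟶ Y s) :
    (permHom (blockPerm (σ * ρ) fun s => (X s).card)⁻¹ ≫ oplusHom f ≫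
        permHom (blockPerm (σ' * ρ) fun s => (Y s).card)) ≫
        castHom (Equiv.sum_comp ρ⁻¹ fun s => (Y s).card).symm =
      castHom (Equiv.sum_comp ρ⁻¹ fun s => (X s).card).symm ≫
        permHom (blockPerm σ fun s => (X (ρ⁻¹ s)).card)⁻¹ ≫
          oplusHom (X := fun s => X (ρ⁻¹ s)) (fun s => f (ρ⁻¹ s)) ≫
            permHom (blockPerm σ' fun s => (Y (ρ⁻¹ s)).card) := by
  have h1 : permHom (blockPerm (σ * ρ) fun s => (X s).card)⁻¹ ≫
      permHom (blockPerm ρ fun s => (X s).card) ≫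
        castHom (Equiv.sum_comp ρ⁻¹ fun s => (X s).card).symm =
      castHom (Equiv.sum_comp ρ⁻¹ fun s => (X s).card).symm ≫
        permHom (blockPerm σ fun s => (X (ρ⁻¹ s)).card)⁻¹ := by
    have h := congrArg (fun g => permHom (blockPerm (σ * ρ) fun s => (X s).card)⁻¹ ≫ g ≫
      permHom (blockPerm σ fun s => (X (ρ⁻¹ s)).card)⁻¹)
          (permHom_blockPerm_mul σ ρ fun s => (X s).card)
    simp only [Category.assoc] at h
    rw [permHom_comp_inv, ← Category.assoc (permHom _) (permHom _), permHom_inv_comp,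
      Category.id_comp, Category.comp_id] at h
    exact h.symm
  have h2 := oplusHom_blockPerm_mul σ' ρ f
  rw [Category.assoc, h2, ← Category.assoc (castHom _) (permHom _), ← h1]
  simp only [Category.assoc]

/-- `K_cat` is a left module over `D_cat`. -/
lemma nerveLaws_muCat : NerveLaws (P := Dcat) (M := Kcat) deltaCat ⟨1⟩ muCat where
  assoc := kcat_assoc
  left_unit {j N} x h := by
    have hc (Z : NCSet) : ∑ _s : Fin 1, Z.card = Z.card := by simp
    refine (congrArg (_ ⋙ ·) (Kcat_cast h)).trans (under_functor_ext
      (fun t => hc (x.obj t).right) (fun t => ?_) fun t t' f => ?_)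
    · have h1 := oplusHom_one (x.obj t).hom h (hc _)
      change (castHom h.symm ≫ oplusHom (X := fun _ : Fin 1 => NCSet.mk j)
        (Y := fun _ => (x.obj t).right) (fun _ => (x.obj t).hom) ≫
          permHom (blockPerm 1 fun _ => (x.obj t).right.card)) ≫ castHom _ = (x.obj t).hom
      rw [blockPerm_one, permHom_one, Category.comp_id, Category.assoc]
      refine (congrArg (castHom h.symm ≫ ·) h1).trans ((Category.assoc _ _ _).symm.trans ?_)
      rw [castHom_comp]
      exact Category.id_comp _
    · have h1 := oplusHom_one (x.map f).right (hc _) (hc _)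
      change (permHom (blockPerm 1 fun _ => (x.obj t).right.card)⁻¹ ≫
        oplusHom (fun _ : Fin 1 => (x.map f).right) ≫
          permHom (blockPerm 1 fun _ => (x.obj t').right.card)) ≫ castHom _ = _
      rw [blockPerm_one, blockPerm_one, inv_one, permHom_one, permHom_one, Category.comp_id,
        Category.id_comp]
      exact h1
  equivariance_A {n j N} σ x y := by
    refine Eq.trans ?_ (congrArg (fun F => (nerveAct (muCat n fun s => j (σ⁻¹ s)) N
      (x, fun s => y (σ⁻¹ s)) ⋙ F) ⋙ (Kcat.act (blockPerm σ j)).toFunctor)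
        (Kcat_cast (Equiv.sum_comp σ⁻¹ j)).symm)
    refine under_functor_ext
      (fun t => (Equiv.sum_comp σ⁻¹ fun s => ((y s).obj t).right.card).symm) (fun t => ?_) fun t t'
          f => ?_
    · exact oplusHom_blockPerm_mul (X := fun s => NCSet.mk (j s)) (x.obj t).as σ fun s =>
          ((y s).obj t).hom
    · exact blockPerm_mul_map (x.obj t).as (x.obj t').as σ fun s => ((y s).map f).right
  equivariance_B {n j N} τ x y := by
    refine under_functor_ext (fun t => rfl) (fun t => ?_) fun t t' f => ?_
    · have h := oplusHom_comp (X := fun s => NCSet.mk (j s)) (Y := fun s => NCSet.mk (j s))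
        (fun s => permHom (τ s)) fun s => ((y s).obj t).hom
      rw [oplusHom_permHom] at h
      refine (Category.comp_id _).trans ((congrArg (· ≫ permHom (blockPerm (x.obj t).as
        fun s => ((y s).obj t).right.card)) h).trans (Category.assoc _ _ _))
    · exact (Category.comp_id _).trans (Category.id_comp _).symm

/-! ### The axioms for the functors `δ` -/

lemma permHom_permCongr {a b : ℕ} (h : a = b) (σ : Equiv.Perm (Fin a)) :
    permHom ((finCongr h).permCongr σ) = castHom h.symm ≫ permHom σ ≫ castHom h := by
  subst h
  rw [castHom_rfl, Category.comp_id, Category.id_comp]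
  rfl

lemma Dcat_cast_obj {a b : ℕ} (h : a = b) (σ : Codiscrete (Equiv.Perm (Fin a))) :
    ((Dcat.cast h).toFunctor.obj σ).as = (finCongr h).permCongr σ.as := by
  subst h
  rfl

/-- Functors to `E S_m` agree if they agree on objects. -/
lemma dcat_functor_ext {T : Type*} [Category T] {m : ℕ} {A B : T ⥤ Dcat.obj m}
    (h : ∀ t, permHom (A.obj t).as = permHom (B.obj t).as) : A = B :=
  CategoryTheory.Functor.ext (fun t => Codiscrete.ext (permHom_injective (h t))) fun _ _ _ => rfl

lemma permHom_mul_sumPerm {m : ℕ} {j : Fin m → ℕ} (σ : Equiv.Perm (Fin (∑ s, j s)))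
    (τ : ∀ s, Equiv.Perm (Fin (j s))) : permHom (σ * sumPerm τ) =
      oplusHom (X := fun s => NCSet.mk (j s)) (fun s => permHom (τ s)) ≫ permHom σ := by
  rw [permHom_mul, oplusHom_permHom]

lemma sumPerm_mul {m : ℕ} {j : Fin m → ℕ} (σ τ : ∀ s, Equiv.Perm (Fin (j s))) :
    sumPerm (fun s => σ s * τ s) = sumPerm σ * sumPerm τ := by
  refine Equiv.ext fun x => ?_
  obtain ⟨x, rfl⟩ := finSigmaFinEquiv.surjective x
  rw [Equiv.Perm.mul_apply, sumPerm_apply, sumPerm_apply, sumPerm_apply]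
  rfl

/-- `D_cat` is an operad, apart from the right unit condition.  The axioms are those for `μ`,
applied to permutations as morphisms of non-commutative sets. -/
lemma nerveLaws_deltaCat : NerveLaws (P := Dcat) (M := Dcat) deltaCat ⟨1⟩ deltaCat where
  assoc {n j i N} x y z := by
    refine dcat_functor_ext fun t => ?_
    refine (congrArg permHom (Dcat_cast_obj (sum_blockOf i) _)).trans
      ((permHom_permCongr _ _).trans ?_)
    have h := mu_assoc (X := fun s r => NCSet.mk (i s r)) (fun s r => permHom ((z s r).obj t).as)
      (x.obj t).as fun s => ((y s).obj t).as
    refine (congrArg (fun g => castHom _ ≫ g ≫ castHom _) (permHom_mul_sumPerm _ _)).trans ?_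
    refine ((congrArg (castHom (sum_blockOf i).symm ≫ ·) h).trans ?_)
    rw [← Category.assoc, castHom_comp]
    refine (Category.id_comp _).trans (Eq.trans ?_ (permHom_mul_sumPerm _ _).symm)
    exact congrArg (fun g => oplusHom (X := fun s => NCSet.mk (∑ r, i s r)) g ≫ permHom _)
      (funext fun s => (permHom_mul_sumPerm _ _).symm)
  left_unit {j N} x h := by
    refine dcat_functor_ext fun t => ?_
    refine (congrArg permHom (Dcat_cast_obj h _)).trans ((permHom_permCongr _ _).trans ?_)
    have h1 := oplusHom_one (permHom (x.obj t).as) h h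
    refine (congrArg (fun g => castHom _ ≫ g ≫ castHom _) (permHom_mul_sumPerm _ _)).trans ?_
    change castHom h.symm ≫ (_ ≫ permHom (blockPerm 1 fun _ => j)) ≫ castHom _ = _
    rw [blockPerm_one, permHom_one, Category.comp_id]
    refine (congrArg (castHom h.symm ≫ ·) h1).trans ((Category.assoc _ _ _).symm.trans ?_)
    rw [castHom_comp]
    exact Category.id_comp _
  equivariance_A {n j N} σ x y := by
    refine dcat_functor_ext fun t => ?_
    have h := oplusHom_blockPerm_mul (X := fun s => NCSet.mk (j s)) (x.obj t).as σ
      fun s => permHom ((y s).obj t).as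
    refine (permHom_mul_sumPerm _ _).trans (Eq.trans ?_ (permHom_mul _ _).symm)
    refine Eq.trans ?_ (congrArg (permHom (blockPerm σ j) ≫ ·)
      ((congrArg permHom (Dcat_cast_obj (Equiv.sum_comp σ⁻¹ j) _)).trans
      ((permHom_permCongr _ _).trans
        (congrArg (fun g => castHom _ ≫ g ≫ castHom _) (permHom_mul_sumPerm _ _))))).symm
    have h' := congrArg (· ≫ castHom (Equiv.sum_comp σ⁻¹ j)) h
    refine Eq.trans ?_ (h'.trans ?_)
    · refine Eq.trans ?_ (Category.assoc _ _ _).symm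
      rw [castHom_comp]
      exact (Category.comp_id _).symm
    · simp only [Category.assoc]
      rfl
  equivariance_B {n j N} τ x y := by
    refine dcat_functor_ext fun t => congrArg permHom ?_
    refine (congrArg (blockPerm (x.obj t).as j * ·)
      (sumPerm_mul (fun s => ((y s).obj t).as) τ)).trans (mul_assoc _ _ _).symm

/-- The right unit axiom for `δ`: `σ{1,…,1} = σ`. -/
lemma deltaCat_right_unit {j N : ℕ} (h : ∑ _s : Fin j, 1 = j)
    (x : ComposableArrows (Dcat.obj j) N) :
    nerveAct (deltaCat j fun _ => 1) N (x, fun _ => (Functor.const _).obj ⟨1⟩) ⋙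
      (Dcat.cast h).toFunctor = x := by
  refine dcat_functor_ext fun t => congrArg permHom ?_
  refine (Dcat_cast_obj h _).trans (Equiv.ext fun a => ?_)
  have key (a : Fin j) : Fin.cast h.symm a = finSigmaFinEquiv (⟨a, 0⟩ : Σ _ : Fin j, Fin 1) :=
    (cast_eq_of_strictMono h.symm (f := fun a => finSigmaFinEquiv (⟨a, 0⟩ : Σ _ : Fin j, Fin 1))
      (fun a b hab => finSigmaFinEquiv_lt (Sigma.Lex.left _ _ hab)) a).symm
  have h1 := perm_eq_of_lt h.symm (x.obj t).as
    (blockPerm (x.obj t).as (fun _ => 1) * sumPerm fun _ => 1) (fun a b hab => ?_) a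
  · exact congrArg (Fin.cast h) h1
  · rw [key, key, Equiv.Perm.mul_apply, Equiv.Perm.mul_apply, sumPerm_apply, sumPerm_apply,
      blockPerm_lt_iff]
    exact Sigma.Lex.left _ _ hab

end SymHomology

end

theorem mainTheorem8 (k : Type u) [CommRing k] :
    ∃ (O : OperadStructure (Dch k)) (M : OperadModule O (Kch k)),
      (∀ (m : ℕ) (j : Fin m → ℕ) (p : ℕ) (q : Fin m → ℕ)
        (x : nerve (Codiscrete (Equiv.Perm (Fin m))) _⦋p⦌ →₀ k)
        (y : ∀ s, nerve (Codiscrete (Equiv.Perm (Fin (j s)))) _⦋q s⦌ →₀ k),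
        O.γ.app (n := m) (j := j) rfl (chainClass x) (fun s => chainClass (y s)) =
          inducedChain (deltaCat m j) p q x y) ∧
      (O.η.f 0).hom (unitElem k) = chainClass (p := 0)
        (Finsupp.single (ComposableArrows.mk₀ (Codiscrete.mk (1 : Equiv.Perm (Fin 1)))) 1) ∧
      (∀ (m : ℕ) (j : Fin m → ℕ) (p : ℕ) (q : Fin m → ℕ)
        (x : nerve (Codiscrete (Equiv.Perm (Fin m))) _⦋p⦌ →₀ k)
        (y : ∀ s, nerve (Under (NCSet.mk (j s))) _⦋q s⦌ →₀ k),
        M.μ.app (n := m) (j := j) rfl (chainClass x) (fun s => chainClass (y s)) =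
          inducedChain (muCat m j) p q x y) := by
  let O : OperadStructure (Dch k) :=
    { γ := chainStructure (P := Dcat) (M := Dcat) deltaCat
      η := chainUnit Dcat ⟨1⟩
      obj_zero := nonempty_obj_zero_iso
      laws := moduleLaws_chainStructure nerveLaws_deltaCat
      right_unit := fun x => right_unit_chainStructure (P := Dcat) (G := deltaCat)
          (e := ⟨1⟩) (by simp)
        (deltaCat_right_unit _) x _ }
  let M : OperadModule O (Kch k) :=
    { μ := chainStructure (P := Dcat) (M := Kcat) muCat
      laws := moduleLaws_chainStructure nerveLaws_muCat }
  exact ⟨O, M, fun m j p q x y => chainStructure_app (P := Dcat) (M := Dcat) deltaCat rfl x y,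
    chainUnit_unitElem Dcat ⟨1⟩,
    fun m j p q x y => chainStructure_app (P := Dcat) (M := Kcat) muCat rfl x y⟩
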